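/- Conventions. Let $(M^6,g)$ be a closed Riemannian six-manifold with Levi-Civita connection $\nabla$, Riemann curvature tensor $R_{ijkl}$ (normalized so that $R_{ijkl}=g_{ik}g_{jl}-g_{il}g_{jk}$ on the unit sphere), Ricci tensor $R_{ij}=R_{isj}{}^{s}$ and scalar curvature $R$. Put $J=\frac{1}{10}R$ and $$P_{ij}=\tfrac14\left(R_{ij}-Jg_{ij}\right),\qquad W_{ijkl}=R_{ijkl}-P_{ik}g_{jl}-P_{jl}g_{ik}+P_{il}g_{jk}+P_{jk}g_{il},$$ $$C_{ijk}=\nabla_iP_{jk}-\nabla_jP_{ik},\qquad B_{ij}=\nabla^sC_{sij}+W_{isjt}P^{st}$$ (Schouten, Weyl, Cotton and Bach tensors; $J=P_s{}^s$). With $\Delta=\nabla^s\nabla_s$, $\delta$ the divergence, and norms and inner products given by full contraction, define \begin{align*} \mathcal{Q}(M,g)&=\int_M\Bigl(-\Delta^2J+4\Delta J^2-8\delta(P(\nabla J))+4\Delta|P|^2-8J^3+24J|P|^2-16\operatorname{tr}P^3-8\langle B,P\rangle\Bigr)\,\mathrm{dvol}_g,\\ \mathcal{L}_1(M,g)&=\int_M\Bigl(2\Delta|W|^2-48\nabla^l(W_{ijkl}C^{ijk})+|\nabla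 W|^2+48P_t^sW_{sijk}W^{tijk}-8J|W|^2-64|C|^2\Bigr)\,\mathrm{dvol}_g,\\ \mathcal{L}_2(M,g)&=\int_M\Bigl(\tfrac12\Delta|W|^2-8\nabla^l(W_{ijkl}C^{ijk})+8P_t^sW_{sijk}W^{tijk}-2J|W|^2-8|C|^2\Bigr)\,\mathrm{dvol}_g. \end{align*} A metric $g$ is conformally Einstein if $e^{2u}g$ is Einstein for some smooth function $u$ on $M$. Proposition. Let $(S^k,d\theta^2)$ be the round unit $k$-sphere (constant sectional curvature one), and let $(T^k,dx^2)=\mathbb{R}^k/\Lambda$ be any $k$-dimensional flat torus, where $\Lambda\subset\mathbb{R}^k$ is a lattice of full rank. Then the Riemannian products satisfy \begin{align*} \mathcal{Q}(S^2\times T^4,d\theta^2+dx^2)&=-\frac{48\pi}{25}\mathrm{Vol}_{dx^2}(T^4),\\ \mathcal{L}_1(T^2\times S^4,dx^2+d\theta^2)&=-96\pi^2\,\mathrm{Vol}_{dx^2}(T^2),\\ \mathcal{L}_2(T^2\times S^4,dx^2+d\theta^2)&=-\frac{528\pi^2}{25}\mathrm{Vol}_{dx^2}(T^2). \end{align*}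 In particular, each of $\mathcal{Q}$, $\mathcal{L}_1$, $\mathcal{L}_2$ is a nontrivial obstruction to the existence of an Einstein metric on a closed six-manifold with infinite fundamental group, in the sense that it is negative on some such Riemannian manifold: $S^2\times T^4$ and $T^2\times S^4$ are closed connected six-manifolds with infinite fundamental group, $\mathcal{Q}(S^2\times T^4,d\theta^2+dx^2)<0$, $\mathcal{L}_1(T^2\times S^4,dx^2+d\theta^2)<0$ and $\mathcal{L}_2(T^2\times S^4,dx^2+d\theta^2)<0$. Moreover, the product metric on $T^2\times S^4$ is not conformally Einstein. -/

import Mathlib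

open Bundle Manifold MeasureTheory
open scoped ContDiff

noncomputable section

/-! ## Tensor calculus of a Riemannian metric on an open set of coordinates

`ι → ℝ` is the space of coordinates and `G y` is the Gram matrix `g_{ij}(y)`. A covariant tensor
field of rank `r` is given by its components. -/

namespace CoordGeometry

variable {ι : Type*} [Fintype ι] [DecidableEq ι]

/-- Components of a covariant tensor field of rank `r`. -/
abbrev TensorField (ι : Type*) (r : ℕ) : Type _ := (ι → ℝ) → (Fin r → ι) → ℝ

/-- The partial derivative `∂_i f`. -/
def partialDeriv (i : ι) (f : (ι → ℝ) → ℝ) (y : ι → ℝ) : ℝ :=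
  fderiv ℝ f y (Pi.single i 1)

variable (G : (ι → ℝ) → Matrix ι ι ℝ)

/-- The Christoffel symbol `Γ^k_{ij}`. -/
def christoffel (k i j : ι) (y : ι → ℝ) : ℝ :=
  (1 / 2) * ∑ l, (G y)⁻¹ k l *
    (partialDeriv i (fun z => G z j l) y + partialDeriv j (fun z => G z i l) y
      - partialDeriv l (fun z => G z i j) y)

/-- The covariant derivative, the new index coming first: `(∇T)_{i a} = ∇_i T_a`. -/
def covDeriv {r : ℕ} (T : TensorField ι r) : TensorField ι (r + 1) := fun y a =>
  partialDeriv (a 0) (fun z => T z (Fin.tail a)) y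
    - ∑ p : Fin r, ∑ m, christoffel G m (a 0) (Fin.tail a p) y *
        T y (Function.update (Fin.tail a) p m)

/-- The inner product of two tensor fields (full contraction, no combinatorial factor). -/
def tensorInner {r : ℕ} (S T : TensorField ι r) (y : ι → ℝ) : ℝ :=
  ∑ a : Fin r → ι, ∑ b : Fin r → ι, (∏ p, (G y)⁻¹ (a p) (b p)) * S y a * T y b

/-- The trace `g^{ij} T_{ij}`. -/
def trace₂ (T : TensorField ι 2) (y : ι → ℝ) : ℝ :=
  ∑ i, ∑ j, (G y)⁻¹ i j * T y ![i, j]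

/-- The differential `∇_i f` of a function. -/
def grad (f : (ι → ℝ) → ℝ) : TensorField ι 1 := fun y a => partialDeriv (a 0) f y

/-- The divergence `δη = ∇^i η_i` of a one-form. -/
def divergence (η : TensorField ι 1) : (ι → ℝ) → ℝ := trace₂ G (covDeriv G η)

/-- The Laplacian `Δf = ∇^i ∇_i f`. -/
def laplacian (f : (ι → ℝ) → ℝ) : (ι → ℝ) → ℝ := divergence G (grad f)

/-- The curvature `R_{ijkl} = g(R(∂_i, ∂_j) ∂_l, ∂_k)`, with
`R(X, Y) = [∇_X, ∇_Y] - ∇_{[X, Y]}`; the round unit sphere has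
`R_{ijkl} = g_{ik} g_{jl} - g_{il} g_{jk}`. -/
def riemann : TensorField ι 4 := fun y a =>
  ∑ m, G y (a 2) m *
    (partialDeriv (a 0) (christoffel G m (a 1) (a 3)) y
      - partialDeriv (a 1) (christoffel G m (a 0) (a 3)) y
      + ∑ s, (christoffel G m (a 0) s y * christoffel G s (a 1) (a 3) y
          - christoffel G m (a 1) s y * christoffel G s (a 0) (a 3) y))

/-- The Ricci tensor `R_{ij} = R_{isj}{}^s`. -/
def ricci : TensorField ι 2 := fun y a =>
  ∑ s, ∑ t, (G y)⁻¹ s t * riemann G y ![a 0, s, a 1, t]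

/-- `J = R / (2 (n - 1))`, where `R` is the scalar curvature; this is the trace of the Schouten
tensor. -/
def schoutenTrace (y : ι → ℝ) : ℝ :=
  trace₂ G (ricci G) y / (2 * ((Fintype.card ι : ℝ) - 1))

/-- The Schouten tensor `P_{ij} = (R_{ij} - J g_{ij}) / (n - 2)`. -/
def schouten : TensorField ι 2 := fun y a =>
  (ricci G y a - schoutenTrace G y * G y (a 0) (a 1)) / ((Fintype.card ι : ℝ) - 2)

/-- The Weyl tensor
`W_{ijkl} = R_{ijkl} - P_{ik} g_{jl} - P_{jl} g_{ik} + P_{il} g_{jk} + P_{jk} g_{il}`. -/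
def weyl : TensorField ι 4 := fun y a =>
  riemann G y a
    - schouten G y ![a 0, a 2] * G y (a 1) (a 3) - schouten G y ![a 1, a 3] * G y (a 0) (a 2)
    + schouten G y ![a 0, a 3] * G y (a 1) (a 2) + schouten G y ![a 1, a 2] * G y (a 0) (a 3)

/-- The Cotton tensor `C_{ijk} = ∇_i P_{jk} - ∇_j P_{ik}`. -/
def cotton : TensorField ι 3 := fun y a =>
  covDeriv G (schouten G) y ![a 0, a 1, a 2] - covDeriv G (schouten G) y ![a 1, a 0, a 2]

/-- The Bach tensor `B_{ij} = ∇^s C_{sij} + W_{isjt} P^{st}`. -/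
def bach : TensorField ι 2 := fun y a =>
  (∑ s, ∑ t, (G y)⁻¹ s t * covDeriv G (cotton G) y ![s, t, a 0, a 1])
    + ∑ s, ∑ t, ∑ u, ∑ v, (G y)⁻¹ s u * (G y)⁻¹ t v *
        weyl G y ![a 0, s, a 1, t] * schouten G y ![u, v]

/-- The one-form `P(∇J)_i = P_i{}^s ∇_s J`. -/
def schoutenGradJ : TensorField ι 1 := fun y a =>
  ∑ s, ∑ t, (G y)⁻¹ s t * schouten G y ![a 0, s] * grad (schoutenTrace G) y ![t]

/-- `tr P³ = P_i{}^j P_j{}^k P_k{}^i`. -/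
def schoutenCubed (y : ι → ℝ) : ℝ :=
  (((G y)⁻¹ * Matrix.of fun i j => schouten G y ![i, j]) ^ 3).trace

/-- The two-tensor `W_{sijk} W_t{}^{ijk}`. -/
def weylSquare : TensorField ι 2 := fun y a =>
  ∑ c : Fin 3 → ι, ∑ d : Fin 3 → ι, (∏ p, (G y)⁻¹ (c p) (d p)) *
    weyl G y ![a 0, c 0, c 1, c 2] * weyl G y ![a 1, d 0, d 1, d 2]

/-- The one-form `W_{ijkl} C^{ijk}` (free index `l`). -/
def weylCotton : TensorField ι 1 := fun y a =>
  ∑ c : Fin 3 → ι, ∑ d : Fin 3 → ι, (∏ p, (G y)⁻¹ (c p) (d p)) *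
    weyl G y ![c 0, c 1, c 2, a 0] * cotton G y d

/-- `Q = -Δ²J + 4ΔJ² - 8δ(P(∇J)) + 4Δ|P|² - 8J³ + 24J|P|² - 16 tr P³ - 8⟨B, P⟩`. -/
def qDensity (y : ι → ℝ) : ℝ :=
  - laplacian G (laplacian G (schoutenTrace G)) y
    + 4 * laplacian G (fun z => schoutenTrace G z ^ 2) y
    - 8 * divergence G (schoutenGradJ G) y
    + 4 * laplacian G (tensorInner G (schouten G) (schouten G)) y
    - 8 * schoutenTrace G y ^ 3
    + 24 * schoutenTrace G y * tensorInner G (schouten G) (schouten G) y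
    - 16 * schoutenCubed G y
    - 8 * tensorInner G (bach G) (schouten G) y

/-- `L₁ = 2Δ|W|² - 48∇^l(W_{ijkl}C^{ijk}) + |∇W|² + 48 P_t^s W_{sijk}W^{tijk} - 8J|W|² - 64|C|²`. -/
def l₁Density (y : ι → ℝ) : ℝ :=
  2 * laplacian G (tensorInner G (weyl G) (weyl G)) y
    - 48 * divergence G (weylCotton G) y
    + tensorInner G (covDeriv G (weyl G)) (covDeriv G (weyl G)) y
    + 48 * tensorInner G (schouten G) (weylSquare G) y
    - 8 * schoutenTrace G y * tensorInner G (weyl G) (weyl G) y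
    - 64 * tensorInner G (cotton G) (cotton G) y

/-- `L₂ = ½Δ|W|² - 8∇^l(W_{ijkl}C^{ijk}) + 8 P_t^s W_{sijk}W^{tijk} - 2J|W|² - 8|C|²`. -/
def l₂Density (y : ι → ℝ) : ℝ :=
  (1 / 2) * laplacian G (tensorInner G (weyl G) (weyl G)) y
    - 8 * divergence G (weylCotton G) y
    + 8 * tensorInner G (schouten G) (weylSquare G) y
    - 2 * schoutenTrace G y * tensorInner G (weyl G) (weyl G) y
    - 8 * tensorInner G (cotton G) (cotton G) y

end CoordGeometry

/-! ## Riemannian manifolds -/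

section Manifold

variable {E : Type*} [NormedAddCommGroup E] [NormedSpace ℝ E]
  {H : Type*} [TopologicalSpace H] {I : ModelWithCorners ℝ E H}
  {M : Type*} [TopologicalSpace M] [ChartedSpace H M] [IsManifold I ∞ M]
  {ι : Type*} [Fintype ι] [DecidableEq ι]

/-- A smooth Riemannian metric on the manifold `M`. -/
abbrev RiemMetric (I : ModelWithCorners ℝ E H) (M : Type*) [TopologicalSpace M]
    [ChartedSpace H M] [IsManifold I ∞ M] : Type _ :=
  ContMDiffRiemannianMetric I ∞ E (fun x : M => TangentSpace I x)

/-- The coordinates `M → (ι → ℝ)` around `x` given by the preferred chart at `x` and a basis of the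
model vector space. -/
def coord (I : ModelWithCorners ℝ E H) (b : Module.Basis ι ℝ E) (x z : M) : ι → ℝ :=
  b.equivFun (extChartAt I x z)

/-- The range of the coordinates around `x`. -/
def coordTarget (I : ModelWithCorners ℝ E H) (b : Module.Basis ι ℝ E) (x : M) : Set (ι → ℝ) :=
  b.equivFun.symm ⁻¹' (extChartAt I x).target

/-- The parametrization of a neighbourhood of `x` by coordinates, inverse to `coord`. -/
def param (I : ModelWithCorners ℝ E H) (b : Module.Basis ι ℝ E) (x : M) (y : ι → ℝ) : M :=
  (extChartAt I x).symm (b.equivFun.symm y)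

/-- The Gram matrix of the metric in the coordinates around `x`. -/
def gram (b : Module.Basis ι ℝ E) (g : RiemMetric I M) (x : M) (y : ι → ℝ) : Matrix ι ι ℝ :=
  Matrix.of fun i j =>
    g.inner (param I b x y)
      (mfderiv 𝓘(ℝ, ι → ℝ) I (param I b x) y (Pi.single i (1 : ℝ) : ι → ℝ))
      (mfderiv 𝓘(ℝ, ι → ℝ) I (param I b x) y (Pi.single j (1 : ℝ) : ι → ℝ))

/-- The Riemannian volume measure: in the coordinates around each point it is `√(det g) dy`. The
measures defined by the various charts agree on overlaps and are glued by taking their supremum. -/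
def riemVolume (b : Module.Basis ι ℝ E) (g : RiemMetric I M) : @Measure M (borel M) :=
  ⨆ x : M, @Measure.map (ι → ℝ) M _ (borel M) (param I b x)
    ((volume.restrict (coordTarget I b x)).withDensity
      fun y => ENNReal.ofReal (Real.sqrt (gram b g x y).det))

/-- The total volume of a Riemannian manifold. -/
def riemVol (b : Module.Basis ι ℝ E) (g : RiemMetric I M) : ℝ :=
  (@Measure.real M (borel M) (riemVolume b g) Set.univ)

/-- The integral over `M` of the local scalar invariant which is given by `F` in coordinates. -/
def totalIntegral (b : Module.Basis ι ℝ E) (g : RiemMetric I M)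
    (F : ((ι → ℝ) → Matrix ι ι ℝ) → (ι → ℝ) → ℝ) : ℝ :=
  @integral M ℝ _ _ (borel M) (riemVolume b g) fun x => F (gram b g x) (coord I b x x)

/-- The total integral `𝒬(M, g)`. -/
def invariantQ (b : Module.Basis ι ℝ E) (g : RiemMetric I M) : ℝ :=
  totalIntegral b g CoordGeometry.qDensity

/-- The total integral `ℒ₁(M, g)`. -/
def invariantL₁ (b : Module.Basis ι ℝ E) (g : RiemMetric I M) : ℝ :=
  totalIntegral b g CoordGeometry.l₁Density

/-- The total integral `ℒ₂(M, g)`. -/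
def invariantL₂ (b : Module.Basis ι ℝ E) (g : RiemMetric I M) : ℝ :=
  totalIntegral b g CoordGeometry.l₂Density

/-- `g` is Einstein: `Ric = c g` for some real constant `c`. -/
def IsEinstein (b : Module.Basis ι ℝ E) (g : RiemMetric I M) : Prop :=
  ∃ c : ℝ, ∀ (x : M) (i j : ι),
    CoordGeometry.ricci (gram b g x) (coord I b x x) ![i, j] = c * gram b g x (coord I b x x) i j

/-- `g` is conformally Einstein: some metric `e^{2u} g`, with `u` smooth, is Einstein. -/
def IsConformallyEinstein (b : Module.Basis ι ℝ E) (g : RiemMetric I M) : Prop :=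
  ∃ (u : M → ℝ) (g' : RiemMetric I M), ContMDiff I 𝓘(ℝ, ℝ) ∞ u ∧
    (∀ (x : M) (v w : TangentSpace I x),
      g'.inner x v w = Real.exp (2 * u x) * g.inner x v w) ∧
    IsEinstein b g'

end Manifold

/-! ## Construction of smooth metrics -/

section Construction

variable {E : Type*} [NormedAddCommGroup E] [NormedSpace ℝ E] [FiniteDimensional ℝ E]
  {H : Type*} [TopologicalSpace H] {I : ModelWithCorners ℝ E H}
  {M : Type*} [TopologicalSpace M] [ChartedSpace H M] [IsManifold I ∞ M]

/-- The unit ball of a positive definite form on a finite-dimensional space is bounded. -/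
theorem isVonNBounded_of_pos (B : E →L[ℝ] E →L[ℝ] ℝ) (hB : ∀ v, v ≠ 0 → 0 < B v v) :
    Bornology.IsVonNBounded ℝ {v : E | B v v < 1} := by
  rw [NormedSpace.isVonNBounded_iff]
  have hc : Continuous fun v : E => B v v := by fun_prop
  have : ProperSpace E := FiniteDimensional.proper ℝ E
  rcases (Metric.sphere (0 : E) 1).eq_empty_or_nonempty with he | hne
  · have hz : ∀ v : E, v = 0 := by
      intro v
      by_contra hv
      have : (‖v‖⁻¹ • v) ∈ Metric.sphere (0 : E) 1 := by
        simp [norm_smul, inv_mul_cancel₀ (norm_ne_zero_iff.2 hv)]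
      rw [he] at this
      exact this
    exact (Bornology.isBounded_singleton (x := (0 : E))).subset fun v _ => hz v
  · obtain ⟨v₀, hv₀, hmin⟩ := (isCompact_sphere (0 : E) 1).exists_isMinOn hne hc.continuousOn
    have hv₀' : v₀ ≠ 0 := by
      rintro rfl
      simp at hv₀
    have hpos := hB v₀ hv₀'
    refine (Metric.isBounded_iff_subset_closedBall (0 : E)).2 ⟨Real.sqrt (B v₀ v₀)⁻¹, ?_⟩
    intro v hv
    rw [mem_closedBall_zero_iff]
    by_cases h0 : v = 0
    · subst h0
      simp
    · apply Real.le_sqrt_of_sq_le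
      have hn : 0 < ‖v‖ := norm_pos_iff.2 h0
      have hs : (‖v‖⁻¹ • v) ∈ Metric.sphere (0 : E) 1 := by
        simp [norm_smul, inv_mul_cancel₀ hn.ne']
      have h1 : B v₀ v₀ ≤ B (‖v‖⁻¹ • v) (‖v‖⁻¹ • v) := hmin hs
      have h2 : B (‖v‖⁻¹ • v) (‖v‖⁻¹ • v) = (‖v‖ ^ 2)⁻¹ * B v v := by
        simp
        field_simp
      rw [h2] at h1
      have hv1 : B v v < 1 := hv
      rw [le_inv_comm₀ (by positivity) hpos]
      calc B v₀ v₀ ≤ (‖v‖ ^ 2)⁻¹ * B v v := h1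
        _ ≤ (‖v‖ ^ 2)⁻¹ * 1 := by gcongr
        _ = _ := by ring

/-- A field of bilinear forms is smooth as soon as its values on local frames are. -/
theorem contMDiff_of_frame
    (B : ∀ x : M, TangentSpace I x →L[ℝ] TangentSpace I x →L[ℝ] ℝ)
    (h : ∀ (x₀ : M) (v w : E), ContMDiffAt I 𝓘(ℝ, ℝ) ∞
      (fun x => B x ((trivializationAt E (TangentSpace I) x₀).symm x v)
        ((trivializationAt E (TangentSpace I) x₀).symm x w)) x₀) :
    ContMDiff I (I.prod 𝓘(ℝ, E →L[ℝ] E →L[ℝ] ℝ)) ∞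
      (fun x => TotalSpace.mk' (E →L[ℝ] E →L[ℝ] ℝ)
        (E := fun x : M => TangentSpace I x →L[ℝ] TangentSpace I x →L[ℝ] ℝ) x (B x)) := by
  intro x₀
  rw [contMDiffAt_hom_bundle]
  refine ⟨contMDiffAt_id, ?_⟩
  let b := Module.finBasis ℝ E
  let c : Fin (Module.finrank ℝ E) → E →L[ℝ] ℝ := fun i => LinearMap.toContinuousLinearMap (b.coord i)
  have key : ContMDiffAt I 𝓘(ℝ, E →L[ℝ] E →L[ℝ] ℝ) ∞ (fun x => ∑ i, ∑ j,
      (B x ((trivializationAt E (TangentSpace I) x₀).symm x (b i))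
        ((trivializationAt E (TangentSpace I) x₀).symm x (b j))) • (c i).smulRight (c j)) x₀ := by
    refine ContMDiffAt.sum fun i _ => ContMDiffAt.sum fun j _ => ?_
    exact (h x₀ (b i) (b j)).smul contMDiffAt_const
  refine key.congr_of_eventuallyEq ?_
  have hbase : (trivializationAt E (TangentSpace I) x₀).baseSet ∈ nhds x₀ :=
    (trivializationAt E (TangentSpace I) x₀).open_baseSet.mem_nhds
      (FiberBundle.mem_baseSet_trivializationAt' x₀)
  filter_upwards [hbase] with x hx
  ext v w
  rw [inCoordinates_apply_eq₂ (F₃ := ℝ) (E₃ := fun _ : M => ℝ) hx hx (by simp)]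
  have hv : v = ∑ i, c i v • b i := (b.sum_repr v).symm
  have hw : w = ∑ i, c i w • b i := (b.sum_repr w).symm
  set e := trivializationAt E (TangentSpace I : M → Type _) x₀ with he
  have hs : ∀ u : E, e.symm x u = e.symmL ℝ x u := fun u => (e.symmL_apply hx u).symm
  simp only [hs]
  conv_lhs => rw [hv, hw]
  have ht : ∀ r : ℝ, (trivializationAt ℝ (fun _ : M => ℝ) x₀).linearMapAt ℝ x r = r := fun r => by
    simp
  rw [ht]
  simp only [map_sum, map_smul, sum_apply, smul_apply,
    ContinuousLinearMap.smulRight_apply, smul_eq_mul, Finset.mul_sum]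
  rw [Finset.sum_comm]
  refine Finset.sum_congr rfl fun i _ => Finset.sum_congr rfl fun j _ => ?_
  ring

/-- The smoothness of `x ↦ g_{f x}(V x, W x)` for vector fields `V`, `W` along `f`. -/
theorem RiemMetric.contMDiffAt_apply
    {E' : Type*} [NormedAddCommGroup E'] [NormedSpace ℝ E']
    {H' : Type*} [TopologicalSpace H'] {I' : ModelWithCorners ℝ E' H'}
    {N : Type*} [TopologicalSpace N] [ChartedSpace H' N]
    (g : RiemMetric I M) {f : N → M} {V W : ∀ x : N, TangentSpace I (f x)} {x₀ : N}
    (hV : ContMDiffAt I' I.tangent ∞ (fun x => TotalSpace.mk' E (f x) (V x)) x₀)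
    (hW : ContMDiffAt I' I.tangent ∞ (fun x => TotalSpace.mk' E (f x) (W x)) x₀) :
    ContMDiffAt I' 𝓘(ℝ, ℝ) ∞ (fun x => g.inner (f x) (V x) (W x)) x₀ := by
  have hf : ContMDiffAt I' I ∞ f x₀ := (contMDiffAt_totalSpace.1 hV).1
  have h : ContMDiffAt I' (I.prod 𝓘(ℝ, ℝ)) ∞
      (fun m => TotalSpace.mk' ℝ (E := Bundle.Trivial M ℝ) (f m) (g.inner (f m) (V m) (W m))) x₀ := by
    apply ContMDiffAt.clm_bundle_apply₂ (F₁ := E) (F₂ := E)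
    · exact ContMDiffAt.comp x₀ g.contMDiff.contMDiffAt hf
    · exact hV
    · exact hW
  exact (contMDiffAt_totalSpace.1 h).2

/-- The local frames of the tangent bundle are smooth. -/
theorem contMDiffAt_frame (x₀ : M) (v : E) :
    ContMDiffAt I I.tangent ∞ (fun x : M => TotalSpace.mk' E (E := TangentSpace I) x
      ((trivializationAt E (TangentSpace I) x₀).symm x v)) x₀ := by
  set e := trivializationAt E (TangentSpace I : M → Type _) x₀
  have hx₀ : x₀ ∈ e.baseSet := FiberBundle.mem_baseSet_trivializationAt' x₀
  refine (e.contMDiffAt_section_iff hx₀).2 ?_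
  refine (contMDiffAt_const (c := v)).congr_of_eventuallyEq ?_
  filter_upwards [e.open_baseSet.mem_nhds hx₀] with x hx
  rw [e.apply_mk_symm hx]

variable {E' : Type*} [NormedAddCommGroup E'] [NormedSpace ℝ E'] [FiniteDimensional ℝ E']
  {H' : Type*} [TopologicalSpace H'] {I' : ModelWithCorners ℝ E' H'}
  {N : Type*} [TopologicalSpace N] [ChartedSpace H' N] [IsManifold I' ∞ N]

/-- The pullback of a metric under a smooth map is a smooth field of bilinear forms. -/
theorem RiemMetric.contMDiffAt_pullback (g : RiemMetric I' N) {f : M → N}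
    (hf : ContMDiff I I' ∞ f) (x₀ : M) (v w : E) :
    ContMDiffAt I 𝓘(ℝ, ℝ) ∞ (fun x => g.inner (f x)
      (mfderiv I I' f x ((trivializationAt E (TangentSpace I) x₀).symm x v))
      (mfderiv I I' f x ((trivializationAt E (TangentSpace I) x₀).symm x w))) x₀ := by
  have ht := hf.contMDiff_tangentMap (m := ∞) (by simp)
  apply g.contMDiffAt_apply
  · exact ContMDiffAt.comp x₀ ht.contMDiffAt (contMDiffAt_frame x₀ v)
  · exact ContMDiffAt.comp x₀ ht.contMDiffAt (contMDiffAt_frame x₀ w)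

/-- The bilinear form `B((v, v'), (w, w')) = B₁(v, w) + B₂(v', w')`. -/
def prodForm (B₁ : E →L[ℝ] E →L[ℝ] ℝ) (B₂ : E' →L[ℝ] E' →L[ℝ] ℝ) :
    E × E' →L[ℝ] E × E' →L[ℝ] ℝ :=
  B₁.bilinearComp (ContinuousLinearMap.fst ℝ E E') (ContinuousLinearMap.fst ℝ E E') +
    B₂.bilinearComp (ContinuousLinearMap.snd ℝ E E') (ContinuousLinearMap.snd ℝ E E')

theorem prodForm_pos {B₁ : E →L[ℝ] E →L[ℝ] ℝ} {B₂ : E' →L[ℝ] E' →L[ℝ] ℝ}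
    (h₁ : ∀ v, v ≠ 0 → 0 < B₁ v v) (h₂ : ∀ v, v ≠ 0 → 0 < B₂ v v) (v : E × E') (hv : v ≠ 0) :
    0 < prodForm B₁ B₂ v v := by
  have e : prodForm B₁ B₂ v v = B₁ v.1 v.1 + B₂ v.2 v.2 := rfl
  have n₁ : 0 ≤ B₁ v.1 v.1 := by
    by_cases h : v.1 = 0
    · simp [h]
    · exact (h₁ _ h).le
  have n₂ : 0 ≤ B₂ v.2 v.2 := by
    by_cases h : v.2 = 0
    · simp [h]
    · exact (h₂ _ h).le
  rw [e]
  by_cases h : v.1 = 0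
  · have : v.2 ≠ 0 := fun h' => hv (Prod.ext h h')
    linarith [h₂ _ this]
  · linarith [h₁ _ h]

/-- The Riemannian product metric `g + h` on `M × N`. -/
def RiemMetric.prod (g : RiemMetric I M) (h : RiemMetric I' N) :
    RiemMetric (I.prod I') (M × N) where
  inner p := prodForm (E := E) (E' := E') (g.inner p.1) (h.inner p.2)
  symm p v w := congrArg₂ (· + ·) (g.symm p.1 v.1 w.1) (h.symm p.2 v.2 w.2)
  pos p v hv := prodForm_pos (E := E) (E' := E') (g.pos p.1) (h.pos p.2) v hv
  isVonNBounded p := isVonNBounded_of_pos (E := E × E')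
    (prodForm (E := E) (E' := E') (g.inner p.1) (h.inner p.2))
    (prodForm_pos (E := E) (E' := E') (g.pos p.1) (h.pos p.2))
  contMDiff := by
    apply contMDiff_of_frame
    intro x₀ v w
    have h₁ := g.contMDiffAt_pullback (I := I.prod I') (contMDiff_fst (M := M) (N := N)) x₀ v w
    have h₂ := h.contMDiffAt_pullback (I := I.prod I') (contMDiff_snd (M := M) (N := N)) x₀ v w
    simp only [mfderiv_fst, mfderiv_snd] at h₁ h₂
    exact h₁.add h₂

/-- The bilinear form `(v, w) ↦ B(A v, A w)`. -/
def pullForm (B : E' →L[ℝ] E' →L[ℝ] ℝ) (A : E →L[ℝ] E') : E →L[ℝ] E →L[ℝ] ℝ :=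
  B.bilinearComp A A

/-- The metric induced on an immersed manifold: `(f^* g)_x(v, w) = g_{f x}(df_x v, df_x w)`. -/
def RiemMetric.pullback (g : RiemMetric I' N) (f : M → N) (hf : ContMDiff I I' ∞ f)
    (hinj : ∀ x, Function.Injective (mfderiv I I' f x)) : RiemMetric I M where
  inner x := pullForm (E := E) (E' := E') (g.inner (f x)) (mfderiv I I' f x)
  symm x _ _ := g.symm (f x) _ _
  pos x _ hv := g.pos (f x) _ fun h => hv (hinj x (h.trans (map_zero (mfderiv I I' f x)).symm))
  isVonNBounded x := isVonNBounded_of_pos (E := E)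
    (pullForm (E := E) (E' := E') (g.inner (f x)) (mfderiv I I' f x)) fun _ hv =>
    g.pos (f x) _ fun h => hv (hinj x (h.trans (map_zero (mfderiv I I' f x)).symm))
  contMDiff := contMDiff_of_frame _ fun x₀ v w => g.contMDiffAt_pullback hf x₀ v w

end Construction

/-! ## Round spheres and flat tori -/

/-- The Euclidean metric. -/
def euclideanMetric (n : ℕ) :
    RiemMetric 𝓘(ℝ, EuclideanSpace ℝ (Fin n)) (EuclideanSpace ℝ (Fin n)) :=
  { riemannianMetricVectorSpace (EuclideanSpace ℝ (Fin n)) with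
    contMDiff := (riemannianMetricVectorSpace (EuclideanSpace ℝ (Fin n))).contMDiff.of_le le_top }

/-- The unit sphere `Sⁿ ⊂ ℝⁿ⁺¹`. -/
abbrev RoundSphere (n : ℕ) : Type := Metric.sphere (0 : EuclideanSpace ℝ (Fin (n + 1))) 1

/-- The round metric on the unit sphere, induced by the Euclidean metric of `ℝⁿ⁺¹`. -/
def roundMetric (n : ℕ) : RiemMetric (𝓡 n) (RoundSphere n) :=
  haveI : Fact (Module.finrank ℝ (EuclideanSpace ℝ (Fin (n + 1))) = n + 1) :=
    ⟨finrank_euclideanSpace_fin⟩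
  (euclideanMetric (n + 1)).pullback (fun x : RoundSphere n => (x : EuclideanSpace ℝ (Fin (n + 1))))
    contMDiff_coe_sphere (fun x => injective_mvfderiv_subtypeVal_sphere x)

section Torus

variable {k : ℕ} (Λ : Submodule ℤ (EuclideanSpace ℝ (Fin k)))

/-- The torus `ℝᵏ/Λ`. -/
abbrev FlatTorus : Type := EuclideanSpace ℝ (Fin k) ⧸ Λ.toAddSubgroup

/-- The projection `ℝᵏ → ℝᵏ/Λ`. -/
def torusProj (x : EuclideanSpace ℝ (Fin k)) : FlatTorus Λ := QuotientAddGroup.mk x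

variable [DiscreteTopology Λ]

theorem torusProj_isLocalHomeomorph : IsLocalHomeomorph (torusProj Λ) := by
  have : DiscreteTopology Λ.toAddSubgroup := ‹DiscreteTopology Λ›
  exact (AddSubgroup.isAddQuotientCoveringMap_of_comm Λ.toAddSubgroup
    DiscreteTopology.isDiscrete).isCoveringMap.isLocalHomeomorph

/-- The charts of `ℝᵏ/Λ` are the local inverses of the projection `ℝᵏ → ℝᵏ/Λ`. -/
instance : ChartedSpace (EuclideanSpace ℝ (Fin k)) (FlatTorus Λ) :=
  (torusProj_isLocalHomeomorph Λ).chartedSpace QuotientAddGroup.mk_surjective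

theorem torus_chart_symm (e : OpenPartialHomeomorph (FlatTorus Λ) (EuclideanSpace ℝ (Fin k)))
    (he : e ∈ atlas (EuclideanSpace ℝ (Fin k)) (FlatTorus Λ)) : ⇑e.symm = torusProj Λ := by
  obtain ⟨q, rfl⟩ := he
  simp
  rfl

/-- A change of charts of `ℝᵏ/Λ` is locally a translation. -/
theorem torus_chart_trans (e : OpenPartialHomeomorph (FlatTorus Λ) (EuclideanSpace ℝ (Fin k)))
    (he : e ∈ atlas (EuclideanSpace ℝ (Fin k)) (FlatTorus Λ)) {z : EuclideanSpace ℝ (Fin k)}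
    (hz : torusProj Λ z ∈ e.source) :
    ∃ c, ∀ᶠ y in nhds z, e (torusProj Λ y) = y + c := by
  refine ⟨e (torusProj Λ z) - z, ?_⟩
  have hcont : ContinuousAt (fun y => e (torusProj Λ y) - y) z :=
    ((e.continuousAt hz).comp (torusProj_isLocalHomeomorph Λ).continuous.continuousAt).sub
      continuousAt_id
  have hmem : ∀ᶠ y in nhds z, e (torusProj Λ y) - y ∈ Λ := by
    filter_upwards [(torusProj_isLocalHomeomorph Λ).continuous.continuousAt.preimage_mem_nhds
      (e.open_source.mem_nhds hz)] with y hy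
    have h1 : torusProj Λ (e (torusProj Λ y)) = torusProj Λ y := by
      rw [← torus_chart_symm Λ e he]
      exact e.left_inv (by rwa [torus_chart_symm Λ e he])
    have h2 := (QuotientAddGroup.eq (s := Λ.toAddSubgroup)).1 h1.symm
    have h3 : -y + e (torusProj Λ y) ∈ Λ := h2
    rwa [neg_add_eq_sub] at h3
  obtain ⟨ε, hε, hball⟩ := Metric.isOpen_singleton_iff.1
    (isOpen_discrete {(⟨e (torusProj Λ z) - z, hmem.self_of_nhds⟩ : Λ)})
  have hnear : ∀ᶠ y in nhds z, dist (e (torusProj Λ y) - y) (e (torusProj Λ z) - z) < ε :=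
    hcont (Metric.ball_mem_nhds _ hε)
  filter_upwards [hmem, hnear] with y hy hd
  have h4 := congrArg Subtype.val (hball ⟨_, hy⟩ hd)
  simp only at h4
  rw [← h4]
  abel

instance : IsManifold (𝓡 k) ∞ (FlatTorus Λ) := by
  refine isManifold_of_contDiffOn (𝓡 k) ∞ (FlatTorus Λ) fun e e' he he' => ?_
  rintro z ⟨⟨hz, hz'⟩, -⟩
  have hz1 : torusProj Λ z ∈ e'.source := by
    rw [← torus_chart_symm Λ e he]
    exact hz'
  obtain ⟨c, hc⟩ := torus_chart_trans Λ e' he' hz1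
  have h : ContDiffAt ℝ ∞ (fun y : EuclideanSpace ℝ (Fin k) => y + c) z :=
    contDiffAt_id.add contDiffAt_const
  refine (h.congr_of_eventuallyEq ?_).contDiffWithinAt
  filter_upwards [hc] with y hy
  rw [← hy, ← torus_chart_symm Λ e he]
  rfl

/-- The local frames of `ℝᵏ/Λ` given by the charts are constant. -/
theorem torus_frame (x₀ x : FlatTorus Λ)
    (hx : x ∈ (chartAt (EuclideanSpace ℝ (Fin k)) x₀).source) (v : EuclideanSpace ℝ (Fin k)) :
    (trivializationAt (EuclideanSpace ℝ (Fin k)) (TangentSpace (𝓡 k)) x₀).symm x v = v := by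
  rw [← Trivialization.symmL_apply _ (R := ℝ) (by simpa using hx),
    TangentBundle.symmL_trivializationAt_eq_core hx, tangentBundleCore_coordChange_achart]
  have h0 := chart_mem_atlas (EuclideanSpace ℝ (Fin k)) x₀
  have h1 := chart_mem_atlas (EuclideanSpace ℝ (Fin k)) x
  have hs : torusProj Λ (chartAt (EuclideanSpace ℝ (Fin k)) x₀ x) = x := by
    rw [← torus_chart_symm Λ _ h0]
    exact (chartAt (EuclideanSpace ℝ (Fin k)) x₀).left_inv hx
  obtain ⟨c, hc⟩ := torus_chart_trans Λ _ h1 (z := chartAt (EuclideanSpace ℝ (Fin k)) x₀ x)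
    (by rw [hs]; exact mem_chart_source _ x)
  have hd : HasFDerivAt (extChartAt (𝓡 k) x ∘ (extChartAt (𝓡 k) x₀).symm)
      (ContinuousLinearMap.id ℝ (EuclideanSpace ℝ (Fin k))) (extChartAt (𝓡 k) x₀ x) := by
    refine ((hasFDerivAt_id _).add_const c).congr_of_eventuallyEq ?_
    filter_upwards [hc] with y hy
    simp [torus_chart_symm Λ _ h0, hy]
  have hr : Set.range (𝓡 k) = Set.univ := by simp
  rw [hr, fderivWithin_univ, hd.fderiv]
  rfl

/-- The metric of `ℝᵏ/Λ` induced by the Euclidean metric: tangent vectors of `ℝᵏ/Λ` are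
identified with vectors of `ℝᵏ` through the charts, which are local inverses of the projection. -/
def flatMetric : RiemMetric (𝓡 k) (FlatTorus Λ) where
  inner q := (innerSL ℝ : EuclideanSpace ℝ (Fin k) →L[ℝ] EuclideanSpace ℝ (Fin k) →L[ℝ] ℝ)
  symm q v w := real_inner_comm (F := EuclideanSpace ℝ (Fin k)) w v
  pos q v hv := (real_inner_self_pos (F := EuclideanSpace ℝ (Fin k))).2 hv
  isVonNBounded q := isVonNBounded_of_pos (E := EuclideanSpace ℝ (Fin k)) (innerSL ℝ)
    fun _ hv => (real_inner_self_pos (F := EuclideanSpace ℝ (Fin k))).2 hv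
  contMDiff := by
    apply contMDiff_of_frame
    intro x₀ v w
    refine (contMDiffAt_const (c := (inner ℝ v w : ℝ))).congr_of_eventuallyEq ?_
    filter_upwards [(chartAt (EuclideanSpace ℝ (Fin k)) x₀).open_source.mem_nhds
      (mem_chart_source _ x₀)] with x hx
    rw [torus_frame Λ x₀ x hx, torus_frame Λ x₀ x hx]
    rfl

/-- The projection `ℝᵏ → ℝᵏ/Λ` is a local isometry. -/
theorem flatMetric_proj (x : EuclideanSpace ℝ (Fin k)) (v w : EuclideanSpace ℝ (Fin k)) :
    (flatMetric Λ).inner (torusProj Λ x)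
      (mfderiv 𝓘(ℝ, EuclideanSpace ℝ (Fin k)) (𝓡 k) (torusProj Λ) x v)
      (mfderiv 𝓘(ℝ, EuclideanSpace ℝ (Fin k)) (𝓡 k) (torusProj Λ) x w) = inner ℝ v w := by
  obtain ⟨c, hc⟩ := torus_chart_trans Λ _ (chart_mem_atlas (EuclideanSpace ℝ (Fin k))
    (torusProj Λ x)) (mem_chart_source _ (torusProj Λ x))
  have hd : HasMFDerivAt 𝓘(ℝ, EuclideanSpace ℝ (Fin k)) (𝓡 k) (torusProj Λ) x
      (ContinuousLinearMap.id ℝ (EuclideanSpace ℝ (Fin k))) := by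
    refine ⟨(torusProj_isLocalHomeomorph Λ).continuous.continuousAt, ?_⟩
    refine HasFDerivAt.hasFDerivWithinAt ?_
    refine ((hasFDerivAt_id _).add_const c).congr_of_eventuallyEq ?_
    filter_upwards [hc] with y hy
    exact hy
  rw [hd.mfderiv]
  rfl

end Torus

/-! ## Six-dimensional products -/

/-- `M` is a closed (compact, without boundary), connected, Hausdorff manifold of dimension `n`
with infinite fundamental group. -/
structure IsClosedManifoldWithInfinitePi1
    {E : Type*} [NormedAddCommGroup E] [NormedSpace ℝ E]
    {H : Type*} [TopologicalSpace H] (I : ModelWithCorners ℝ E H) (n : ℕ)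
    (M : Type*) [TopologicalSpace M] [ChartedSpace H M] : Prop where
  isManifold : IsManifold I ∞ M
  finrank_eq : Module.finrank ℝ E = n
  boundaryless : BoundarylessManifold I M
  compact : CompactSpace M
  t2 : T2Space M
  connected : ConnectedSpace M
  infinite_pi1 : ∀ p : M, Infinite (FundamentalGroup M p)

/-- The standard basis of `ℝⁿ`. -/
def stdBasis (n : ℕ) : Module.Basis (Fin n) ℝ (EuclideanSpace ℝ (Fin n)) :=
  (EuclideanSpace.basisFun (Fin n) ℝ).toBasis

/-- The standard basis of `ℝᵐ × ℝⁿ`. -/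
def prodBasis (m n : ℕ) :
    Module.Basis (Fin m ⊕ Fin n) ℝ (EuclideanSpace ℝ (Fin m) × EuclideanSpace ℝ (Fin n)) :=
  (stdBasis m).prod (stdBasis n)

end

/-!
The proof is a computation in coordinates in which the metrics are explicit, followed by a
determination of the Riemannian measure and a maximum principle.

*Curvature.* Around each of its points, the product of a round sphere and a flat torus has
coordinates (stereographic coordinates on the sphere, linear coordinates on the torus) in which the
metric is the diagonal matrix `modelMetric`. In the orthonormal frame obtained by rescaling the
coordinate vectors, all curvature tensors have constant components: the Riemann tensor is that of a
space of curvature one in the spherical directions (`riemann_modelMetric`), and the Ricci, Schouten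
and Weyl tensors follow by linear algebra. The Schouten tensor is parallel, so the Cotton tensor
vanishes and the Bach tensor is algebraic. The Weyl tensor is parallel as well, but this is needed
only at the centre of the coordinates (`covDeriv_frameTensor_center`), because the integrands are
evaluated at each point in the chart centred there. The integrands are the constants `-12/25`, `-36`
and `-198/25`.

*Volume.* The Riemannian measure is defined as a supremum over charts. A measure which restricts to
the right measure on each chart domain equals this supremum (`iSup_chartVolume_eq`). For the torus
such a measure comes from a fundamental domain of the lattice, for the sphere it is Mathlib's measure
`toSphere` defined by polar coordinates (`chartVolume_roundMetric`, through the Jacobian of the cone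
over the stereographic parametrization), and for products it is the product measure. The areas
`4π` and `8π²/3` of the spheres follow from the volumes of the balls.

*Topology.* The lattice is infinite and is a quotient of the fundamental group of the torus, which is
in turn a quotient of the fundamental group of the product.

*Conformal Einstein metrics.* If `e^{2u} g` is Einstein on `Tᵐ × Sⁿ`, the conformal transformation law
of the Ricci tensor (`ricci_conformal`) shows that `W = e^{-u}` has no mixed second derivatives and
that its second derivatives in the flat directions exceed those in the spherical directions
(`exists_hessian_of_isEinstein`). On the product of a closed geodesic of the torus and a great circle,
`W` is therefore a sum of functions of one variable. Where the summand on the geodesic is maximal and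
the summand on the great circle is minimal, the second derivatives have the wrong signs.
-/

noncomputable section

set_option linter.unusedSectionVars false
set_option linter.unusedSimpArgs false

namespace CoordGeometry

variable {ι : Type*} [Fintype ι] [DecidableEq ι]

/-! ### Orthogonal coordinates -/

theorem partialDeriv_const (i : ι) (c : ℝ) (y : ι → ℝ) : partialDeriv i (fun _ => c) y = 0 := by
  simp [partialDeriv]

theorem partialDeriv_add {i : ι} {f g : (ι → ℝ) → ℝ} {y : ι → ℝ} (hf : DifferentiableAt ℝ f y)
    (hg : DifferentiableAt ℝ g y) :
    partialDeriv i (fun z => f z + g z) y = partialDeriv i f y + partialDeriv i g y := by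
  simp [partialDeriv, fderiv_fun_add hf hg]

theorem partialDeriv_sub {i : ι} {f g : (ι → ℝ) → ℝ} {y : ι → ℝ} (hf : DifferentiableAt ℝ f y)
    (hg : DifferentiableAt ℝ g y) :
    partialDeriv i (fun z => f z - g z) y = partialDeriv i f y - partialDeriv i g y := by
  simp [partialDeriv, fderiv_fun_sub hf hg]

theorem partialDeriv_mul {i : ι} {f g : (ι → ℝ) → ℝ} {y : ι → ℝ} (hf : DifferentiableAt ℝ f y)
    (hg : DifferentiableAt ℝ g y) :
    partialDeriv i (fun z => f z * g z) y
      = partialDeriv i f y * g y + f y * partialDeriv i g y := by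
  simp [partialDeriv, fderiv_fun_mul hf hg]
  ring

theorem partialDeriv_const_mul {i : ι} {g : (ι → ℝ) → ℝ} {y : ι → ℝ} (c : ℝ)
    (hg : DifferentiableAt ℝ g y) :
    partialDeriv i (fun z => c * g z) y = c * partialDeriv i g y := by
  rw [partialDeriv_mul (differentiableAt_const c) hg, partialDeriv_const]
  ring

theorem partialDeriv_coord (i j : ι) (y : ι → ℝ) :
    partialDeriv i (fun z => z j) y = if i = j then 1 else 0 := by
  have h : HasFDerivAt (fun z : ι → ℝ => z j) (ContinuousLinearMap.proj (R := ℝ) j) y :=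
    hasFDerivAt_apply j y
  rw [partialDeriv, h.fderiv]
  simp [Pi.single_apply, eq_comm]

theorem inv_diagonal_of_ne_zero {d : ι → ℝ} (h : ∀ i, d i ≠ 0) :
    (Matrix.diagonal d)⁻¹ = Matrix.diagonal fun i => (d i)⁻¹ := by
  apply Matrix.inv_eq_right_inv
  rw [Matrix.diagonal_mul_diagonal, ← Matrix.diagonal_one]
  congr 1
  ext i
  simp [h i]

/-- Christoffel symbols of an orthogonal metric `∑ Eᵢ² dyᵢ²`, where `D i a = ∂ₐ log Eᵢ`. -/
theorem christoffel_diagonal {E : (ι → ℝ) → ι → ℝ} {D : ι → ι → ℝ} {y : ι → ℝ}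
    (hE : ∀ i, E y i ≠ 0) (hd : ∀ i, DifferentiableAt ℝ (fun z => E z i) y)
    (hD : ∀ i a, partialDeriv a (fun z => E z i) y = D i a * E y i) (k i j : ι) :
    christoffel (fun z => Matrix.diagonal fun i => E z i ^ 2) k i j y
      = (if j = k then D k i else 0) + (if i = k then D k j else 0)
        - (if i = j then (E y i / E y k) ^ 2 * D i k else 0) := by
  have hp : ∀ a p q, partialDeriv a (fun z => Matrix.diagonal (fun i => E z i ^ 2) p q) y
      = if p = q then 2 * D p a * E y p ^ 2 else 0 := by
    intro a p q
    by_cases h : p = q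
    · subst h
      simp only [Matrix.diagonal_apply_eq, if_true, pow_two]
      rw [partialDeriv_mul (hd p) (hd p), hD]
      ring
    · simp [h, partialDeriv_const]
  rw [christoffel]
  simp only [hp]
  rw [inv_diagonal_of_ne_zero (fun i => pow_ne_zero 2 (hE i))]
  rw [Finset.sum_eq_single k]
  · rw [Matrix.diagonal_apply_eq]
    have := hE k
    by_cases h1 : j = k <;> by_cases h2 : i = k <;> by_cases h3 : i = j <;>
      simp_all <;> field_simp <;> exact mul_div_cancel_left₀ _ (hE k)
  · intro l _ hl
    rw [Matrix.diagonal_apply_ne _ hl.symm, zero_mul]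
  · simp

/-! ### The product of a round sphere and a flat space in stereographic coordinates -/

variable (s : ι → Prop) [DecidablePred s]

/-- The indicator function of the spherical directions: a coordinate `i` belongs to the spherical
factor if `s i` holds, and to the flat factor otherwise. -/
def ind (i : ι) : ℝ := if s i then 1 else 0

/-- The conformal factor `4 / (4 + |y|²)` of the round metric in stereographic coordinates, where
only the spherical coordinates `s` contribute to `|y|²`. -/
def roundFactor (y : ι → ℝ) : ℝ := 4 / (4 + ∑ j, ind s j * y j ^ 2)

/-- The lengths of the coordinate vectors for the product of the round metric in the directions `s`
and the flat metric in the other directions. -/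
def frameScale (y : ι → ℝ) (i : ι) : ℝ := if s i then roundFactor s y else 1

/-- The product of the round metric in the directions `s`, in stereographic coordinates, and of the
flat metric in the other directions. -/
def modelMetric (y : ι → ℝ) : Matrix ι ι ℝ := Matrix.diagonal fun i => frameScale s y i ^ 2

/-- The logarithmic derivative `∂ᵢ log λ` of the conformal factor `λ` of the round metric. -/
def roundLogDeriv (y : ι → ℝ) (i : ι) : ℝ := -(1 / 2) * ind s i * (roundFactor s y * y i)

theorem ind_mul_self (i : ι) : ind s i * ind s i = ind s i := by
  unfold ind; split_ifs <;> simp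

theorem sum_ind_nonneg (y : ι → ℝ) : 0 ≤ ∑ j, ind s j * y j ^ 2 :=
  Finset.sum_nonneg fun j _ => mul_nonneg (by unfold ind; split_ifs <;> simp) (sq_nonneg _)

theorem roundFactor_pos (y : ι → ℝ) : 0 < roundFactor s y := by
  have := sum_ind_nonneg s y
  unfold roundFactor
  positivity

theorem frameScale_pos (y : ι → ℝ) (i : ι) : 0 < frameScale s y i := by
  unfold frameScale
  split_ifs
  · exact roundFactor_pos s y
  · exact one_pos

theorem hasFDerivAt_roundFactor (y : ι → ℝ) :
    HasFDerivAt (roundFactor s)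
      (-(4 : ℝ) • ((4 + ∑ j, ind s j * y j ^ 2) ^ 2)⁻¹ • ∑ j, ind s j • (2 * y j) •
        (ContinuousLinearMap.proj (R := ℝ) (φ := fun _ : ι => ℝ) j)) y := by
  have h1 : HasFDerivAt (fun z : ι → ℝ => 4 + ∑ j, ind s j * z j ^ 2)
      (∑ j, ind s j • (2 * y j) • (ContinuousLinearMap.proj (R := ℝ) (φ := fun _ : ι => ℝ) j)) y := by
    refine HasFDerivAt.const_add _ ?_
    refine HasFDerivAt.fun_sum fun j _ => ?_
    refine HasFDerivAt.const_mul ?_ _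
    have := (hasFDerivAt_apply (𝕜 := ℝ) j y).pow 2
    simpa using this
  have h0 : (4 + ∑ j, ind s j * y j ^ 2) ≠ 0 := by
    have := sum_ind_nonneg s y
    positivity
  have h2 := ((hasDerivAt_inv h0).comp_hasFDerivAt y h1).const_mul 4
  refine (h2.congr_fderiv ?_).congr_of_eventuallyEq ?_
  · ext v
    simp
  · filter_upwards with z
    simp [roundFactor, div_eq_mul_inv]

theorem differentiable_roundFactor : Differentiable ℝ (roundFactor s) := fun y =>
  (hasFDerivAt_roundFactor s y).differentiableAt

theorem partialDeriv_roundFactor (i : ι) (y : ι → ℝ) :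
    partialDeriv i (roundFactor s) y = roundLogDeriv s y i * roundFactor s y := by
  have h0 : (4 + ∑ j, ind s j * y j ^ 2) ≠ 0 := by
    have := sum_ind_nonneg s y
    positivity
  rw [partialDeriv, (hasFDerivAt_roundFactor s y).fderiv]
  simp [Pi.single_apply, roundLogDeriv]
  unfold roundFactor
  field_simp
  ring

theorem differentiable_roundLogDeriv (i : ι) :
    Differentiable ℝ (fun z => roundLogDeriv s z i) := by
  unfold roundLogDeriv
  have := differentiable_roundFactor s
  fun_prop

theorem partialDeriv_roundLogDeriv (i j : ι) (y : ι → ℝ) :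
    partialDeriv j (fun z => roundLogDeriv s z i) y
      = roundLogDeriv s y i * roundLogDeriv s y j
        - if i = j then (1 / 2) * ind s i * roundFactor s y else 0 := by
  unfold roundLogDeriv
  rw [partialDeriv_const_mul _ ((differentiable_roundFactor s y).fun_mul (by fun_prop)),
    partialDeriv_mul (differentiable_roundFactor s y) (by fun_prop), partialDeriv_roundFactor,
    partialDeriv_coord]
  unfold roundLogDeriv
  by_cases h : i = j
  · subst h
    simp
    ring
  · simp [h, Ne.symm h]
    ring

theorem ind_mul_roundLogDeriv (y : ι → ℝ) (i : ι) :
    ind s i * roundLogDeriv s y i = roundLogDeriv s y i := by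
  unfold roundLogDeriv
  linear_combination (-(1 / 2) * (roundFactor s y * y i)) * ind_mul_self s i

/-- The sphere has curvature one: `|∇ log λ|² = λ - λ²`. -/
theorem sum_roundLogDeriv_sq (y : ι → ℝ) :
    ∑ i, roundLogDeriv s y i ^ 2 = roundFactor s y - roundFactor s y ^ 2 := by
  have h0 : (4 + ∑ j, ind s j * y j ^ 2) ≠ 0 := by
    have := sum_ind_nonneg s y
    positivity
  have h1 : ∀ i, roundLogDeriv s y i ^ 2
      = (1 / 4) * roundFactor s y ^ 2 * (ind s i * y i ^ 2) := fun i => by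
    unfold roundLogDeriv
    linear_combination ((1 / 4) * roundFactor s y ^ 2 * y i ^ 2) * ind_mul_self s i
  simp only [h1]
  rw [← Finset.mul_sum]
  unfold roundFactor
  field_simp
  ring

theorem differentiable_frameScale (i : ι) : Differentiable ℝ (fun z => frameScale s z i) := by
  unfold frameScale
  split_ifs
  · exact differentiable_roundFactor s
  · exact differentiable_const _

theorem partialDeriv_frameScale (i a : ι) (y : ι → ℝ) :
    partialDeriv a (fun z => frameScale s z i) y
      = (ind s i * roundLogDeriv s y a) * frameScale s y i := by
  unfold frameScale ind
  split_ifs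
  · simpa using partialDeriv_roundFactor s a y
  · simp [partialDeriv_const]

/-- The centre of the coordinates is the set where all spherical coordinates vanish; the flat
coordinates are arbitrary there. -/
theorem roundFactor_center {y : ι → ℝ} (hy : ∀ i, s i → y i = 0) : roundFactor s y = 1 := by
  have h : ∀ j, ind s j * y j ^ 2 = 0 := by
    intro j
    by_cases hj : s j
    · simp [hy j hj]
    · simp [ind, hj]
  simp [roundFactor, h]

theorem roundLogDeriv_center {y : ι → ℝ} (hy : ∀ i, s i → y i = 0) (i : ι) :
    roundLogDeriv s y i = 0 := by
  by_cases hi : s i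
  · simp [roundLogDeriv, hy i hi]
  · simp [roundLogDeriv, ind, hi]

theorem frameScale_center {y : ι → ℝ} (hy : ∀ i, s i → y i = 0) (i : ι) : frameScale s y i = 1 := by
  simp [frameScale, roundFactor_center s hy]

/-- The Christoffel symbols of the model metric. The quotients of frame scales in
`christoffel_diagonal` disappear, because `∂ₖ log λ` vanishes unless `k` is spherical. -/
theorem christoffel_modelMetric (k i j : ι) (y : ι → ℝ) :
    christoffel (modelMetric s) k i j y
      = (if j = k then ind s k * roundLogDeriv s y i else 0)
        + (if i = k then ind s k * roundLogDeriv s y j else 0)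
        - (if i = j then ind s i * roundLogDeriv s y k else 0) := by
  have h := christoffel_diagonal (E := frameScale s) (D := fun i a => ind s i * roundLogDeriv s y a)
    (y := y) (fun i => (frameScale_pos s y i).ne') (fun i => differentiable_frameScale s i y)
    (fun i a => partialDeriv_frameScale s i a y) k i j
  have h2 : (frameScale s y i / frameScale s y k) ^ 2 * (ind s i * roundLogDeriv s y k)
      = ind s i * roundLogDeriv s y k := by
    have := (roundFactor_pos s y).ne'
    by_cases h1 : s i <;> by_cases h2 : s k <;> simp [frameScale, ind, roundLogDeriv, h1, h2, this]
  rw [h2] at h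
  exact h

theorem partialDeriv_christoffel_modelMetric (a k i j : ι) (y : ι → ℝ) :
    partialDeriv a (christoffel (modelMetric s) k i j) y
      = (if j = k then ind s k * (roundLogDeriv s y i * roundLogDeriv s y a
          - if i = a then (1 / 2) * ind s i * roundFactor s y else 0) else 0)
        + (if i = k then ind s k * (roundLogDeriv s y j * roundLogDeriv s y a
          - if j = a then (1 / 2) * ind s j * roundFactor s y else 0) else 0)
        - (if i = j then ind s i * (roundLogDeriv s y k * roundLogDeriv s y a
          - if k = a then (1 / 2) * ind s k * roundFactor s y else 0) else 0) := by
  have h : ∀ (p : Prop) [Decidable p] (c : ℝ) (m : ι),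
      DifferentiableAt ℝ (fun z => if p then c * roundLogDeriv s z m else 0) y := by
    intro p _ c m
    split_ifs
    · exact (differentiable_roundLogDeriv s m y).const_mul c
    · exact differentiableAt_const _
  have hd : ∀ (p : Prop) [Decidable p] (c : ℝ) (m : ι),
      partialDeriv a (fun z => if p then c * roundLogDeriv s z m else 0) y
        = if p then c * (roundLogDeriv s y m * roundLogDeriv s y a
          - if m = a then (1 / 2) * ind s m * roundFactor s y else 0) else 0 := by
    intro p _ c m
    split_ifs with h1 h2
    · rw [partialDeriv_const_mul _ (differentiable_roundLogDeriv s m y),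
        partialDeriv_roundLogDeriv, if_pos h2]
    · rw [partialDeriv_const_mul _ (differentiable_roundLogDeriv s m y),
        partialDeriv_roundLogDeriv, if_neg h2]
    · exact partialDeriv_const _ _ _
  rw [show christoffel (modelMetric s) k i j = fun z => _ from
    funext fun z => christoffel_modelMetric s k i j z,
    partialDeriv_sub ((h _ _ _).fun_add (h _ _ _)) (h _ _ _), partialDeriv_add (h _ _ _) (h _ _ _),
    hd, hd, hd]

/-! ### Curvature of the model metric -/

/-- The quadratic terms of the curvature; the identity `|∇ log λ|² = λ - λ²` removes the sum. -/
theorem sum_christoffel_mul (k i j l : ι) (y : ι → ℝ) :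
    ∑ m, christoffel (modelMetric s) k i m y * christoffel (modelMetric s) m j l y
      = ind s k * roundLogDeriv s y i * christoffel (modelMetric s) k j l y
        + (if i = k then ind s k * (2 * roundLogDeriv s y j * roundLogDeriv s y l
          - if j = l then ind s j * (roundFactor s y - roundFactor s y ^ 2) else 0) else 0)
        - ind s i * roundLogDeriv s y k * christoffel (modelMetric s) i j l y := by
  have h1 : ∑ m, roundLogDeriv s y m * christoffel (modelMetric s) m j l y
      = 2 * roundLogDeriv s y j * roundLogDeriv s y l
          - if j = l then ind s j * (roundFactor s y - roundFactor s y ^ 2) else 0 := by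
    rw [← sum_roundLogDeriv_sq]
    simp only [christoffel_modelMetric, mul_add, mul_sub, Finset.sum_add_distrib,
      Finset.sum_sub_distrib, mul_ite, mul_zero, Finset.sum_ite_eq, Finset.mem_univ, if_true]
    have h2 := ind_mul_roundLogDeriv s y l
    have h3 := ind_mul_roundLogDeriv s y j
    have h4 : (∑ x, if j = l then roundLogDeriv s y x * (ind s j * roundLogDeriv s y x) else 0)
        = if j = l then ind s j * ∑ x, roundLogDeriv s y x ^ 2 else 0 := by
      split_ifs
      · rw [Finset.mul_sum]
        exact Finset.sum_congr rfl fun x _ => by ring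
      · simp
    rw [h4]
    linear_combination roundLogDeriv s y j * h2 + roundLogDeriv s y l * h3
  rw [← h1]
  have h5 : ∀ m, christoffel (modelMetric s) k i m y * christoffel (modelMetric s) m j l y
      = (if m = k then ind s k * roundLogDeriv s y i * christoffel (modelMetric s) m j l y else 0)
        + (if i = k then ind s k * (roundLogDeriv s y m * christoffel (modelMetric s) m j l y) else 0)
        - (if i = m then ind s i * roundLogDeriv s y k * christoffel (modelMetric s) m j l y
            else 0) := by
    intro m
    rw [christoffel_modelMetric s k i m]
    split_ifs <;> ring
  simp only [h5, Finset.sum_add_distrib, Finset.sum_sub_distrib, Finset.sum_ite_eq,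
    Finset.sum_ite_eq', Finset.mem_univ, if_true]
  congr 2
  split_ifs
  · rw [Finset.mul_sum]
  · simp

/-- The curvature operator `R_{ij}{}^k{}_l` of the model metric. All terms vanish unless the four
indices are spherical, and then there are only finitely many patterns of coincidences. -/
theorem curvature_christoffel_modelMetric (i j k l : ι) (y : ι → ℝ) :
    partialDeriv i (christoffel (modelMetric s) k j l) y
      - partialDeriv j (christoffel (modelMetric s) k i l) y
      + ∑ m, (christoffel (modelMetric s) k i m y * christoffel (modelMetric s) m j l y
          - christoffel (modelMetric s) k j m y * christoffel (modelMetric s) m i l y)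
      = roundFactor s y ^ 2 * (ind s i * ind s j * ((if i = k then 1 else 0) * (if j = l then 1 else 0)
          - (if i = l then 1 else 0) * (if j = k then 1 else 0))) := by
  rw [Finset.sum_sub_distrib, sum_christoffel_mul, sum_christoffel_mul,
    partialDeriv_christoffel_modelMetric, partialDeriv_christoffel_modelMetric]
  simp only [christoffel_modelMetric]
  have hz : ∀ m, ¬ s m → roundLogDeriv s y m = 0 ∧ ind s m = 0 := fun m hm => by
    simp [roundLogDeriv, ind, hm]
  have ho : ∀ m, s m → ind s m = 1 := fun m hm => by simp [ind, hm]
  generalize roundFactor s y = L at *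
  generalize roundLogDeriv s y = φ at *
  generalize ind s = c at *
  by_cases hi : s i
  · by_cases hj : s j
    · by_cases hk : s k
      · by_cases hl : s l
        · rw [ho i hi, ho j hj, ho k hk, ho l hl]
          by_cases h1 : i = j
          · subst h1; ring
          by_cases h2 : i = k
          · subst h2
            by_cases h3 : j = l
            · subst h3
              simp [h1, Ne.symm h1]
              ring
            · by_cases h4 : i = l
              · subst h4
                simp [h1, Ne.symm h1]
                ring
              · simp [h1, h3, h4, Ne.symm h1, Ne.symm h3, Ne.symm h4]
                ring
          · by_cases h3 : j = l
            · subst h3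
              by_cases h4 : j = k
              · subst h4
                simp [h1, Ne.symm h1]
                ring
              · simp [h1, h2, h4, Ne.symm h1, Ne.symm h2, Ne.symm h4]
                ring
            · by_cases h4 : j = k
              · subst h4
                by_cases h5 : i = l
                · subst h5
                  simp [h1, Ne.symm h1]
                  ring
                · simp [h1, h3, h5, Ne.symm h1, Ne.symm h3, Ne.symm h5]
                  ring
              · by_cases h5 : i = l
                · subst h5
                  simp [h1, h2, h4, Ne.symm h1, Ne.symm h2, Ne.symm h4]
                  ring
                · simp [h1, h2, h3, h4, h5, Ne.symm h1, Ne.symm h2, Ne.symm h3, Ne.symm h4,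
                    Ne.symm h5]
                  try ring
        · have h1 : i ≠ l := by rintro rfl; exact hl hi
          have h2 : j ≠ l := by rintro rfl; exact hl hj
          have h3 : k ≠ l := by rintro rfl; exact hl hk
          simp [hz l hl, h1, h2, Ne.symm h1, Ne.symm h2, Ne.symm h3]
      · have h1 : i ≠ k := by rintro rfl; exact hk hi
        have h2 : j ≠ k := by rintro rfl; exact hk hj
        simp [hz k hk, h1, h2]
    · have h1 : i ≠ j := by rintro rfl; exact hj hi
      by_cases h2 : j = k
      · subst h2
        simp [hz j hj, h1, Ne.symm h1]
      · by_cases h3 : j = l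
        · subst h3
          simp [hz j hj, h1, h2, Ne.symm h1]
        · simp [hz j hj, h1, h2, h3, Ne.symm h1, Ne.symm h2, Ne.symm h3]
  · by_cases h1 : i = j
    · subst h1; ring
    by_cases h2 : i = k
    · subst h2
      simp [hz i hi, h1, Ne.symm h1]
    · by_cases h3 : i = l
      · subst h3
        simp [hz i hi, h1, h2, Ne.symm h1]
      · simp [hz i hi, h1, h2, h3, Ne.symm h1, Ne.symm h2, Ne.symm h3]

/-- The tensor field with constant components `T` in the orthonormal frame of the model metric. The
coordinate vector `∂ᵢ` is `frameScale s y i` times the `i`-th vector of the frame. -/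
def frameTensor {r : ℕ} (T : (Fin r → ι) → ℝ) : TensorField ι r := fun y a =>
  (∏ p, frameScale s y (a p)) * T a

/-- The tensor `gᵢₖ gⱼₗ - gᵢₗ gⱼₖ` in an orthonormal frame. -/
def unitCurvature (a : Fin 4 → ι) : ℝ :=
  (if a 0 = a 2 then 1 else 0) * (if a 1 = a 3 then 1 else 0)
    - (if a 0 = a 3 then 1 else 0) * (if a 1 = a 2 then 1 else 0)

/-- The curvature tensor of the product is the constant curvature one tensor on the spherical
factor. -/
theorem riemann_modelMetric :
    riemann (modelMetric s)
      = frameTensor s fun a => ind s (a 0) * ind s (a 1) * unitCurvature a := by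
  funext y a
  unfold riemann
  simp only [curvature_christoffel_modelMetric]
  rw [Finset.sum_eq_single (a 2) (fun m _ hm => by
    rw [modelMetric, Matrix.diagonal_apply_ne _ hm.symm, zero_mul]) (by simp)]
  rw [modelMetric, Matrix.diagonal_apply_eq, frameTensor, unitCurvature]
  rw [Fin.prod_univ_four]
  by_cases h0 : s (a 0)
  · by_cases h1 : s (a 1)
    · by_cases h2 : a 0 = a 2
      · by_cases h3 : a 1 = a 3
        · simp [← h2, ← h3, frameScale, ind, h0, h1]
          ring_nf
        · by_cases h4 : a 0 = a 3
          · simp [← h2, ← h4, frameScale, ind, h0, h1]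
          · simp [h3, h4]
      · by_cases h4 : a 0 = a 3
        · by_cases h5 : a 1 = a 2
          · simp [← h5, ← h4, frameScale, ind, h0, h1]
            ring
          · simp [h5, h2]
        · simp [h2, h4]
    · simp [ind, h1]
  · simp [ind, h0]

theorem modelMetric_inv (y : ι → ℝ) :
    (modelMetric s y)⁻¹ = Matrix.diagonal fun i => (frameScale s y i ^ 2)⁻¹ :=
  inv_diagonal_of_ne_zero fun i => pow_ne_zero 2 (frameScale_pos s y i).ne'

theorem modelMetric_inv_sum (y : ι → ℝ) (F : ι → ι → ℝ) :
    ∑ i, ∑ j, (modelMetric s y)⁻¹ i j * F i j = ∑ i, (frameScale s y i ^ 2)⁻¹ * F i i := by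
  rw [modelMetric_inv]
  refine Finset.sum_congr rfl fun i _ => ?_
  rw [Finset.sum_eq_single i (fun j _ hj => by
    rw [Matrix.diagonal_apply_ne _ hj.symm, zero_mul]) (by simp), Matrix.diagonal_apply_eq]

theorem modelMetric_inv_prod_sum {r : ℕ} (y : ι → ℝ) (F : (Fin r → ι) → (Fin r → ι) → ℝ) :
    ∑ a : Fin r → ι, ∑ b : Fin r → ι, (∏ p, (modelMetric s y)⁻¹ (a p) (b p)) * F a b
      = ∑ a : Fin r → ι, ((∏ p, frameScale s y (a p)) ^ 2)⁻¹ * F a a := by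
  rw [modelMetric_inv]
  refine Finset.sum_congr rfl fun a _ => ?_
  rw [Finset.sum_eq_single a]
  · simp only [Matrix.diagonal_apply_eq, Finset.prod_inv_distrib, Finset.prod_pow]
  · intro b _ hb
    obtain ⟨p, hp⟩ := Function.ne_iff.1 hb
    refine mul_eq_zero_of_left (Finset.prod_eq_zero (Finset.mem_univ p) ?_) _
    exact Matrix.diagonal_apply_ne _ hp.symm
  · simp

theorem tensorInner_frameTensor {r : ℕ} (S T : (Fin r → ι) → ℝ) (y : ι → ℝ) :
    tensorInner (modelMetric s) (frameTensor s S) (frameTensor s T) y = ∑ a, S a * T a := by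
  unfold tensorInner
  simp only [mul_assoc]
  rw [modelMetric_inv_prod_sum]
  refine Finset.sum_congr rfl fun a _ => ?_
  have : (∏ p, frameScale s y (a p)) ≠ 0 :=
    Finset.prod_ne_zero_iff.2 fun p _ => (frameScale_pos s y _).ne'
  unfold frameTensor
  field_simp

theorem trace₂_frameTensor (T : (Fin 2 → ι) → ℝ) (y : ι → ℝ) :
    trace₂ (modelMetric s) (frameTensor s T) y = ∑ i, T ![i, i] := by
  unfold trace₂
  rw [modelMetric_inv_sum]
  refine Finset.sum_congr rfl fun i _ => ?_
  have := (frameScale_pos s y i).ne'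
  simp [frameTensor, Fin.prod_univ_two]
  field_simp

/-- The dimension of the spherical factor, as a real number. -/
def sphereDim : ℝ := ∑ i, ind s i

theorem ricci_modelMetric :
    ricci (modelMetric s) = frameTensor s fun a =>
      if a 0 = a 1 then (sphereDim s - 1) * ind s (a 0) else 0 := by
  funext y a
  unfold ricci
  rw [modelMetric_inv_sum, riemann_modelMetric]
  have h : ∀ i, (frameScale s y i ^ 2)⁻¹ * frameTensor s
      (fun a => ind s (a 0) * ind s (a 1) * unitCurvature a) y ![a 0, i, a 1, i]
      = (frameScale s y (a 0) * frameScale s y (a 1)) * ((if a 0 = a 1 then ind s (a 0) * ind s i else 0)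
          - if a 0 = i then (if a 0 = a 1 then ind s (a 0) else 0) else 0) := by
    intro i
    have hi := (frameScale_pos s y i).ne'
    have h2 := ind_mul_self s i
    by_cases h0 : a 0 = i
    · by_cases h1 : a 0 = a 1
      · subst h0
        simp [frameTensor, unitCurvature, Fin.prod_univ_four, ← h1, h2]
      · have h3 : i ≠ a 1 := h0 ▸ h1
        simp [frameTensor, unitCurvature, Fin.prod_univ_four, h0, h3]
    · by_cases h1 : a 0 = a 1
      · have h3 : a 1 ≠ i := h1 ▸ h0
        simp [frameTensor, unitCurvature, Fin.prod_univ_four, h1, h3]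
        field_simp
      · simp [frameTensor, unitCurvature, Fin.prod_univ_four, h0, h1]
  simp only [h]
  rw [← Finset.mul_sum, Finset.sum_sub_distrib, Finset.sum_ite_eq, if_pos (Finset.mem_univ _)]
  simp only [frameTensor, Fin.prod_univ_two]
  congr 1
  split_ifs
  · rw [← Finset.mul_sum, sphereDim]
    ring
  · simp

/-- The constant value of `J` for the model metric. -/
def modelJ : ℝ :=
  (sphereDim s - 1) * sphereDim s / (2 * ((Fintype.card ι : ℝ) - 1))

/-- The eigenvalues of the Schouten tensor of the model metric. -/
def modelP (i : ι) : ℝ :=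
  ((sphereDim s - 1) * ind s i - modelJ s) / ((Fintype.card ι : ℝ) - 2)

/-- The sectional components `W(eᵢ, eⱼ, eᵢ, eⱼ)` of the Weyl tensor of the model metric. -/
def modelW (i j : ι) : ℝ := ind s i * ind s j - modelP s i - modelP s j

theorem schoutenTrace_modelMetric : schoutenTrace (modelMetric s) = fun _ => modelJ s := by
  funext y
  rw [schoutenTrace, ricci_modelMetric, trace₂_frameTensor, modelJ]
  simp [← Finset.mul_sum, sphereDim]

theorem schouten_modelMetric :
    schouten (modelMetric s) = frameTensor s fun a => if a 0 = a 1 then modelP s (a 0) else 0 := by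
  funext y a
  rw [schouten, ricci_modelMetric, schoutenTrace_modelMetric]
  unfold modelP frameTensor modelMetric
  rw [Fin.prod_univ_two]
  by_cases h : a 0 = a 1
  · simp [h]
    ring
  · simp [h]

/-- The Ricci tensor being diagonal in the orthonormal frame, the Weyl tensor is `unitCurvature` with
coefficients depending only on the two-plane of the frame. -/
theorem weyl_modelMetric :
    weyl (modelMetric s) = frameTensor s fun a => modelW s (a 0) (a 1) * unitCurvature a := by
  funext y a
  rw [weyl, riemann_modelMetric, schouten_modelMetric]
  have hG : ∀ i j, modelMetric s y i j
      = frameScale s y i * frameScale s y j * if i = j then 1 else 0 := by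
    intro i j
    by_cases h : i = j
    · subst h; simp [modelMetric, pow_two]
    · simp [modelMetric, h]
  simp only [frameTensor, Fin.prod_univ_four, Fin.prod_univ_two, hG, modelW, unitCurvature,
    Matrix.cons_val_zero, Matrix.cons_val_one]
  clear hG
  generalize a 0 = i
  generalize a 1 = j
  generalize a 2 = k
  generalize a 3 = l
  by_cases h1 : i = k
  · subst h1
    by_cases h2 : j = l
    · subst h2
      by_cases h3 : i = j
      · subst h3
        simp
      · simp [h3, Ne.symm h3]
        ring
    · by_cases h3 : i = l
      · subst h3
        simp [h2]
      · by_cases h4 : j = i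
        · subst h4
          simp [h2]
        · simp [h2, h3, h4]
  · by_cases h2 : i = l
    · subst h2
      by_cases h3 : j = k
      · subst h3
        simp [h1, Ne.symm h1]
        ring
      · simp [h1, h3]
    · by_cases h3 : j = k
      · subst h3
        simp [h1, h2]
      · simp [h1, h2, h3]

/-! ### The integrands of the invariants -/

theorem covDeriv_zero (G : (ι → ℝ) → Matrix ι ι ℝ) (r : ℕ) :
    covDeriv G (0 : TensorField ι r) = 0 := by
  funext y a
  have h : (fun z : ι → ℝ => (0 : TensorField ι r) z (Fin.tail a)) = fun _ => 0 := rfl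
  simp only [covDeriv, h, partialDeriv_const]
  simp

theorem laplacian_const (G : (ι → ℝ) → Matrix ι ι ℝ) (c : ℝ) :
    laplacian G (fun _ => c) = fun _ => 0 := by
  have h : grad (fun _ : ι → ℝ => c) = 0 := by
    funext y a
    exact partialDeriv_const _ _ _
  funext y
  rw [laplacian, divergence, h, covDeriv_zero]
  simp [trace₂]

theorem divergence_zero (G : (ι → ℝ) → Matrix ι ι ℝ) : divergence G 0 = fun _ => 0 := by
  funext y
  rw [divergence, covDeriv_zero]
  simp [trace₂]

theorem tensorInner_zero (G : (ι → ℝ) → Matrix ι ι ℝ) (r : ℕ) (y : ι → ℝ) :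
    tensorInner G (0 : TensorField ι r) 0 y = 0 := by
  simp [tensorInner]

/-- The Schouten tensor of the model metric is parallel. -/
theorem covDeriv_schouten_modelMetric : covDeriv (modelMetric s) (schouten (modelMetric s)) = 0 := by
  funext y a
  rw [schouten_modelMetric]
  have hE := differentiable_frameScale s
  have h0 : ∀ i k : ι, ind s i * roundLogDeriv s y k * (frameScale s y i ^ 2 * modelP s i)
      = ind s i * roundLogDeriv s y k * (frameScale s y k ^ 2 * modelP s k) := by
    intro i k
    by_cases hi : s i
    · by_cases hk : s k
      · simp [frameScale, modelP, ind, hi, hk]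
      · simp [roundLogDeriv, ind, hk]
    · simp [ind, hi]
  have hp : ∀ (a i j : ι) (c : ℝ),
      partialDeriv a (fun z => frameScale s z i * frameScale s z j * c) y
      = (ind s i * roundLogDeriv s y a + ind s j * roundLogDeriv s y a)
        * (frameScale s y i * frameScale s y j * c) := by
    intro a i j c
    rw [partialDeriv_mul ((hE i y).fun_mul (hE j y)) (differentiableAt_const c),
      partialDeriv_mul (hE i y) (hE j y), partialDeriv_const, partialDeriv_frameScale,
      partialDeriv_frameScale]
    ring
  obtain ⟨i, b, rfl⟩ : ∃ i b, a = Fin.cons i b := ⟨a 0, Fin.tail a, (Fin.cons_self_tail a).symm⟩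
  simp only [covDeriv, frameTensor, Fin.prod_univ_two, Fin.sum_univ_two, Fin.tail_cons,
    Fin.cons_zero, hp]
  simp [christoffel_modelMetric]
  generalize b 0 = j
  generalize b 1 = k
  have h1 := h0 k j
  have h2 := h0 j k
  by_cases h : j = k
  · subst h
    by_cases h3 : i = j
    · subst h3
      simp
      ring
    · simp [h3]
      ring
  · by_cases h3 : i = j
    · subst h3
      simp [h, Ne.symm h]
      linear_combination -h2
    · by_cases h4 : i = k
      · subst h4
        simp [h, Ne.symm h]
        linear_combination -h1
      · simp [h, h3, h4, Ne.symm h]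

theorem cotton_modelMetric : cotton (modelMetric s) = 0 := by
  funext y a
  simp [cotton, covDeriv_schouten_modelMetric]

theorem weylCotton_modelMetric : weylCotton (modelMetric s) = 0 := by
  funext y a
  simp [weylCotton, cotton_modelMetric]

theorem schoutenGradJ_modelMetric : schoutenGradJ (modelMetric s) = 0 := by
  funext y a
  simp [schoutenGradJ, schoutenTrace_modelMetric, grad, partialDeriv_const]

/-- Tensors with constant components in the orthonormal frame have vanishing covariant derivative
at the centre of the stereographic coordinates, where the metric is Euclidean to first order. -/
theorem covDeriv_frameTensor_center {r : ℕ} (T : (Fin r → ι) → ℝ) {y : ι → ℝ}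
    (hy : ∀ i, s i → y i = 0) : covDeriv (modelMetric s) (frameTensor s T) y = 0 := by
  have h0 := roundLogDeriv_center s hy
  have h1 : ∀ k i j, christoffel (modelMetric s) k i j y = 0 := by
    intro k i j
    simp [christoffel_modelMetric, h0]
  have h2 : HasFDerivAt (roundFactor s) (0 : (ι → ℝ) →L[ℝ] ℝ) y := by
    refine (hasFDerivAt_roundFactor s y).congr_fderiv ?_
    have h : ∀ j, ind s j • (2 * y j) •
        ContinuousLinearMap.proj (R := ℝ) (φ := fun _ : ι => ℝ) j = 0 := by
      intro j
      by_cases hj : s j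
      · simp [hy j hj]
      · simp [ind, hj]
    simp only [h, Finset.sum_const_zero, smul_zero]
  have h3 : ∀ i, HasFDerivAt (fun z => frameScale s z i) (0 : (ι → ℝ) →L[ℝ] ℝ) y := by
    intro i
    unfold frameScale
    split_ifs
    · exact h2
    · exact hasFDerivAt_const _ _
  funext a
  have h4 : HasFDerivAt (fun z => frameTensor s T z (Fin.tail a)) (0 : (ι → ℝ) →L[ℝ] ℝ) y := by
    have := (HasFDerivAt.finsetProd (u := Finset.univ)
      (g := fun (p : Fin r) (z : ι → ℝ) => frameScale s z (Fin.tail a p))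
      (fun p _ => h3 (Fin.tail a p))).mul_const (T (Fin.tail a))
    simpa [frameTensor] using this
  simp [covDeriv, h1, partialDeriv, h4.fderiv]

/-- The Cotton tensor vanishes, so the Bach tensor is the contraction of the Weyl tensor with the
Schouten tensor. -/
theorem bach_modelMetric :
    bach (modelMetric s) = frameTensor s fun a =>
      ∑ i, modelW s (a 0) i * unitCurvature ![a 0, i, a 1, i] * modelP s i := by
  funext y a
  rw [bach, cotton_modelMetric, covDeriv_zero]
  have h : ∀ i j, ∑ u, ∑ v, (modelMetric s y)⁻¹ i u * (modelMetric s y)⁻¹ j v *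
        weyl (modelMetric s) y ![a 0, i, a 1, j] * schouten (modelMetric s) y ![u, v]
      = if i = j then frameScale s y (a 0) * frameScale s y (a 1) *
          (modelW s (a 0) i * unitCurvature ![a 0, i, a 1, i] * modelP s i) else 0 := by
    intro i j
    have hi := (frameScale_pos s y i).ne'
    rw [modelMetric_inv, Finset.sum_eq_single i, Finset.sum_eq_single j, weyl_modelMetric,
      schouten_modelMetric]
    · by_cases hij : i = j
      · subst hij
        simp [frameTensor, Fin.prod_univ_four, Fin.prod_univ_two]
        field_simp
      · simp [frameTensor, hij]
    · intro v _ hv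
      simp [Matrix.diagonal_apply_ne _ hv.symm]
    · simp
    · intro v _ hv
      simp [Matrix.diagonal_apply_ne _ hv.symm]
    · simp
  simp only [h]
  simp [frameTensor, Fin.prod_univ_two, Finset.mul_sum]

theorem schoutenCubed_modelMetric (y : ι → ℝ) :
    schoutenCubed (modelMetric s) y = ∑ i, modelP s i ^ 3 := by
  have h : (Matrix.of fun i j => schouten (modelMetric s) y ![i, j])
      = Matrix.diagonal fun i => frameScale s y i ^ 2 * modelP s i := by
    ext i j
    rw [schouten_modelMetric]
    by_cases hij : i = j
    · subst hij
      simp [frameTensor, Fin.prod_univ_two, pow_two]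
    · simp [frameTensor, hij]
  rw [schoutenCubed, h, modelMetric_inv, Matrix.diagonal_mul_diagonal, Matrix.diagonal_pow,
    Matrix.trace_diagonal]
  refine Finset.sum_congr rfl fun i _ => ?_
  have := (frameScale_pos s y i).ne'
  simp
  field_simp

theorem weylSquare_modelMetric :
    weylSquare (modelMetric s) = frameTensor s fun a => ∑ c : Fin 3 → ι,
      (modelW s (a 0) (c 0) * unitCurvature ![a 0, c 0, c 1, c 2])
        * (modelW s (a 1) (c 0) * unitCurvature ![a 1, c 0, c 1, c 2]) := by
  funext y a
  unfold weylSquare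
  simp only [mul_assoc]
  rw [modelMetric_inv_prod_sum, frameTensor, Finset.mul_sum]
  refine Finset.sum_congr rfl fun c _ => ?_
  have h0 := (frameScale_pos s y (c 0)).ne'
  have h1 := (frameScale_pos s y (c 1)).ne'
  have h2 := (frameScale_pos s y (c 2)).ne'
  rw [weyl_modelMetric]
  simp [frameTensor, Fin.prod_univ_four, Fin.prod_univ_two, Fin.prod_univ_three]
  field_simp

theorem sum_fin_succ_arrow {r : ℕ} (F : (Fin (r + 1) → ι) → ℝ) :
    ∑ a, F a = ∑ i, ∑ b : Fin r → ι, F (Fin.cons i b) := by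
  rw [← (Fin.consEquiv fun _ => ι).sum_comp, Fintype.sum_prod_type]
  rfl

theorem sum_fin_two_arrow (F : (Fin 2 → ι) → ℝ) :
    ∑ a, F a = ∑ i, ∑ j, F ![i, j] := by
  simp only [sum_fin_succ_arrow]
  simp
  rfl

theorem sum_fin_three_arrow (F : (Fin 3 → ι) → ℝ) :
    ∑ a, F a = ∑ i, ∑ j, ∑ k, F ![i, j, k] := by
  simp only [sum_fin_succ_arrow]
  simp
  rfl

theorem sum_fin_four_arrow (F : (Fin 4 → ι) → ℝ) :
    ∑ a, F a = ∑ i, ∑ j, ∑ k, ∑ l, F ![i, j, k, l] := by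
  simp only [sum_fin_succ_arrow]
  simp
  rfl

theorem unitCurvature_apply (i j k l : ι) :
    unitCurvature ![i, j, k, l] = (if i = k then 1 else 0) * (if j = l then 1 else 0)
      - (if i = l then 1 else 0) * (if j = k then 1 else 0) := rfl

theorem sum_unitCurvature_sq (i j : ι) :
    ∑ k, ∑ l, unitCurvature ![i, j, k, l] * unitCurvature ![i, j, k, l]
      = if i = j then 0 else 2 := by
  have h1 : ∀ k l, unitCurvature ![i, j, k, l] * unitCurvature ![i, j, k, l]
      = (if i = k then (if j = l then 1 else 0) else 0)
        + (if j = k then (if i = l then 1 else 0) else 0)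
        - (if i = j then 2 else 0) * (if i = k then (if i = l then 1 else 0) else 0) := by
    intro k l
    rw [unitCurvature_apply]
    by_cases h : i = j
    · subst h
      rw [if_pos (rfl : i = i)]
      split_ifs <;> norm_num
    · by_cases h2 : i = k
      · subst h2
        simp [h, Ne.symm h]
      · simp [h, h2]
        split_ifs <;> simp
  simp only [h1, Finset.sum_add_distrib, Finset.sum_sub_distrib, ← Finset.mul_sum]
  simp
  split_ifs <;> norm_num

theorem sum_weyl_sq :
    ∑ a : Fin 4 → ι, (modelW s (a 0) (a 1) * unitCurvature a)
        * (modelW s (a 0) (a 1) * unitCurvature a)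
      = ∑ i, ∑ j, modelW s i j ^ 2 * if i = j then 0 else 2 := by
  rw [sum_fin_four_arrow]
  refine Finset.sum_congr rfl fun i _ => Finset.sum_congr rfl fun j _ => ?_
  rw [← sum_unitCurvature_sq, Finset.mul_sum]
  refine Finset.sum_congr rfl fun k _ => ?_
  rw [Finset.mul_sum]
  refine Finset.sum_congr rfl fun l _ => ?_
  simp
  ring

/-- The value of `|P|²`. -/
theorem tensorInner_schouten_modelMetric :
    tensorInner (modelMetric s) (schouten (modelMetric s)) (schouten (modelMetric s))
      = fun _ => ∑ i, modelP s i ^ 2 := by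
  funext y
  rw [schouten_modelMetric, tensorInner_frameTensor, sum_fin_two_arrow]
  simp [pow_two]

theorem tensorInner_weyl_modelMetric :
    tensorInner (modelMetric s) (weyl (modelMetric s)) (weyl (modelMetric s))
      = fun _ => ∑ i, ∑ j, modelW s i j ^ 2 * if i = j then 0 else 2 := by
  funext y
  rw [weyl_modelMetric, tensorInner_frameTensor, sum_weyl_sq]

theorem tensorInner_bach_modelMetric (y : ι → ℝ) :
    tensorInner (modelMetric s) (bach (modelMetric s)) (schouten (modelMetric s)) y
      = ∑ i, ∑ j, if i = j then 0 else modelW s i j * modelP s i * modelP s j := by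
  rw [bach_modelMetric, schouten_modelMetric, tensorInner_frameTensor, sum_fin_two_arrow]
  simp [Finset.sum_mul, unitCurvature]
  refine Finset.sum_congr rfl fun i _ => Finset.sum_congr rfl fun j _ => ?_
  by_cases h : i = j
  · simp [h]
  · simp [h]
    ring

theorem tensorInner_weylSquare_modelMetric (y : ι → ℝ) :
    tensorInner (modelMetric s) (schouten (modelMetric s)) (weylSquare (modelMetric s)) y
      = ∑ i, modelP s i * ∑ j, modelW s i j ^ 2 * if i = j then 0 else 2 := by
  rw [weylSquare_modelMetric, schouten_modelMetric, tensorInner_frameTensor, sum_fin_two_arrow]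
  refine Finset.sum_congr rfl fun i _ => ?_
  rw [Finset.sum_eq_single i (fun j _ hj => by simp [Ne.symm hj]) (by simp)]
  simp only [Matrix.cons_val_zero, Matrix.cons_val_one, if_true]
  rw [sum_fin_three_arrow]
  congr 1
  refine Finset.sum_congr rfl fun j _ => ?_
  rw [← sum_unitCurvature_sq, Finset.mul_sum]
  refine Finset.sum_congr rfl fun k _ => ?_
  rw [Finset.mul_sum]
  refine Finset.sum_congr rfl fun l _ => ?_
  simp
  ring

/-- The derivative terms of the integrand of `𝒬` vanish because all scalar invariants are constant
and the Schouten tensor is parallel. -/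
theorem qDensity_modelMetric (y : ι → ℝ) :
    qDensity (modelMetric s) y
      = - 8 * modelJ s ^ 3 + 24 * modelJ s * (∑ i, modelP s i ^ 2) - 16 * (∑ i, modelP s i ^ 3)
        - 8 * ∑ i, ∑ j, if i = j then 0 else modelW s i j * modelP s i * modelP s j := by
  rw [qDensity, tensorInner_bach_modelMetric, tensorInner_schouten_modelMetric,
    schoutenCubed_modelMetric, schoutenTrace_modelMetric, schoutenGradJ_modelMetric,
    divergence_zero]
  simp only [laplacian_const]
  ring

/-- The integrand of `ℒ₁` contains `|∇W|²`, which is evaluated only at the centre of the coordinates;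
this is enough because each point is the centre of its own chart. -/
theorem l₁Density_modelMetric {y : ι → ℝ} (hy : ∀ i, s i → y i = 0) :
    l₁Density (modelMetric s) y
      = 48 * (∑ i, modelP s i * ∑ j, modelW s i j ^ 2 * if i = j then 0 else 2)
        - 8 * modelJ s * ∑ i, ∑ j, modelW s i j ^ 2 * if i = j then 0 else 2 := by
  have h : tensorInner (modelMetric s) (covDeriv (modelMetric s) (weyl (modelMetric s)))
      (covDeriv (modelMetric s) (weyl (modelMetric s))) y = 0 := by
    have h1 : covDeriv (modelMetric s) (weyl (modelMetric s)) y = 0 := by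
      rw [weyl_modelMetric]
      exact covDeriv_frameTensor_center s _ hy
    simp [tensorInner, h1]
  rw [l₁Density, tensorInner_weyl_modelMetric, h, tensorInner_weylSquare_modelMetric,
    schoutenTrace_modelMetric, weylCotton_modelMetric, cotton_modelMetric, divergence_zero,
    laplacian_const, tensorInner_zero]
  ring

theorem l₂Density_modelMetric (y : ι → ℝ) :
    l₂Density (modelMetric s) y
      = 8 * (∑ i, modelP s i * ∑ j, modelW s i j ^ 2 * if i = j then 0 else 2)
        - 2 * modelJ s * ∑ i, ∑ j, modelW s i j ^ 2 * if i = j then 0 else 2 := by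
  rw [l₂Density, tensorInner_weyl_modelMetric, tensorInner_weylSquare_modelMetric,
    schoutenTrace_modelMetric, weylCotton_modelMetric, cotton_modelMetric, divergence_zero,
    laplacian_const, tensorInner_zero]
  ring

theorem qDensity_modelMetric_two_four (y : Fin 2 ⊕ Fin 4 → ℝ) :
    qDensity (modelMetric fun i : Fin 2 ⊕ Fin 4 => i.isLeft) y = -(12 / 25) := by
  have hN : sphereDim (fun i : Fin 2 ⊕ Fin 4 => i.isLeft) = 2 := by
    simp [sphereDim, ind, Fintype.sum_sum_type, -Finset.sum_boole]
  have hJ : modelJ (fun i : Fin 2 ⊕ Fin 4 => i.isLeft) = 1 / 5 := by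
    rw [modelJ, hN]
    simp
    norm_num
  have hP1 : ∀ i, modelP (fun i : Fin 2 ⊕ Fin 4 => i.isLeft) (Sum.inl i) = 1 / 5 := by
    intro i
    rw [modelP, hN, hJ]
    simp [ind]
    norm_num
  have hP2 : ∀ i, modelP (fun i : Fin 2 ⊕ Fin 4 => i.isLeft) (Sum.inr i) = -(1 / 20) := by
    intro i
    rw [modelP, hN, hJ]
    simp [ind]
    norm_num
  have h : ∀ (f : Fin 2 ⊕ Fin 4 → ℝ) i, ∑ j, (if i = j then 0 else f j) = (∑ j, f j) - f i := by
    intro f i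
    have h1 : ∑ j, (if i = j then f j else 0) = f i := by simp
    rw [eq_sub_iff_add_eq, ← h1, ← Finset.sum_add_distrib]
    exact Finset.sum_congr rfl fun j _ => by split_ifs <;> simp
  rw [qDensity_modelMetric, hJ]
  simp only [h]
  simp [Fintype.sum_sum_type, modelW, hP1, hP2, ind]
  norm_num

/-- The values of `P_t^s W_{sijk} W^{tijk}`, `|W|²` and `J` on the product of a flat surface and the
unit four-sphere. -/
theorem sums_modelMetric_two_four :
    (∑ i, modelP (fun i : Fin 2 ⊕ Fin 4 => i.isRight) i
        * ∑ j, modelW (fun i : Fin 2 ⊕ Fin 4 => i.isRight) i j ^ 2 * if i = j then 0 else 2)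
      = -(27 / 100) ∧
    (∑ i, ∑ j, modelW (fun i : Fin 2 ⊕ Fin 4 => i.isRight) i j ^ 2 * if i = j then 0 else 2)
      = 12 / 5 ∧
    modelJ (fun i : Fin 2 ⊕ Fin 4 => i.isRight) = 6 / 5 := by
  have hN : sphereDim (fun i : Fin 2 ⊕ Fin 4 => i.isRight) = 4 := by
    simp [sphereDim, ind, Fintype.sum_sum_type, -Finset.sum_boole]
  have hJ : modelJ (fun i : Fin 2 ⊕ Fin 4 => i.isRight) = 6 / 5 := by
    rw [modelJ, hN]
    simp
    norm_num
  have hP1 : ∀ i, modelP (fun i : Fin 2 ⊕ Fin 4 => i.isRight) (Sum.inl i) = -(3 / 10) := by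
    intro i
    rw [modelP, hN, hJ]
    simp [ind]
    norm_num
  have hP2 : ∀ i, modelP (fun i : Fin 2 ⊕ Fin 4 => i.isRight) (Sum.inr i) = 9 / 20 := by
    intro i
    rw [modelP, hN, hJ]
    simp [ind]
    norm_num
  have h : ∀ (f : Fin 2 ⊕ Fin 4 → ℝ) i,
      ∑ j, (f j * if i = j then 0 else 2) = 2 * (∑ j, f j) - 2 * f i := by
    intro f i
    have h1 : ∑ j, (if i = j then 2 * f j else 0) = 2 * f i := by simp
    rw [eq_sub_iff_add_eq, Finset.mul_sum, ← h1, ← Finset.sum_add_distrib]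
    exact Finset.sum_congr rfl fun j _ => by split_ifs <;> ring
  refine ⟨?_, ?_, hJ⟩
  all_goals
    simp only [h]
    simp [Fintype.sum_sum_type, modelW, hP1, hP2, ind]
    norm_num

theorem l₁Density_modelMetric_two_four {y : Fin 2 ⊕ Fin 4 → ℝ} (hy : ∀ i, y (Sum.inr i) = 0) :
    l₁Density (modelMetric fun i : Fin 2 ⊕ Fin 4 => i.isRight) y = -36 := by
  obtain ⟨h1, h2, h3⟩ := sums_modelMetric_two_four
  have hc : ∀ i : Fin 2 ⊕ Fin 4, i.isRight → y i = 0 := by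
    rintro (i | i) hi
    · simp at hi
    · exact hy i
  rw [l₁Density_modelMetric _ hc, h1, h2, h3]
  norm_num

theorem l₂Density_modelMetric_two_four (y : Fin 2 ⊕ Fin 4 → ℝ) :
    l₂Density (modelMetric fun i : Fin 2 ⊕ Fin 4 => i.isRight) y = -(198 / 25) := by
  obtain ⟨h1, h2, h3⟩ := sums_modelMetric_two_four
  rw [l₂Density_modelMetric, h1, h2, h3]
  norm_num

/-! ### The Ricci tensor of a conformal change of the model metric -/

theorem partialDeriv_mul_of_eq_zero {i : ι} {f g : (ι → ℝ) → ℝ} {y : ι → ℝ}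
    (hf : DifferentiableAt ℝ f y) (hg : DifferentiableAt ℝ g y) (h1 : f y = 1)
    (h0 : partialDeriv i f y = 0) :
    partialDeriv i (fun z => f z * g z) y = partialDeriv i g y := by
  rw [partialDeriv_mul hf hg, h0, h1]
  ring

variable {v : (ι → ℝ) → ℝ}

theorem differentiable_partialDeriv (hv : ContDiff ℝ 2 v) (i : ι) :
    Differentiable ℝ (partialDeriv i v) := by
  have h : ContDiff ℝ 1 (fderiv ℝ v) := hv.fderiv_right (by norm_num)
  exact (h.differentiable one_ne_zero).clm_apply (differentiable_const _)

/-- The Christoffel symbols of `e^{2v} g` for the model metric `g`. -/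
theorem christoffel_conformal (hv : ContDiff ℝ 2 v) (k i j : ι) (y : ι → ℝ) :
    christoffel (fun z => Real.exp (2 * v z) • modelMetric s z) k i j y
      = (if j = k then partialDeriv i v y + ind s k * roundLogDeriv s y i else 0)
        + (if i = k then partialDeriv j v y + ind s k * roundLogDeriv s y j else 0)
        - (if i = j then (frameScale s y i / frameScale s y k) ^ 2 *
          (partialDeriv k v y + ind s i * roundLogDeriv s y k) else 0) := by
  have hd : Differentiable ℝ v := hv.differentiable two_ne_zero
  have hG : (fun z => Real.exp (2 * v z) • modelMetric s z)
      = fun z => Matrix.diagonal fun i => (Real.exp (v z) * frameScale s z i) ^ 2 := by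
    funext z
    rw [modelMetric, ← Matrix.diagonal_smul]
    congr 1
    funext i
    simp [mul_pow, ← Real.exp_nat_mul]
  have he : ∀ a, partialDeriv a (fun z => Real.exp (v z)) y
      = partialDeriv a v y * Real.exp (v y) := by
    intro a
    rw [partialDeriv, fderiv_exp (hd y), partialDeriv]
    simp [mul_comm]
  rw [hG, christoffel_diagonal (E := fun z i => Real.exp (v z) * frameScale s z i)
    (D := fun i a => partialDeriv a v y + ind s i * roundLogDeriv s y a)]
  · rw [mul_div_mul_left _ _ (Real.exp_ne_zero _)]
  · exact fun i => mul_ne_zero (Real.exp_ne_zero _) (frameScale_pos s y i).ne'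
  · exact fun i => (hd y).exp.fun_mul (differentiable_frameScale s i y)
  · intro i a
    rw [partialDeriv_mul (hd y).exp (differentiable_frameScale s i y), he, partialDeriv_frameScale]
    ring

/-- At the centre of the coordinates the model metric is Euclidean to first order, so its
contribution reduces to the second derivatives of `log λ`. -/
theorem partialDeriv_christoffel_conformal (hv : ContDiff ℝ 2 v) {y : ι → ℝ}
    (hy : ∀ i, s i → y i = 0) (a k i j : ι) :
    partialDeriv a (christoffel (fun z => Real.exp (2 * v z) • modelMetric s z) k i j) y
      = (if j = k then partialDeriv a (partialDeriv i v) y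
          - (if i = a then (1 / 2) * ind s k * ind s i else 0) else 0)
        + (if i = k then partialDeriv a (partialDeriv j v) y
          - (if j = a then (1 / 2) * ind s k * ind s j else 0) else 0)
        - (if i = j then partialDeriv a (partialDeriv k v) y
          - (if k = a then (1 / 2) * ind s i * ind s k else 0) else 0) := by
  set F : ι → ι → (ι → ℝ) → ℝ := fun k i z =>
    partialDeriv i v z + ind s k * roundLogDeriv s z i with hF
  have hFd : ∀ k i, DifferentiableAt ℝ (F k i) y := fun k i =>
    (differentiable_partialDeriv hv i y).fun_add
      ((differentiable_roundLogDeriv s i y).const_mul _)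
  have hFp : ∀ k i, partialDeriv a (F k i) y = partialDeriv a (partialDeriv i v) y
      - (if i = a then (1 / 2) * ind s k * ind s i else 0) := by
    intro k i
    rw [hF]
    simp only
    rw [partialDeriv_add (differentiable_partialDeriv hv i y)
      ((differentiable_roundLogDeriv s i y).const_mul _),
      partialDeriv_const_mul _ (differentiable_roundLogDeriv s i y), partialDeriv_roundLogDeriv,
      roundLogDeriv_center s hy, roundFactor_center s hy]
    split_ifs <;> ring
  set q : (ι → ℝ) → ℝ := fun z => (frameScale s z i / frameScale s z k) ^ 2 with hq
  have hd := differentiable_frameScale s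
  have h3 : DifferentiableAt ℝ (fun z => frameScale s z i / frameScale s z k) y := by
    simp only [div_eq_mul_inv]
    exact (hd i y).fun_mul ((hd k y).fun_inv (frameScale_pos s y k).ne')
  have hqd : DifferentiableAt ℝ q y := h3.fun_pow 2
  have hq1 : q y = 1 := by simp [hq, frameScale_center s hy]
  have hq0 : partialDeriv a q y = 0 := by
    have h1 : q = fun z => (frameScale s z i / frameScale s z k)
        * (frameScale s z i / frameScale s z k) := by
      funext z
      rw [hq]
      ring
    have h2 : partialDeriv a (fun z => frameScale s z i / frameScale s z k) y = 0 := by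
      have h4 : partialDeriv a (fun z => (frameScale s z i / frameScale s z k)
          * frameScale s z k) y = 0 := by
        have h5 : (fun z => (frameScale s z i / frameScale s z k) * frameScale s z k)
            = fun z => frameScale s z i := by
          funext z
          exact div_mul_cancel₀ _ (frameScale_pos s z k).ne'
        rw [h5, partialDeriv_frameScale, roundLogDeriv_center s hy]
        simp
      rw [partialDeriv_mul h3 (hd k y), partialDeriv_frameScale, roundLogDeriv_center s hy,
        frameScale_center s hy k] at h4
      simpa using h4
    rw [h1, partialDeriv_mul h3 h3, h2]
    simp
  have hd1 : ∀ (p : Prop) [Decidable p] (f : (ι → ℝ) → ℝ), DifferentiableAt ℝ f y →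
      DifferentiableAt ℝ (fun z => if p then f z else 0) y := by
    intro p _ f hf
    split_ifs
    · exact hf
    · exact differentiableAt_const _
  have hp1 : ∀ (p : Prop) [Decidable p] (f : (ι → ℝ) → ℝ),
      partialDeriv a (fun z => if p then f z else 0) y = if p then partialDeriv a f y else 0 := by
    intro p _ f
    split_ifs
    · rfl
    · exact partialDeriv_const _ _ _
  have h : christoffel (fun z => Real.exp (2 * v z) • modelMetric s z) k i j
      = fun z => (if j = k then F k i z else 0) + (if i = k then F k j z else 0)
        - (if i = j then q z * F i k z else 0) :=
    funext fun z => christoffel_conformal s hv k i j z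
  rw [h, partialDeriv_sub ((hd1 _ _ (hFd _ _)).fun_add (hd1 _ _ (hFd _ _)))
      (hd1 _ _ (hqd.fun_mul (hFd _ _))),
    partialDeriv_add (hd1 _ _ (hFd _ _)) (hd1 _ _ (hFd _ _)), hp1, hp1, hp1,
    partialDeriv_mul_of_eq_zero hqd (hFd _ _) hq1 hq0]
  simp only [hFp]

/-- The Ricci tensor of `e^{2v} g` at the centre of the coordinates: up to a multiple of the
metric, it is `Ric - (n - 2) (∇²v - dv ⊗ dv)`. The multiple `K = -Δv - (n - 2)|dv|²` plays no role
in the sequel. -/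
theorem ricci_conformal (hv : ContDiff ℝ 2 v) {y : ι → ℝ} (hy : ∀ i, s i → y i = 0) :
    ∃ K : ℝ, ∀ i j, ricci (fun z => Real.exp (2 * v z) • modelMetric s z) y ![i, j]
      = -((Fintype.card ι : ℝ) - 2) * (partialDeriv i (partialDeriv j v) y
          - partialDeriv i v y * partialDeriv j v y)
        + if i = j then (sphereDim s - 1) * ind s i + K else 0 := by
  set d : ι → ℝ := fun i => partialDeriv i v y with hd
  set D : ι → ι → ℝ := fun a i => partialDeriv a (partialDeriv i v) y with hD
  -- Symmetry of second derivatives.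
  have hsymm : ∀ i j, D i j = D j i := by
    intro i j
    have h1 : ∀ i j, D i j = fderiv ℝ (fderiv ℝ v) y (Pi.single i 1) (Pi.single j 1) := by
      intro i j
      have h : ContDiff ℝ 1 (fderiv ℝ v) := hv.fderiv_right (by norm_num)
      change fderiv ℝ (fun z => fderiv ℝ v z (Pi.single j 1)) y (Pi.single i 1) = _
      rw [fderiv_clm_apply (h.differentiable one_ne_zero y) (differentiableAt_const _)]
      simp
    rw [h1, h1]
    exact (hv.contDiffAt.isSymmSndFDerivAt (by simp)) _ _
  refine ⟨-(∑ m, D m m) - ((Fintype.card ι : ℝ) - 2) * ∑ m, d m * d m, fun i j => ?_⟩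
  have hΓ : ∀ k i j, christoffel (fun z => Real.exp (2 * v z) • modelMetric s z) k i j y
      = (if j = k then d i else 0) + (if i = k then d j else 0) - (if i = j then d k else 0) := by
    intro k i j
    rw [christoffel_conformal s hv]
    simp [roundLogDeriv_center s hy, frameScale_center s hy, hd]
  have hM : modelMetric s y = 1 := by
    simp [modelMetric, frameScale_center s hy]
  have hpos := Real.exp_ne_zero (2 * v y)
  have hinv : (Real.exp (2 * v y) • modelMetric s y)⁻¹
      = Matrix.diagonal fun _ => (Real.exp (2 * v y))⁻¹ := by
    rw [hM, ← Matrix.diagonal_one, ← Matrix.diagonal_smul]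
    rw [inv_diagonal_of_ne_zero fun i => by simp]
    simp
  have hG : ∀ a b, (Real.exp (2 * v y) • modelMetric s y) a b
      = if a = b then Real.exp (2 * v y) else 0 := by
    intro a b
    rw [hM]
    simp [Matrix.one_apply]
  have hR : ∀ i m j, riemann (fun z => Real.exp (2 * v z) • modelMetric s z) y ![i, m, j, m]
      = Real.exp (2 * v y) *
        (partialDeriv i (christoffel (fun z => Real.exp (2 * v z) • modelMetric s z) j m m) y
      - partialDeriv m (christoffel (fun z => Real.exp (2 * v z) • modelMetric s z) j i m) y
      + ∑ r, (christoffel (fun z => Real.exp (2 * v z) • modelMetric s z) j i r y *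
            christoffel (fun z => Real.exp (2 * v z) • modelMetric s z) r m m y
          - christoffel (fun z => Real.exp (2 * v z) • modelMetric s z) j m r y *
            christoffel (fun z => Real.exp (2 * v z) • modelMetric s z) r i m y)) := by
    intro i m j
    simp only [riemann, hG]
    rw [Finset.sum_eq_single j (fun b _ hb => by simp [Ne.symm hb]) (by simp)]
    simp
  have hRic : ricci (fun z => Real.exp (2 * v z) • modelMetric s z) y ![i, j]
      = ∑ m, ((partialDeriv i (christoffel (fun z => Real.exp (2 * v z) • modelMetric s z) j m m) y
      - partialDeriv m (christoffel (fun z => Real.exp (2 * v z) • modelMetric s z) j i m) y)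
      + ∑ r, (christoffel (fun z => Real.exp (2 * v z) • modelMetric s z) j i r y *
            christoffel (fun z => Real.exp (2 * v z) • modelMetric s z) r m m y
          - christoffel (fun z => Real.exp (2 * v z) • modelMetric s z) j m r y *
            christoffel (fun z => Real.exp (2 * v z) • modelMetric s z) r i m y)) := by
    unfold ricci
    rw [hinv]
    refine Finset.sum_congr rfl fun m _ => ?_
    rw [Finset.sum_eq_single m (fun t _ ht => by
      rw [Matrix.diagonal_apply_ne _ ht.symm, zero_mul]) (by simp), Matrix.diagonal_apply_eq]
    simp only [Matrix.cons_val_zero, Matrix.cons_val_one]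
    rw [hR]
    field_simp
  rw [hRic, Finset.sum_add_distrib, Finset.sum_sub_distrib]
  -- `∂ᵢ Γʲₘₘ`, `∂ₘ Γʲᵢₘ` and the quadratic terms are summed over `m` separately.
  have hA : ∑ m, partialDeriv i (christoffel (fun z => Real.exp (2 * v z) • modelMetric s z) j m m) y
      = (2 - (Fintype.card ι : ℝ)) * D i j
        + if i = j then (sphereDim s / 2 - 1) * ind s i else 0 := by
    have h1 : ∀ m, partialDeriv i
        (christoffel (fun z => Real.exp (2 * v z) • modelMetric s z) j m m) y
        = (if m = j then 2 * (D i m - if m = i then (1 / 2) * ind s j * ind s m else 0) else 0)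
          - D i j + (if j = i then (1 / 2) * ind s j else 0) * ind s m := by
      intro m
      rw [partialDeriv_christoffel_conformal s hv hy]
      simp only [if_true, ← hD]
      split_ifs <;> ring
    simp only [h1, Finset.sum_add_distrib, Finset.sum_sub_distrib, Finset.sum_ite_eq',
      Finset.mem_univ, if_true, ← Finset.mul_sum, ← sphereDim.eq_1]
    simp only [Finset.sum_const, Finset.card_univ, nsmul_eq_mul]
    by_cases h : i = j
    · subst h
      simp
      linear_combination -ind_mul_self s i
    · simp [h, Ne.symm h]
      ring
  have hB : ∑ m, partialDeriv m (christoffel (fun z => Real.exp (2 * v z) • modelMetric s z) j i m) y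
      = if i = j then (∑ m, D m m) - sphereDim s / 2 * ind s i else 0 := by
    have h1 : ∀ m, partialDeriv m
        (christoffel (fun z => Real.exp (2 * v z) • modelMetric s z) j i m) y
        = (if m = j then D m i - (if i = m then (1 / 2) * ind s j * ind s i else 0) else 0)
          + (if i = j then D m m - (1 / 2) * ind s j * ind s m else 0)
          - (if i = m then D m j - (if j = m then (1 / 2) * ind s i * ind s j else 0) else 0) := by
      intro m
      rw [partialDeriv_christoffel_conformal s hv hy]
      simp only [eq_self_iff_true, if_true, hD]
    simp only [h1, Finset.sum_add_distrib, Finset.sum_sub_distrib, Finset.sum_ite_eq',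
      Finset.sum_ite_eq, Finset.mem_univ, if_true]
    by_cases h : i = j
    · subst h
      simp only [if_true, Finset.sum_sub_distrib, ← Finset.mul_sum, ← sphereDim.eq_1]
      ring
    · simp [h, Ne.symm h, hsymm i j]
  have hC : ∑ m, ∑ r, (christoffel (fun z => Real.exp (2 * v z) • modelMetric s z) j i r y *
            christoffel (fun z => Real.exp (2 * v z) • modelMetric s z) r m m y
          - christoffel (fun z => Real.exp (2 * v z) • modelMetric s z) j m r y *
            christoffel (fun z => Real.exp (2 * v z) • modelMetric s z) r i m y)
      = ((Fintype.card ι : ℝ) - 2) * (d i * d j - if i = j then ∑ m, d m * d m else 0) := by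
    simp only [hΓ, eq_self_iff_true, if_true, Finset.sum_sub_distrib]
    have h1 : ∀ m, ∑ r, (((if r = j then d i else 0) + (if i = j then d r else 0)
          - (if i = r then d j else 0)) * ((if m = r then d m else 0) + (if m = r then d m else 0)
            - d r))
        = (if m = j then 2 * (d i * d m) else 0)
          + (if i = j then 2 * (d m * d m) - ∑ r, d r * d r else 0)
          - (if i = m then 2 * (d m * d j) else 0) := by
      intro m
      simp only [add_mul, sub_mul, mul_add, mul_sub, Finset.sum_add_distrib,
        Finset.sum_sub_distrib, ite_mul, zero_mul, mul_ite, mul_zero, Finset.sum_ite_eq',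
        Finset.sum_ite_eq, Finset.mem_univ, if_true]
      by_cases h : i = j
      · subst h
        by_cases hm : m = i
        · subst hm; simp [Finset.sum_add_distrib, Finset.sum_sub_distrib]; ring
        · simp [hm, Ne.symm hm, Finset.sum_add_distrib]; ring
      · by_cases hm : m = j
        · subst hm; simp [h, Ne.symm h]; ring
        · by_cases hm' : i = m
          · subst hm'; simp [h, Ne.symm h]; ring
          · simp [h, hm, hm']; ring
    have h2 : ∀ m, ∑ r, (((if r = j then d m else 0) + (if m = j then d r else 0)
          - (if m = r then d j else 0)) * ((if m = r then d i else 0) + (if i = r then d m else 0)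
            - (if i = m then d r else 0)))
        = (if i = j then d m * d m else 0) - d i * d j
          + (if m = j then 3 * (d i * d m) else 0) - (if i = m then d m * d j else 0)
          - (if i = m then (if m = j then ∑ r, d r * d r else 0) else 0) := by
      intro m
      simp only [add_mul, sub_mul, mul_add, mul_sub, Finset.sum_add_distrib,
        Finset.sum_sub_distrib, ite_mul, zero_mul, mul_ite, mul_zero, Finset.sum_ite_eq',
        Finset.sum_ite_eq, Finset.mem_univ, if_true]
      by_cases h : i = j
      · subst h
        by_cases hm : m = i
        · subst hm; simp [Finset.sum_add_distrib, Finset.sum_sub_distrib]; ring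
        · simp [hm, Ne.symm hm]; try ring
      · by_cases hm : m = j
        · subst hm; simp [h, Ne.symm h]; try ring
        · by_cases hm' : i = m
          · subst hm'; simp [h, Ne.symm h]; try ring
          · simp [h, hm, hm', Ne.symm h, Ne.symm hm']; try ring
    simp only [h1, h2, Finset.sum_add_distrib, Finset.sum_sub_distrib, Finset.sum_ite_eq',
      Finset.sum_ite_eq, Finset.mem_univ, if_true, Finset.sum_const, Finset.card_univ, nsmul_eq_mul]
    by_cases h : i = j
    · subst h
      simp [Finset.sum_sub_distrib, ← Finset.mul_sum]
      ring
    · simp [h]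
      ring
  rw [hA, hB, hC]
  by_cases h : i = j
  · subst h
    simp only [if_true, hd, hD]
    ring
  · simp only [h, if_false, hd, hD]
    ring

end CoordGeometry

/-! ### Stereographic coordinates -/

section Stereo

variable {n : ℕ} {F : Type*} [NormedAddCommGroup F] [InnerProductSpace ℝ F]

/-- The linear combination `∑ yᵢ bᵢ`, as a continuous linear function of `y`. -/
def frameMap (b : Fin n → F) : (Fin n → ℝ) →L[ℝ] F :=
  ∑ i, (ContinuousLinearMap.proj (R := ℝ) (φ := fun _ : Fin n => ℝ) i).smulRight (b i)

theorem frameMap_apply (b : Fin n → F) (y : Fin n → ℝ) : frameMap b y = ∑ i, y i • b i := by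
  simp [frameMap, sum_apply]

theorem inner_frameMap {b : Fin n → F} (hb : Orthonormal ℝ b) (y v : Fin n → ℝ) :
    inner ℝ (frameMap b y) (frameMap b v) = y ⬝ᵥ v := by
  rw [frameMap_apply, frameMap_apply, hb.inner_sum]
  simp [dotProduct]

theorem inner_frameMap_right {b : Fin n → F} {p : F} (hp : ∀ i, inner ℝ p (b i) = 0)
    (y : Fin n → ℝ) : inner ℝ p (frameMap b y) = 0 := by
  simp [frameMap_apply, inner_sum, inner_smul_right, hp]

/-- The inverse of the stereographic projection from `-p`, in the coordinates given by the vectors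
`b` orthogonal to `p`. -/
def stereoPoint (p : F) (b : Fin n → F) (y : Fin n → ℝ) : F :=
  (y ⬝ᵥ y + 4)⁻¹ • ((4 : ℝ) • frameMap b y + (4 - y ⬝ᵥ y) • p)

/-- The derivative of `stereoPoint` at `y` in the direction `v`. -/
def stereoDeriv (p : F) (b : Fin n → F) (y v : Fin n → ℝ) : F :=
  (y ⬝ᵥ y + 4)⁻¹ • ((4 : ℝ) • frameMap b v - (2 * (y ⬝ᵥ v)) • p)
    - (2 * (y ⬝ᵥ v) * ((y ⬝ᵥ y + 4)⁻¹) ^ 2) • ((4 : ℝ) • frameMap b y + (4 - y ⬝ᵥ y) • p)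

theorem dotProduct_self_add_four_pos (y : Fin n → ℝ) : 0 < y ⬝ᵥ y + 4 := by
  have : 0 ≤ y ⬝ᵥ y := Finset.sum_nonneg fun i _ => mul_self_nonneg _
  positivity

theorem contDiff_dotProduct_self : ContDiff ℝ ∞ (fun y : Fin n → ℝ => y ⬝ᵥ y) := by
  unfold dotProduct
  fun_prop

theorem contDiff_stereoPoint (p : F) (b : Fin n → F) : ContDiff ℝ ∞ (stereoPoint p b) := by
  have h := contDiff_dotProduct_self (n := n)
  unfold stereoPoint
  refine ContDiff.smul (ContDiff.inv (h.add contDiff_const)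
    fun y => (dotProduct_self_add_four_pos y).ne') ?_
  exact (contDiff_const.smul (frameMap b).contDiff).add
    ((contDiff_const.sub h).smul contDiff_const)

theorem fderiv_stereoPoint (p : F) (b : Fin n → F) (y v : Fin n → ℝ) :
    fderiv ℝ (stereoPoint p b) y v = stereoDeriv p b y v := by
  have hq : HasDerivAt (fun t : ℝ => (y + t • v) ⬝ᵥ (y + t • v)) (2 * (y ⬝ᵥ v)) 0 := by
    have h1 : (fun t : ℝ => (y + t • v) ⬝ᵥ (y + t • v))
        = fun t : ℝ => y ⬝ᵥ y + t * (2 * (y ⬝ᵥ v)) + t ^ 2 * (v ⬝ᵥ v) := by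
      funext t
      simp [dotProduct_comm v y]
      ring
    rw [h1]
    have h2 := (((hasDerivAt_id (0 : ℝ)).mul_const (2 * (y ⬝ᵥ v))).const_add (y ⬝ᵥ y)).fun_add
      (((hasDerivAt_id (0 : ℝ)).fun_pow 2).mul_const (v ⬝ᵥ v))
    simpa using h2
  have hW : HasDerivAt (fun t : ℝ => frameMap b (y + t • v)) (frameMap b v) 0 := by
    have h1 : (fun t : ℝ => frameMap b (y + t • v))
        = fun t : ℝ => frameMap b y + t • frameMap b v := by
      funext t
      simp
    rw [h1]
    simpa using ((hasDerivAt_id (0 : ℝ)).smul_const (frameMap b v)).const_add (frameMap b y)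
  have hq0 : (y + (0 : ℝ) • v) ⬝ᵥ (y + (0 : ℝ) • v) = y ⬝ᵥ y := by simp
  have h0 := dotProduct_self_add_four_pos y
  have hd : HasDerivAt (fun t : ℝ => stereoPoint p b (y + t • v)) (stereoDeriv p b y v) 0 := by
    have h1 := (hq.add_const 4).fun_inv (by rw [hq0]; exact h0.ne')
    have h2 := (hW.fun_const_smul (4 : ℝ)).fun_add ((hq.const_sub 4).smul_const p)
    have h3 := h1.fun_smul h2
    refine h3.congr_deriv ?_
    simp only [hq0, zero_smul, add_zero, stereoDeriv]
    rw [sub_eq_add_neg _ ((2 * (y ⬝ᵥ v) * ((y ⬝ᵥ y + 4)⁻¹) ^ 2) • _), ← neg_smul]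
    congr 2
    · rw [neg_smul, sub_eq_add_neg]
    · field_simp
  have h1 := ((contDiff_stereoPoint p b).differentiable (by simp) y).hasFDerivAt.hasLineDerivAt v
  exact HasDerivAt.unique h1 hd

variable {p : F} {b : Fin n → F}

theorem inner_stereoPoint_self (hp : ‖p‖ = 1) (hb : Orthonormal ℝ b) (hpb : ∀ i, inner ℝ p (b i) = 0)
    (y : Fin n → ℝ) : inner ℝ (stereoPoint p b y) (stereoPoint p b y) = 1 := by
  have h0 := dotProduct_self_add_four_pos y
  have h1 := fun v => inner_frameMap_right hpb v
  have h2 : ∀ v, inner ℝ (frameMap b v) p = 0 := fun v => by rw [real_inner_comm, h1]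
  simp only [stereoPoint, inner_add_left, inner_add_right, inner_smul_left, inner_smul_right, h1, h2,
    inner_frameMap hb, real_inner_self_eq_norm_sq p, hp]
  simp
  field_simp
  ring

theorem inner_stereoPoint_stereoDeriv (hp : ‖p‖ = 1) (hb : Orthonormal ℝ b)
    (hpb : ∀ i, inner ℝ p (b i) = 0) (y v : Fin n → ℝ) :
    inner ℝ (stereoPoint p b y) (stereoDeriv p b y v) = 0 := by
  have h0 := dotProduct_self_add_four_pos y
  have h1 := fun v => inner_frameMap_right hpb v
  have h2 : ∀ v, inner ℝ (frameMap b v) p = 0 := fun v => by rw [real_inner_comm, h1]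
  simp only [stereoPoint, stereoDeriv, inner_add_left, inner_add_right, inner_sub_left,
    inner_sub_right, inner_smul_left, inner_smul_right, h1, h2,
    inner_frameMap hb, real_inner_self_eq_norm_sq p, hp]
  simp
  field_simp
  ring

/-- The inverse stereographic projection is conformal, with factor `4 / (4 + |y|²)`. -/
theorem inner_stereoDeriv (hp : ‖p‖ = 1) (hb : Orthonormal ℝ b)
    (hpb : ∀ i, inner ℝ p (b i) = 0) (y v w : Fin n → ℝ) :
    inner ℝ (stereoDeriv p b y v) (stereoDeriv p b y w) = (4 / (4 + y ⬝ᵥ y)) ^ 2 * (v ⬝ᵥ w) := by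
  have h0 := dotProduct_self_add_four_pos y
  have h0' : 4 + y ⬝ᵥ y ≠ 0 := by rw [add_comm]; exact h0.ne'
  have h1 := fun v => inner_frameMap_right hpb v
  have h2 : ∀ v, inner ℝ (frameMap b v) p = 0 := fun v => by rw [real_inner_comm, h1]
  simp only [stereoPoint, stereoDeriv, inner_add_left, inner_add_right, inner_sub_left,
    inner_sub_right, inner_smul_left, inner_smul_right, h1, h2,
    inner_frameMap hb, real_inner_self_eq_norm_sq p, hp, dotProduct_comm v y]
  simp
  field_simp
  ring

end Stereo

section Sphere

variable {n : ℕ}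

/-- The orthonormal frame at `x` which determines the stereographic coordinates around `x`. -/
def sphereFrame (x : RoundSphere n) (i : Fin n) : EuclideanSpace ℝ (Fin (n + 1)) :=
  haveI : Fact (Module.finrank ℝ (EuclideanSpace ℝ (Fin (n + 1))) = n + 1) :=
    ⟨finrank_euclideanSpace_fin⟩
  (OrthonormalBasis.fromOrthogonalSpanSingleton (𝕜 := ℝ) n (ne_zero_of_mem_unit_sphere (-x)) i : _)

theorem orthonormal_sphereFrame (x : RoundSphere n) : Orthonormal ℝ (sphereFrame x) := by
  have : Fact (Module.finrank ℝ (EuclideanSpace ℝ (Fin (n + 1))) = n + 1) :=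
    ⟨finrank_euclideanSpace_fin⟩
  exact (OrthonormalBasis.fromOrthogonalSpanSingleton (𝕜 := ℝ) n
    (ne_zero_of_mem_unit_sphere (-x))).orthonormal.comp_linearIsometry (Submodule.subtypeₗᵢ _)

theorem inner_sphereFrame (x : RoundSphere n) (i : Fin n) :
    inner ℝ (x : EuclideanSpace ℝ (Fin (n + 1))) (sphereFrame x i) = 0 := by
  have : Fact (Module.finrank ℝ (EuclideanSpace ℝ (Fin (n + 1))) = n + 1) :=
    ⟨finrank_euclideanSpace_fin⟩
  have h := Submodule.mem_orthogonal_singleton_iff_inner_right.1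
    (OrthonormalBasis.fromOrthogonalSpanSingleton (𝕜 := ℝ) n (ne_zero_of_mem_unit_sphere (-x)) i).2
  have h2 : inner ℝ (-(x : EuclideanSpace ℝ (Fin (n + 1)))) (sphereFrame x i) = 0 := h
  simpa using h2

theorem stdBasis_equivFun (z : EuclideanSpace ℝ (Fin n)) : (stdBasis n).equivFun z = z.ofLp := by
  ext i
  simp [stdBasis]

theorem stdBasis_equivFun_symm (y : Fin n → ℝ) :
    (stdBasis n).equivFun.symm y = WithLp.toLp 2 y := by
  rw [LinearEquiv.symm_apply_eq, stdBasis_equivFun]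

/-- The preferred chart of Mathlib at a point of the sphere is the stereographic projection from the
antipodal point. -/
theorem param_sphere (x : RoundSphere n) (y : Fin n → ℝ) :
    ((param (𝓡 n) (stdBasis n) x y : RoundSphere n) : EuclideanSpace ℝ (Fin (n + 1)))
      = stereoPoint (x : EuclideanSpace ℝ (Fin (n + 1))) (sphereFrame x) y := by
  have : Fact (Module.finrank ℝ (EuclideanSpace ℝ (Fin (n + 1))) = n + 1) :=
    ⟨finrank_euclideanSpace_fin⟩
  have h1 : ((param (𝓡 n) (stdBasis n) x y : RoundSphere n) : EuclideanSpace ℝ (Fin (n + 1)))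
      = ((stereographic' n (-x)).symm ((stdBasis n).equivFun.symm y)) := rfl
  rw [h1, stereographic'_symm_apply]
  set B := OrthonormalBasis.fromOrthogonalSpanSingleton (𝕜 := ℝ) n
    (ne_zero_of_mem_unit_sphere (-x)) with hB
  have h2 : ((B.repr.symm ((stdBasis n).equivFun.symm y) : _) : EuclideanSpace ℝ (Fin (n + 1)))
      = frameMap (sphereFrame x) y := by
    rw [stdBasis_equivFun_symm, ← B.sum_repr_symm, frameMap_apply, Submodule.coe_sum]
    rfl
  have h3 : ‖frameMap (sphereFrame x) y‖ ^ 2 = y ⬝ᵥ y := by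
    rw [← real_inner_self_eq_norm_sq, inner_frameMap (orthonormal_sphereFrame x)]
  simp only [h2, h3, stereoPoint]
  rw [smul_add]
  congr 2
  rw [coe_neg_sphere, smul_neg, ← neg_smul, neg_sub]

end Sphere

/-! ### Gram matrices of round spheres, flat tori and products -/

section Sphere

variable {n : ℕ}

theorem contMDiff_param_sphere (x : RoundSphere n) :
    ContMDiff 𝓘(ℝ, Fin n → ℝ) (𝓡 n) ∞ (param (𝓡 n) (stdBasis n) x) := by
  have h1 := contMDiffOn_extChartAt_symm (I := 𝓡 n) (n := ∞) x
  have ht : (extChartAt (𝓡 n) x).target = Set.univ := by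
    rw [extChartAt_target]
    have : (chartAt (EuclideanSpace ℝ (Fin n)) x).target = Set.univ := by
      have : Fact (Module.finrank ℝ (EuclideanSpace ℝ (Fin (n + 1))) = n + 1) :=
        ⟨finrank_euclideanSpace_fin⟩
      exact stereographic'_target (-x)
    simp [this]
  rw [ht, contMDiffOn_univ] at h1
  exact h1.comp ((stdBasis n).equivFun.symm.toContinuousLinearEquiv.contDiff.contMDiff)

theorem gram_roundMetric (x : RoundSphere n) (y : Fin n → ℝ) :
    gram (stdBasis n) (roundMetric n) x y
      = Matrix.diagonal fun _ => (4 / (4 + y ⬝ᵥ y)) ^ 2 := by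
  have : Fact (Module.finrank ℝ (EuclideanSpace ℝ (Fin (n + 1))) = n + 1) :=
    ⟨finrank_euclideanSpace_fin⟩
  have hcomp : (fun z => ((param (𝓡 n) (stdBasis n) x z : RoundSphere n) :
      EuclideanSpace ℝ (Fin (n + 1)))) = stereoPoint (x : EuclideanSpace ℝ (Fin (n + 1)))
        (sphereFrame x) := funext fun z => param_sphere x z
  have hd : ∀ v : Fin n → ℝ,
      mfderiv (𝓡 n) 𝓘(ℝ, EuclideanSpace ℝ (Fin (n + 1)))
        (fun z : RoundSphere n => (z : EuclideanSpace ℝ (Fin (n + 1))))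
        (param (𝓡 n) (stdBasis n) x y)
        (mfderiv 𝓘(ℝ, Fin n → ℝ) (𝓡 n) (param (𝓡 n) (stdBasis n) x) y v)
      = stereoDeriv (x : EuclideanSpace ℝ (Fin (n + 1))) (sphereFrame x) y v := by
    intro v
    rw [← fderiv_stereoPoint, ← hcomp, ← mfderiv_eq_fderiv]
    have h := mfderiv_comp (I := 𝓘(ℝ, Fin n → ℝ)) (I' := 𝓡 n)
      (I'' := 𝓘(ℝ, EuclideanSpace ℝ (Fin (n + 1)))) y
      (g := fun z : RoundSphere n => (z : EuclideanSpace ℝ (Fin (n + 1))))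
      (f := param (𝓡 n) (stdBasis n) x)
      ((contMDiff_coe_sphere (m := ∞)).mdifferentiable (by simp) _)
      ((contMDiff_param_sphere x).mdifferentiable (by simp) _)
    exact (congrArg (fun L => L v) h).symm
  ext i j
  have h1 : gram (stdBasis n) (roundMetric n) x y i j
      = inner ℝ (stereoDeriv (x : EuclideanSpace ℝ (Fin (n + 1))) (sphereFrame x) y
          (Pi.single i 1)) (stereoDeriv (x : EuclideanSpace ℝ (Fin (n + 1))) (sphereFrame x) y
          (Pi.single j 1)) := by
    rw [← hd, ← hd]
    rfl
  rw [h1, inner_stereoDeriv (by simp) (orthonormal_sphereFrame x) (inner_sphereFrame x)]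
  by_cases h : i = j
  · subst h
    simp
  · simp [h]

theorem coord_sphere_self (x : RoundSphere n) : coord (𝓡 n) (stdBasis n) x x = 0 := by
  have : Fact (Module.finrank ℝ (EuclideanSpace ℝ (Fin (n + 1))) = n + 1) :=
    ⟨finrank_euclideanSpace_fin⟩
  have h : stereographic' n (-x) x = 0 := by
    simp only [stereographic', OpenPartialHomeomorph.coe_trans, Function.comp_apply]
    have : stereographic (norm_eq_of_mem_sphere (-x)) x = 0 := stereographic_neg_apply x
    rw [this]
    exact (OrthonormalBasis.fromOrthogonalSpanSingleton (𝕜 := ℝ) n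
      (ne_zero_of_mem_unit_sphere (-x))).repr.map_zero
  have h2 : coord (𝓡 n) (stdBasis n) x x = (stdBasis n).equivFun (stereographic' n (-x) x) := rfl
  rw [h2, h, map_zero]

end Sphere

section Torus

variable {k : ℕ} (Λ : Submodule ℤ (EuclideanSpace ℝ (Fin k))) [DiscreteTopology Λ]

/-- All charts of the torus have the same inverse, the projection `ℝᵏ → ℝᵏ/Λ`; they differ in their
targets. -/
theorem param_torus (q : FlatTorus Λ) (y : Fin k → ℝ) :
    param (𝓡 k) (stdBasis k) q y = torusProj Λ (WithLp.toLp 2 y) := by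
  rw [← torus_chart_symm Λ (chartAt _ q) (chart_mem_atlas _ q), ← stdBasis_equivFun_symm]
  rfl

theorem contMDiff_torusProj : ContMDiff (𝓡 k) (𝓡 k) ∞ (torusProj Λ) := by
  intro z
  set e := chartAt (EuclideanSpace ℝ (Fin k)) (torusProj Λ z)
  have he := chart_mem_atlas (EuclideanSpace ℝ (Fin k)) (torusProj Λ z)
  have hz : torusProj Λ z ∈ e.source := mem_chart_source _ _
  obtain ⟨c, hc⟩ := torus_chart_trans Λ e he hz
  have h1 : ContMDiffAt (𝓡 k) (𝓡 k) ∞ e.symm (z + c) := by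
    have h2 : z + c ∈ e.target := hc.self_of_nhds ▸ e.map_source hz
    exact (contMDiffOn_chart_symm (I := 𝓡 k) (n := ∞) (x := torusProj Λ z)).contMDiffAt
      (e.open_target.mem_nhds h2)
  have h3 : ContMDiffAt (𝓡 k) (𝓡 k) ∞ (fun y : EuclideanSpace ℝ (Fin k) => y + c) z :=
    (contDiff_id.add contDiff_const).contMDiff.contMDiffAt
  refine (ContMDiffAt.comp z h1 h3).congr_of_eventuallyEq ?_
  filter_upwards [hc, (torusProj_isLocalHomeomorph Λ).continuous.continuousAt.preimage_mem_nhds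
      (e.open_source.mem_nhds hz)] with y hy hy2
  rw [Function.comp_apply, ← hy]
  exact (e.left_inv hy2).symm

theorem contMDiff_param_torus (q : FlatTorus Λ) :
    ContMDiff 𝓘(ℝ, Fin k → ℝ) (𝓡 k) ∞ (param (𝓡 k) (stdBasis k) q) := by
  have h : param (𝓡 k) (stdBasis k) q
      = torusProj Λ ∘ (stdBasis k).equivFun.symm.toContinuousLinearEquiv := by
    funext y
    rw [param_torus, ← stdBasis_equivFun_symm]
    rfl
  rw [h]
  exact (contMDiff_torusProj Λ).comp
    ((stdBasis k).equivFun.symm.toContinuousLinearEquiv.contDiff.contMDiff)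

theorem gram_flatMetric (q : FlatTorus Λ) (y : Fin k → ℝ) :
    gram (stdBasis k) (flatMetric Λ) q y = 1 := by
  have h : param (𝓡 k) (stdBasis k) q
      = torusProj Λ ∘ (stdBasis k).equivFun.symm.toContinuousLinearEquiv := by
    funext y
    rw [param_torus, ← stdBasis_equivFun_symm]
    rfl
  have hd : ∀ v : Fin k → ℝ, mfderiv 𝓘(ℝ, Fin k → ℝ) (𝓡 k) (param (𝓡 k) (stdBasis k) q) y v
      = mfderiv (𝓡 k) (𝓡 k) (torusProj Λ) (WithLp.toLp 2 y) (WithLp.toLp 2 v : EuclideanSpace ℝ (Fin k)) := by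
    intro v
    rw [h, mfderiv_comp (I' := 𝓡 k) y ((contMDiff_torusProj Λ).mdifferentiable (by simp) _)
      ((stdBasis k).equivFun.symm.toContinuousLinearEquiv.contDiff.contMDiff.mdifferentiable
        (n := ∞) (by simp) _)]
    have h1 : ∀ v, mfderiv 𝓘(ℝ, Fin k → ℝ) (𝓡 k) (stdBasis k).equivFun.symm.toContinuousLinearEquiv y v
        = (stdBasis k).equivFun.symm.toContinuousLinearEquiv v := by
      intro v
      rw [mfderiv_eq_fderiv, ContinuousLinearEquiv.fderiv]
      rfl
    have h2 := congrArg (mfderiv (𝓡 k) (𝓡 k) (torusProj Λ)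
      ((stdBasis k).equivFun.symm.toContinuousLinearEquiv y)) (h1 v)
    refine Eq.trans h2 ?_
    change mfderiv (𝓡 k) (𝓡 k) (torusProj Λ) ((stdBasis k).equivFun.symm y)
      ((stdBasis k).equivFun.symm v) = _
    rw [stdBasis_equivFun_symm, stdBasis_equivFun_symm]
  ext i j
  have h1 := flatMetric_proj Λ (WithLp.toLp 2 y) (WithLp.toLp 2 (Pi.single i 1))
    (WithLp.toLp 2 (Pi.single j 1))
  rw [← hd, ← hd, ← param_torus Λ q] at h1
  refine Eq.trans h1 ?_
  simp [PiLp.inner_apply, Matrix.one_apply, Pi.single_apply]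

end Torus

section Product

variable {m n : ℕ}
  {H : Type*} [TopologicalSpace H] {I : ModelWithCorners ℝ (EuclideanSpace ℝ (Fin m)) H}
  {M : Type*} [TopologicalSpace M] [ChartedSpace H M] [IsManifold I ∞ M]
  {H' : Type*} [TopologicalSpace H'] {I' : ModelWithCorners ℝ (EuclideanSpace ℝ (Fin n)) H'}
  {N : Type*} [TopologicalSpace N] [ChartedSpace H' N] [IsManifold I' ∞ N]

theorem prodBasis_equivFun_symm (y : Fin m ⊕ Fin n → ℝ) :
    (prodBasis m n).equivFun.symm y
      = ((stdBasis m).equivFun.symm (y ∘ Sum.inl), (stdBasis n).equivFun.symm (y ∘ Sum.inr)) := by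
  rw [LinearEquiv.symm_apply_eq]
  ext (i | i)
  · simp [prodBasis, stdBasis_equivFun_symm]
    simp [Finsupp.single_apply]
  · simp [prodBasis, stdBasis_equivFun_symm]
    simp [Finsupp.single_apply]

theorem param_prod (x : M × N) (y : Fin m ⊕ Fin n → ℝ) :
    param (I.prod I') (prodBasis m n) x y
      = (param I (stdBasis m) x.1 (y ∘ Sum.inl), param I' (stdBasis n) x.2 (y ∘ Sum.inr)) := by
  rw [param, prodBasis_equivFun_symm, extChartAt_prod]
  rfl

theorem coord_prod (x z : M × N) :
    coord (I.prod I') (prodBasis m n) x z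
      = Sum.elim (coord I (stdBasis m) x.1 z.1) (coord I' (stdBasis n) x.2 z.2) := by
  rw [coord, ← LinearEquiv.eq_symm_apply, prodBasis_equivFun_symm, extChartAt_prod]
  simp only [Sum.elim_comp_inl, Sum.elim_comp_inr]
  simp [coord]

/-- Restriction of coordinates of a product to one of the factors. -/
def restrictCoord {α β : Type*} [Fintype α] [Fintype β] (f : α → β) : (β → ℝ) →L[ℝ] (α → ℝ) :=
  ContinuousLinearMap.pi fun i => ContinuousLinearMap.proj (f i)

/-- The coordinates of a product are the coordinates of the factors, so the Gram matrix of a product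
metric is block diagonal. -/
theorem gram_prod (g : RiemMetric I M) (h : RiemMetric I' N) (x : M × N) (y : Fin m ⊕ Fin n → ℝ)
    (hM : MDifferentiable 𝓘(ℝ, Fin m → ℝ) I (param I (stdBasis m) x.1))
    (hN : MDifferentiable 𝓘(ℝ, Fin n → ℝ) I' (param I' (stdBasis n) x.2)) :
    gram (prodBasis m n) (g.prod h) x y
      = Matrix.fromBlocks (gram (stdBasis m) g x.1 (y ∘ Sum.inl)) 0 0
          (gram (stdBasis n) h x.2 (y ∘ Sum.inr)) := by
  set A : (Fin m ⊕ Fin n → ℝ) →L[ℝ] (Fin m → ℝ) := restrictCoord Sum.inl with hA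
  set B : (Fin m ⊕ Fin n → ℝ) →L[ℝ] (Fin n → ℝ) := restrictCoord Sum.inr with hB
  have hp : param (I.prod I') (prodBasis m n) x
      = fun y => (param I (stdBasis m) x.1 (A y), param I' (stdBasis n) x.2 (B y)) :=
    funext fun y => param_prod x y
  have hdA : HasMFDerivAt 𝓘(ℝ, Fin m ⊕ Fin n → ℝ) I (fun y => param I (stdBasis m) x.1 (A y)) y
      ((mfderiv 𝓘(ℝ, Fin m → ℝ) I (param I (stdBasis m) x.1) (A y)).comp A) :=
    HasMFDerivAt.comp (g := param I (stdBasis m) x.1) (f := A) y (hM (A y)).hasMFDerivAt A.hasFDerivAt.hasMFDerivAt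
  have hdB : HasMFDerivAt 𝓘(ℝ, Fin m ⊕ Fin n → ℝ) I' (fun y => param I' (stdBasis n) x.2 (B y)) y
      ((mfderiv 𝓘(ℝ, Fin n → ℝ) I' (param I' (stdBasis n) x.2) (B y)).comp B) :=
    HasMFDerivAt.comp (g := param I' (stdBasis n) x.2) (f := B) y (hN (B y)).hasMFDerivAt B.hasFDerivAt.hasMFDerivAt
  have hd := (hdA.prodMk hdB).mfderiv
  rw [← hp] at hd
  -- The pulled back bilinear forms, as functions on coordinate vectors.
  set β : (Fin m → ℝ) → (Fin m → ℝ) → ℝ := fun v w => g.inner (param I (stdBasis m) x.1 (A y))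
    (mfderiv 𝓘(ℝ, Fin m → ℝ) I (param I (stdBasis m) x.1) (A y) v)
    (mfderiv 𝓘(ℝ, Fin m → ℝ) I (param I (stdBasis m) x.1) (A y) w) with hβ
  set γ : (Fin n → ℝ) → (Fin n → ℝ) → ℝ := fun v w => h.inner (param I' (stdBasis n) x.2 (B y))
    (mfderiv 𝓘(ℝ, Fin n → ℝ) I' (param I' (stdBasis n) x.2) (B y) v)
    (mfderiv 𝓘(ℝ, Fin n → ℝ) I' (param I' (stdBasis n) x.2) (B y) w) with hγ
  have hβ0 : ∀ v, β 0 v = 0 ∧ β v 0 = 0 := fun v => by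
    constructor
    · refine Eq.trans (congrArg (fun z => g.inner (param I (stdBasis m) x.1 (A y)) z _)
        (map_zero (mfderiv 𝓘(ℝ, Fin m → ℝ) I (param I (stdBasis m) x.1) (A y)))) ?_
      simp
    · refine Eq.trans (congrArg (fun z => g.inner (param I (stdBasis m) x.1 (A y)) _ z)
        (map_zero (mfderiv 𝓘(ℝ, Fin m → ℝ) I (param I (stdBasis m) x.1) (A y)))) ?_
      simp
  have hγ0 : ∀ v, γ 0 v = 0 ∧ γ v 0 = 0 := fun v => by
    constructor
    · refine Eq.trans (congrArg (fun z => h.inner (param I' (stdBasis n) x.2 (B y)) z _)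
        (map_zero (mfderiv 𝓘(ℝ, Fin n → ℝ) I' (param I' (stdBasis n) x.2) (B y)))) ?_
      simp
    · refine Eq.trans (congrArg (fun z => h.inner (param I' (stdBasis n) x.2 (B y)) _ z)
        (map_zero (mfderiv 𝓘(ℝ, Fin n → ℝ) I' (param I' (stdBasis n) x.2) (B y)))) ?_
      simp
  have key : ∀ i j, gram (prodBasis m n) (g.prod h) x y i j
      = β (A (Pi.single i 1)) (A (Pi.single j 1)) + γ (B (Pi.single i 1)) (B (Pi.single j 1)) := by
    intro i j
    rw [gram, Matrix.of_apply, hd, hp]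
    rfl
  have hAl : ∀ i, A (Pi.single (Sum.inl i) (1 : ℝ)) = Pi.single i 1 := by
    intro i; ext j; simp [hA, restrictCoord, Pi.single_apply]
  have hAr : ∀ i, A (Pi.single (Sum.inr i) (1 : ℝ)) = 0 := by
    intro i; ext j; simp [hA, restrictCoord, Pi.single_apply]
  have hBl : ∀ i, B (Pi.single (Sum.inl i) (1 : ℝ)) = 0 := by
    intro i; ext j; simp [hB, restrictCoord, Pi.single_apply]
  have hBr : ∀ i, B (Pi.single (Sum.inr i) (1 : ℝ)) = Pi.single i 1 := by
    intro i; ext j; simp [hB, restrictCoord, Pi.single_apply]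
  ext (i | i) (j | j)
  · rw [key, hAl, hAl, hBl, (hγ0 _).1, Matrix.fromBlocks_apply₁₁, add_zero]
    rfl
  · rw [key, hAr, hBl, (hγ0 _).1, (hβ0 _).2]
    simp
  · rw [key, hAr, hBl, (hγ0 _).2, (hβ0 _).1]
    simp
  · rw [key, hAr, hBr, hBr, (hβ0 _).1, Matrix.fromBlocks_apply₂₂, zero_add]
    rfl

end Product

/-! ### The Riemannian volume measure -/

section Volume

variable {E : Type*} [NormedAddCommGroup E] [NormedSpace ℝ E]
  {H : Type*} [TopologicalSpace H] {I : ModelWithCorners ℝ E H}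
  {M : Type*} [TopologicalSpace M] [ChartedSpace H M] [IsManifold I ∞ M]
  {ι : Type*} [Fintype ι] [DecidableEq ι]

/-- The density `√(det g)` of the Riemannian volume in the coordinates around `x`. -/
def gramDensity (b : Module.Basis ι ℝ E) (g : RiemMetric I M) (x : M) (y : ι → ℝ) : ENNReal :=
  ENNReal.ofReal (Real.sqrt (gram b g x y).det)

/-- The Riemannian volume of the coordinate neighbourhood of `x`, as a measure on `M`. -/
def chartVolume [MeasurableSpace M] (b : Module.Basis ι ℝ E) (g : RiemMetric I M) (x : M) :
    Measure M :=
  Measure.map (param I b x) ((volume.restrict (coordTarget I b x)).withDensity (gramDensity b g x))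

/-- A measure which agrees with the Riemannian volume on open coordinate neighbourhoods covering `M`
is the Riemannian volume. -/
theorem iSup_chartVolume_eq [MeasurableSpace M] [OpensMeasurableSpace M]
    [SecondCountableTopology M] {b : Module.Basis ι ℝ E} {g : RiemMetric I M} {μ : Measure M}
    {U : M → Set M} (hU : ∀ x, IsOpen (U x)) (hx : ∀ x, x ∈ U x)
    (h : ∀ x, chartVolume b g x = μ.restrict (U x)) :
    ⨆ x, chartVolume b g x = μ := by
  obtain ⟨t, ht, htu⟩ := TopologicalSpace.countable_cover_nhds fun x => (hU x).mem_nhds (hx x)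
  have hle : ⨆ x, chartVolume b g x ≤ μ := iSup_le fun x => (h x).trans_le Measure.restrict_le_self
  have : Countable t := ht
  refine (Measure.ext_iff_of_iUnion_eq_univ (s := fun x : t => U x) (by
    rw [← htu, Set.biUnion_eq_iUnion])).2 fun x => le_antisymm ?_ ?_
  · exact Measure.restrict_mono le_rfl hle
  · have h1 : μ.restrict (U x) ≤ ⨆ x, chartVolume b g x :=
      (h x).symm.trans_le (le_iSup (chartVolume b g) (x : M))
    have h2 := Measure.restrict_mono (le_refl (U x)) h1
    rwa [Measure.restrict_restrict (hU x).measurableSet, Set.inter_self] at h2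

theorem totalIntegral_eq_integral [mM : MeasurableSpace M] [BorelSpace M]
    [SecondCountableTopology M] {b : Module.Basis ι ℝ E} {g : RiemMetric I M} {μ : Measure M}
    {U : M → Set M} (hU : ∀ x, IsOpen (U x)) (hx : ∀ x, x ∈ U x)
    (h : ∀ x, chartVolume b g x = μ.restrict (U x))
    (F : ((ι → ℝ) → Matrix ι ι ℝ) → (ι → ℝ) → ℝ) :
    totalIntegral b g F = ∫ x, F (gram b g x) (coord I b x x) ∂μ := by
  have h1 := iSup_chartVolume_eq hU hx h
  obtain rfl : mM = borel M := BorelSpace.measurable_eq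
  rw [← h1]
  rfl

theorem riemVol_eq_measureReal [mM : MeasurableSpace M] [BorelSpace M]
    [SecondCountableTopology M] {b : Module.Basis ι ℝ E} {g : RiemMetric I M} {μ : Measure M}
    {U : M → Set M} (hU : ∀ x, IsOpen (U x)) (hx : ∀ x, x ∈ U x)
    (h : ∀ x, chartVolume b g x = μ.restrict (U x)) :
    riemVol b g = μ.real Set.univ := by
  have h1 := iSup_chartVolume_eq hU hx h
  obtain rfl : mM = borel M := BorelSpace.measurable_eq
  rw [← h1]
  rfl

end Volume

theorem MeasurePreserving.map_withDensity_comp {α β : Type*} [MeasurableSpace α]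
    [MeasurableSpace β] {μ : Measure α} {ν : Measure β} {f : α → β} (hf : MeasurePreserving f μ ν)
    {F : β → ENNReal} (hF : Measurable F) :
    Measure.map f (μ.withDensity (F ∘ f)) = ν.withDensity F := by
  ext s hs
  rw [Measure.map_apply hf.measurable hs, withDensity_apply _ (hf.measurable hs),
    withDensity_apply _ hs]
  exact hf.setLIntegral_comp_preimage hs hF

section Product

variable {m n : ℕ}
  {H : Type*} [TopologicalSpace H] {I : ModelWithCorners ℝ (EuclideanSpace ℝ (Fin m)) H}
  {M : Type*} [TopologicalSpace M] [ChartedSpace H M] [IsManifold I ∞ M]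
  {H' : Type*} [TopologicalSpace H'] {I' : ModelWithCorners ℝ (EuclideanSpace ℝ (Fin n)) H'}
  {N : Type*} [TopologicalSpace N] [ChartedSpace H' N] [IsManifold I' ∞ N]

theorem coordTarget_prod (x : M × N) :
    coordTarget (I.prod I') (prodBasis m n) x
      = MeasurableEquiv.sumPiEquivProdPi (fun _ : Fin m ⊕ Fin n => ℝ) ⁻¹'
          (coordTarget I (stdBasis m) x.1 ×ˢ coordTarget I' (stdBasis n) x.2) := by
  ext y
  rw [coordTarget, Set.mem_preimage, prodBasis_equivFun_symm, extChartAt_prod]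
  rfl

theorem gramDensity_prod {g : RiemMetric I M} {h : RiemMetric I' N} {x : M × N}
    (hg : ∀ y, (gram (stdBasis m) g x.1 y).PosSemidef)
    (hM : MDifferentiable 𝓘(ℝ, Fin m → ℝ) I (param I (stdBasis m) x.1))
    (hN : MDifferentiable 𝓘(ℝ, Fin n → ℝ) I' (param I' (stdBasis n) x.2))
    (y : Fin m ⊕ Fin n → ℝ) :
    gramDensity (prodBasis m n) (g.prod h) x y
      = gramDensity (stdBasis m) g x.1 (y ∘ Sum.inl) *
          gramDensity (stdBasis n) h x.2 (y ∘ Sum.inr) := by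
  rw [gramDensity, gram_prod g h x y hM hN, Matrix.det_fromBlocks_zero₂₁,
    Real.sqrt_mul (hg _).det_nonneg, ENNReal.ofReal_mul (Real.sqrt_nonneg _)]
  rfl

/-- The Riemannian volume of a product is locally the product of the Riemannian volumes. -/
theorem chartVolume_prod [MeasurableSpace M] [BorelSpace M] [MeasurableSpace N] [BorelSpace N]
    {g : RiemMetric I M} {h : RiemMetric I' N} {x : M × N}
    (hg : ∀ y, (gram (stdBasis m) g x.1 y).PosSemidef)
    (hM : MDifferentiable 𝓘(ℝ, Fin m → ℝ) I (param I (stdBasis m) x.1))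
    (hN : MDifferentiable 𝓘(ℝ, Fin n → ℝ) I' (param I' (stdBasis n) x.2))
    (hgm : Measurable (gramDensity (stdBasis m) g x.1))
    (hhm : Measurable (gramDensity (stdBasis n) h x.2))
    (hgt : MeasurableSet (coordTarget I (stdBasis m) x.1))
    (hht : MeasurableSet (coordTarget I' (stdBasis n) x.2)) :
    chartVolume (prodBasis m n) (g.prod h) x
      = (chartVolume (stdBasis m) g x.1).prod (chartVolume (stdBasis n) h x.2) := by
  set e := MeasurableEquiv.sumPiEquivProdPi (fun _ : Fin m ⊕ Fin n => ℝ) with he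
  have hM' : Measurable (param I (stdBasis m) x.1) := hM.continuous.measurable
  have hN' : Measurable (param I' (stdBasis n) x.2) := hN.continuous.measurable
  have hpres := (volume_measurePreserving_sumPiEquivProdPi
    (fun _ : Fin m ⊕ Fin n => ℝ)).restrict_preimage (hgt.prod hht)
  have hp : param (I.prod I') (prodBasis m n) x
      = Prod.map (param I (stdBasis m) x.1) (param I' (stdBasis n) x.2) ∘ e :=
    funext fun y => param_prod x y
  have hd : gramDensity (prodBasis m n) (g.prod h) x
      = (fun z : (Fin m → ℝ) × (Fin n → ℝ) => gramDensity (stdBasis m) g x.1 z.1 *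
          gramDensity (stdBasis n) h x.2 z.2) ∘ e :=
    funext fun y => gramDensity_prod hg hM hN y
  have hmap := MeasurePreserving.map_withDensity_comp hpres
    (F := fun z : (Fin m → ℝ) × (Fin n → ℝ) => gramDensity (stdBasis m) g x.1 z.1 *
          gramDensity (stdBasis n) h x.2 z.2)
    ((hgm.comp measurable_fst).mul (hhm.comp measurable_snd))
  rw [chartVolume, hp, ← Measure.map_map (hM'.prodMap hN') e.measurable, coordTarget_prod, hd,
    he, hmap, chartVolume, chartVolume,
    Measure.map_prod_map _ _ hM' hN', prod_withDensity hgm hhm, Measure.prod_restrict]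
  rfl

end Product

/-! ### The volume of a flat torus -/

section Torus

variable {k : ℕ} (Λ : Submodule ℤ (EuclideanSpace ℝ (Fin k)))

/-- A fundamental parallelepiped of a lattice, spanned by an arbitrary `ℤ`-basis. -/
def latticeDomain [DiscreteTopology Λ] [IsZLattice ℝ Λ] : Set (EuclideanSpace ℝ (Fin k)) :=
  haveI := ZLattice.module_free ℝ Λ
  haveI := ZLattice.module_finite ℝ Λ
  ZSpan.fundamentalDomain ((Module.Free.chooseBasis ℤ Λ).ofZLatticeBasis ℝ Λ)

variable [DiscreteTopology Λ]

theorem gramDensity_flatMetric (q : FlatTorus Λ) : gramDensity (stdBasis k) (flatMetric Λ) q = 1 := by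
  funext y
  simp [gramDensity, gram_flatMetric]

variable [IsZLattice ℝ Λ]

/-- The measure on the torus induced by the Lebesgue measure on a fundamental domain. -/
def torusMeasure : Measure (FlatTorus Λ) :=
  Measure.map (torusProj Λ) (volume.restrict (latticeDomain Λ))

theorem isAddFundamentalDomain_latticeDomain (μ : Measure (EuclideanSpace ℝ (Fin k))) :
    IsAddFundamentalDomain Λ (latticeDomain Λ) μ := by
  have := ZLattice.module_free ℝ Λ
  have := ZLattice.module_finite ℝ Λ
  exact ZLattice.isAddFundamentalDomain _ μ

theorem torusProj_eq_iff (x y : EuclideanSpace ℝ (Fin k)) :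
    torusProj Λ x = torusProj Λ y ↔ y - x ∈ Λ := by
  refine QuotientAddGroup.eq.trans ?_
  rw [neg_add_eq_sub]
  rfl

theorem torusMeasure_univ : torusMeasure Λ Set.univ = volume (latticeDomain Λ) := by
  rw [torusMeasure, Measure.map_apply (torusProj_isLocalHomeomorph Λ).continuous.measurable
    MeasurableSet.univ]
  simp

theorem isBounded_latticeDomain : Bornology.IsBounded (latticeDomain Λ) := by
  have := ZLattice.module_free ℝ Λ
  have := ZLattice.module_finite ℝ Λ
  exact ZSpan.fundamentalDomain_isBounded _

theorem volume_latticeDomain_ne_zero : volume (latticeDomain Λ) ≠ 0 := by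
  have := ZLattice.module_free ℝ Λ
  have := ZLattice.module_finite ℝ Λ
  exact ZSpan.measure_fundamentalDomain_ne_zero _

instance : IsFiniteMeasure (torusMeasure Λ) :=
  ⟨by rw [torusMeasure_univ]; exact (isBounded_latticeDomain Λ).measure_lt_top⟩

/-- On the domain of a chart, the Riemannian volume of the torus is the measure induced from a
fundamental domain. -/
theorem chartVolume_flatMetric (q : FlatTorus Λ) :
    chartVolume (stdBasis k) (flatMetric Λ) q
      = (torusMeasure Λ).restrict (chartAt (EuclideanSpace ℝ (Fin k)) q).source := by
  set e := chartAt (EuclideanSpace ℝ (Fin k)) q with he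
  have hsymm : ⇑e.symm = torusProj Λ := torus_chart_symm Λ e (chart_mem_atlas _ q)
  have hcont := (torusProj_isLocalHomeomorph Λ).continuous
  have hmeas := hcont.measurable
  have hT : coordTarget (𝓡 k) (stdBasis k) q = WithLp.toLp 2 ⁻¹' e.target := by
    ext y
    rw [coordTarget, Set.mem_preimage, stdBasis_equivFun_symm]
    simp [he]
  have hp : param (𝓡 k) (stdBasis k) q = torusProj Λ ∘ WithLp.toLp 2 :=
    funext fun y => param_torus Λ q y
  have hpres := (PiLp.volume_preserving_toLp (Fin k)).restrict_preimage e.open_target.measurableSet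
  rw [chartVolume, gramDensity_flatMetric, withDensity_one, hT, hp,
    ← Measure.map_map hmeas (WithLp.measurable_toLp 2 _)]
  rw [hpres.map_eq]
  -- For the Lebesgue measure on the `Λ`-invariant open set `V` over the domain of the chart, both the
  -- target of the chart and the parallelepiped are fundamental domains of `Λ`, and therefore they
  -- give the same measure to invariant sets.
  set V := torusProj Λ ⁻¹' e.source with hV
  have hVm : MeasurableSet V := hmeas e.open_source.measurableSet
  have hperiod : ∀ (s : Set (FlatTorus Λ)) (g : Λ),
      (fun x => g +ᵥ x) ⁻¹' (torusProj Λ ⁻¹' s) = torusProj Λ ⁻¹' s := by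
    intro s g
    ext x
    have : torusProj Λ (g +ᵥ x) = torusProj Λ x := by
      rw [torusProj_eq_iff, Submodule.vadd_def]
      simp
    simp only [Set.mem_preimage, this]
  have hinv : VAddInvariantMeasure Λ (EuclideanSpace ℝ (Fin k)) (volume.restrict V) := by
    refine ⟨fun g s hs => ?_⟩
    rw [Measure.restrict_apply hs, Measure.restrict_apply (measurable_const_vadd g hs)]
    nth_rw 1 [hV]
    rw [← hperiod e.source g, ← Set.preimage_inter]
    exact measure_preimage_add volume (g : EuclideanSpace ℝ (Fin k)) (s ∩ V)
  have hdom : IsAddFundamentalDomain Λ e.target (volume.restrict V) := by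
    refine ⟨e.open_target.measurableSet.nullMeasurableSet, ?_, ?_⟩
    · refine (ae_restrict_iff' hVm).2 (Filter.Eventually.of_forall fun x hx => ?_)
      have h1 : torusProj Λ (e (torusProj Λ x)) = torusProj Λ x := by
        rw [← hsymm]
        exact e.left_inv (by rwa [hsymm])
      refine ⟨⟨e (torusProj Λ x) - x, (torusProj_eq_iff Λ _ _).1 h1.symm⟩, ?_⟩
      rw [Submodule.vadd_def]
      simpa using e.map_source hx
    · intro g g' hgg
      refine Disjoint.aedisjoint (Set.disjoint_left.2 ?_)
      rintro _ ⟨a, ha, rfl⟩ ⟨c, hc, hac⟩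
      simp only [Submodule.vadd_def, vadd_eq_add] at hac
      have h1 : torusProj Λ a = torusProj Λ c := by
        rw [torusProj_eq_iff, show c - a = (g : EuclideanSpace ℝ (Fin k)) - g' by
          rw [sub_eq_sub_iff_add_eq_add, add_comm c, hac]]
        exact Λ.sub_mem g.2 g'.2
      rw [← hsymm] at h1
      have h2 : a = c := e.symm.injOn ha hc h1
      subst h2
      exact hgg (Subtype.ext (add_right_cancel hac)).symm
  ext s hs
  have h1 := hdom.measure_set_eq (isAddFundamentalDomain_latticeDomain Λ _) (hmeas hs) (hperiod s)
  have hF : NullMeasurableSet (latticeDomain Λ) (volume.restrict V) :=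
    (isAddFundamentalDomain_latticeDomain Λ _).nullMeasurableSet
  rw [Measure.restrict_apply ((hmeas hs).inter e.open_target.measurableSet),
    Set.inter_assoc, Set.inter_eq_left.2 (show e.target ⊆ V from fun z hz => by
      rw [hV, Set.mem_preimage, ← hsymm]
      exact e.map_target hz)] at h1
  rw [Measure.map_apply hmeas hs, Measure.restrict_apply (hmeas hs), h1,
    Measure.restrict_apply hs, torusMeasure, Measure.map_apply hmeas (hs.inter e.open_source.measurableSet),
    Measure.restrict_apply (hmeas (hs.inter e.open_source.measurableSet)),
    Measure.restrict_apply' hVm, Set.preimage_inter, Set.inter_right_comm]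

theorem riemVol_flatMetric :
    riemVol (stdBasis k) (flatMetric Λ) = (torusMeasure Λ).real Set.univ :=
  riemVol_eq_measureReal (fun q => (chartAt (EuclideanSpace ℝ (Fin k)) q).open_source)
    (fun q => mem_chart_source _ q) (chartVolume_flatMetric Λ)

theorem riemVol_flatMetric_pos : 0 < riemVol (stdBasis k) (flatMetric Λ) := by
  rw [riemVol_flatMetric, measureReal_def, torusMeasure_univ]
  exact ENNReal.toReal_pos (volume_latticeDomain_ne_zero Λ)
    (isBounded_latticeDomain Λ).measure_lt_top.ne

end Torus

/-! ### The volume of a round sphere -/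

section SphereVolume

variable {n : ℕ}

/-- A linear map which sends the standard basis to an orthogonal system of vectors of lengths `c i`
has determinant `± ∏ c i`. -/
theorem abs_det_eq_prod_of_inner {d : ℕ}
    (L : EuclideanSpace ℝ (Fin d) →L[ℝ] EuclideanSpace ℝ (Fin d)) {c : Fin d → ℝ}
    (hc : ∀ i, 0 ≤ c i)
    (h : ∀ i j, inner ℝ (L (EuclideanSpace.single i 1)) (L (EuclideanSpace.single j 1))
      = if i = j then c i ^ 2 else 0) :
    |L.det| = ∏ i, c i := by
  set b := (EuclideanSpace.basisFun (Fin d) ℝ).toBasis with hb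
  set A := LinearMap.toMatrix b b (L : EuclideanSpace ℝ (Fin d) →ₗ[ℝ] EuclideanSpace ℝ (Fin d))
    with hA
  have hAe : ∀ i j, A i j = L (EuclideanSpace.single j 1) i := by
    intro i j
    simp [hA, hb, LinearMap.toMatrix_apply]
  have hG : A.transpose * A = Matrix.diagonal fun i => c i ^ 2 := by
    ext i j
    have h1 := h i j
    rw [PiLp.inner_apply] at h1
    rw [Matrix.mul_apply, Matrix.diagonal_apply, ← h1]
    refine Finset.sum_congr rfl fun l _ => ?_
    simp [hAe, mul_comm]
  have hdet : L.det = A.det := by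
    rw [hA, LinearMap.det_toMatrix]
  have h2 := congrArg Matrix.det hG
  rw [Matrix.det_mul, Matrix.det_transpose, Matrix.det_diagonal, Finset.prod_pow, ← hdet,
    ← sq] at h2
  rw [← abs_of_nonneg (Finset.prod_nonneg fun i _ => hc i)]
  exact (sq_eq_sq_iff_abs_eq_abs _ _).1 h2

/-- The last `n` coordinates of a point of `ℝⁿ⁺¹`. -/
def tailCoord (n : ℕ) : EuclideanSpace ℝ (Fin (n + 1)) →L[ℝ] (Fin n → ℝ) :=
  ContinuousLinearMap.pi fun i => EuclideanSpace.proj i.succ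

/-- The cone over the stereographic parametrization: `(r, y) ↦ r · stereoPoint y`. -/
def coneMap (p : EuclideanSpace ℝ (Fin (n + 1))) (b : Fin n → EuclideanSpace ℝ (Fin (n + 1)))
    (z : EuclideanSpace ℝ (Fin (n + 1))) : EuclideanSpace ℝ (Fin (n + 1)) :=
  z 0 • stereoPoint p b (tailCoord n z)

variable {p : EuclideanSpace ℝ (Fin (n + 1))} {b : Fin n → EuclideanSpace ℝ (Fin (n + 1))}

/-- The derivative of the cone map is spanned by the radial direction and the tangent vectors of the
sphere. -/
theorem hasFDerivAt_coneMap (z : EuclideanSpace ℝ (Fin (n + 1))) :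
    HasFDerivAt (coneMap p b) (fderiv ℝ (coneMap p b) z) z ∧
      ∀ v, fderiv ℝ (coneMap p b) z v
        = z 0 • stereoDeriv p b (tailCoord n z) (tailCoord n v)
          + v 0 • stereoPoint p b (tailCoord n z) := by
  have h1 : HasFDerivAt (fun z => stereoPoint p b (tailCoord n z))
      ((fderiv ℝ (stereoPoint p b) (tailCoord n z)).comp (tailCoord n)) z :=
    (((contDiff_stereoPoint p b).differentiable (by simp)) (tailCoord n z)).hasFDerivAt.comp z
      (tailCoord n).hasFDerivAt
  have h2 := (EuclideanSpace.proj 0 : EuclideanSpace ℝ (Fin (n + 1)) →L[ℝ] ℝ).hasFDerivAt (x := z)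
  have h3 : HasFDerivAt (coneMap p b) _ z := h2.smul h1
  refine ⟨h3.differentiableAt.hasFDerivAt, fun v => ?_⟩
  rw [h3.fderiv, ← fderiv_stereoPoint]
  rfl

/-- The Jacobian of polar coordinates: `rⁿ` times the volume density of the sphere in stereographic
coordinates. -/
theorem abs_det_fderiv_coneMap (hp : ‖p‖ = 1) (hb : Orthonormal ℝ b)
    (hpb : ∀ i, inner ℝ p (b i) = 0) {z : EuclideanSpace ℝ (Fin (n + 1))} (hz : 0 ≤ z 0) :
    |(fderiv ℝ (coneMap p b) z).det|
      = z 0 ^ n * (4 / (4 + tailCoord n z ⬝ᵥ tailCoord n z)) ^ n := by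
  set y := tailCoord n z with hy
  have hpos : 0 < 4 / (4 + y ⬝ᵥ y) := by
    have := dotProduct_self_add_four_pos y
    rw [add_comm]
    positivity
  have hs0 : tailCoord n (EuclideanSpace.single 0 1) = 0 := by
    ext i
    simp [tailCoord]
  have hs : ∀ i : Fin n, tailCoord n (EuclideanSpace.single i.succ 1) = Pi.single i 1 := by
    intro i
    ext j
    simp [tailCoord, Pi.single_apply]
  have hd := (hasFDerivAt_coneMap (p := p) (b := b) z).2
  have e0 : fderiv ℝ (coneMap p b) z (EuclideanSpace.single 0 1) = stereoPoint p b y := by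
    have h00 : stereoDeriv p b y 0 = 0 := by
      rw [← fderiv_stereoPoint, map_zero]
    rw [hd, hs0, ← hy, h00]
    simp
  have es : ∀ i : Fin n, fderiv ℝ (coneMap p b) z (EuclideanSpace.single i.succ 1)
      = z 0 • stereoDeriv p b y (Pi.single i 1) := by
    intro i
    rw [hd, hs, ← hy]
    simp
  have key := abs_det_eq_prod_of_inner (fderiv ℝ (coneMap p b) z)
    (c := Fin.cons 1 fun _ => z 0 * (4 / (4 + y ⬝ᵥ y))) ?_ ?_
  · rw [key, Fin.prod_univ_succ]
    simp [mul_pow]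
  · intro i
    refine Fin.cases ?_ (fun i => ?_) i
    · simp
    · simp only [Fin.cons_succ]
      positivity
  · intro i j
    refine Fin.cases ?_ (fun i => ?_) i <;> refine Fin.cases ?_ (fun j => ?_) j
    · rw [e0, inner_stereoPoint_self hp hb hpb]
      simp
    · rw [e0, es, inner_smul_right, inner_stereoPoint_stereoDeriv hp hb hpb]
      simp [(Fin.succ_ne_zero j).symm]
    · rw [e0, es, inner_smul_left, real_inner_comm, inner_stereoPoint_stereoDeriv hp hb hpb]
      simp
    · rw [es, es, inner_smul_left, inner_smul_right, inner_stereoDeriv hp hb hpb]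
      by_cases h : i = j
      · subst h
        simp
        ring
      · simp [h]

/-- The volume of the cone, truncated to radii in `(0, 1)`, over the part of the sphere with
stereographic coordinates in `A`, by polar coordinates. -/
theorem volume_coneMap_image (hp : ‖p‖ = 1) (hb : Orthonormal ℝ b)
    (hpb : ∀ i, inner ℝ p (b i) = 0) (hinj : Function.Injective (stereoPoint p b))
    {A : Set (Fin n → ℝ)} (hA : MeasurableSet A) :
    ((n + 1 : ℕ) : ENNReal) * volume (coneMap p b '' {z | z 0 ∈ Set.Ioo (0 : ℝ) 1 ∧ tailCoord n z ∈ A})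
      = ∫⁻ y in A, ENNReal.ofReal ((4 / (4 + y ⬝ᵥ y)) ^ n) := by
  set D := {z : EuclideanSpace ℝ (Fin (n + 1)) | z 0 ∈ Set.Ioo (0 : ℝ) 1 ∧ tailCoord n z ∈ A} with hD
  have hDm : MeasurableSet D := by
    refine MeasurableSet.inter ?_ ((tailCoord n).continuous.measurable hA)
    exact (EuclideanSpace.proj 0 : EuclideanSpace ℝ (Fin (n + 1)) →L[ℝ] ℝ).continuous.measurable
      measurableSet_Ioo
  have hnorm : ∀ y, ‖stereoPoint p b y‖ = 1 := by
    intro y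
    have h := inner_stereoPoint_self hp hb hpb y
    rw [real_inner_self_eq_norm_sq] at h
    exact (pow_eq_one_iff_of_nonneg (norm_nonneg _) two_ne_zero).1 h
  have hinjD : Set.InjOn (coneMap p b) D := by
    intro z hz w hw hzw
    have h0 : z 0 = w 0 := by
      have := congrArg norm hzw
      simp only [coneMap, norm_smul, hnorm, mul_one, Real.norm_eq_abs] at this
      rwa [abs_of_pos hz.1.1, abs_of_pos hw.1.1] at this
    have h1 : tailCoord n z = tailCoord n w := by
      refine hinj ?_
      have h2 : z 0 • stereoPoint p b (tailCoord n z) = w 0 • stereoPoint p b (tailCoord n w) := hzw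
      rw [← h0] at h2
      exact smul_right_injective _ hz.1.1.ne' h2
    ext i
    refine Fin.cases h0 (fun i => congrFun h1 i) i
  rw [← lintegral_abs_det_fderiv_eq_addHaar_image volume hDm
    (fun z _ => (hasFDerivAt_coneMap z).1.hasFDerivWithinAt) hinjD]
  set F : ℝ × (Fin n → ℝ) → ENNReal := fun w =>
    ENNReal.ofReal (w.1 ^ n) * ENNReal.ofReal ((4 / (4 + w.2 ⬝ᵥ w.2)) ^ n) with hF
  set e := fun z : EuclideanSpace ℝ (Fin (n + 1)) => ((z 0, tailCoord n z) : ℝ × (Fin n → ℝ)) with he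
  have hpres : MeasurePreserving e volume volume := by
    have := (volume_preserving_piFinSuccAbove (fun _ : Fin (n + 1) => ℝ) 0).comp
      (PiLp.volume_preserving_ofLp (Fin (n + 1)))
    exact this
  have hm2 : Measurable fun y : Fin n → ℝ => ENNReal.ofReal ((4 / (4 + y ⬝ᵥ y)) ^ n) := by
    have : Measurable fun y : Fin n → ℝ => y ⬝ᵥ y := contDiff_dotProduct_self.continuous.measurable
    fun_prop
  have hFm : Measurable F := by
    have : Measurable fun y : ℝ × (Fin n → ℝ) => ENNReal.ofReal (y.1 ^ n) := by fun_prop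
    exact this.mul (hm2.comp measurable_snd)
  have h1 : ∫⁻ z in D, ENNReal.ofReal |(fderiv ℝ (coneMap p b) z).det|
      = ∫⁻ z in e ⁻¹' (Set.Ioo 0 1 ×ˢ A), F (e z) := by
    refine setLIntegral_congr_fun hDm fun z hz => ?_
    rw [abs_det_fderiv_coneMap hp hb hpb hz.1.1.le,
      ENNReal.ofReal_mul (pow_nonneg hz.1.1.le _)]
  rw [h1, hpres.setLIntegral_comp_preimage (measurableSet_Ioo.prod hA) hFm,
    Measure.volume_eq_prod, ← Measure.prod_restrict,
    lintegral_prod_mul (f := fun r : ℝ => ENNReal.ofReal (r ^ n)) (by fun_prop) hm2.aemeasurable,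
    ← mul_assoc]
  have h2 : ∫⁻ r in Set.Ioo (0 : ℝ) 1, ENNReal.ofReal (r ^ n) = ENNReal.ofReal (1 / (n + 1)) := by
    rw [← ofReal_integral_eq_lintegral_ofReal]
    · rw [← integral_Ioc_eq_integral_Ioo, ← intervalIntegral.integral_of_le zero_le_one, integral_pow]
      simp
    · exact ((continuous_pow n).integrableOn_Icc (a := (0 : ℝ)) (b := 1)).mono_set
        Set.Ioo_subset_Icc_self
    · exact (ae_restrict_iff' measurableSet_Ioo).2
        (Filter.Eventually.of_forall fun r hr => pow_nonneg hr.1.le _)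
  have h3 : ((n + 1 : ℕ) : ENNReal) * ENNReal.ofReal (1 / (n + 1)) = 1 := by
    rw [← ENNReal.ofReal_natCast, ← ENNReal.ofReal_mul (by positivity)]
    push_cast
    rw [mul_one_div_cancel (by positivity), ENNReal.ofReal_one]
  rw [h2, h3, one_mul]

/-- Over the open set of points which are not antipodal to `x`, the Riemannian volume of the unit
sphere is the measure obtained from the Lebesgue measure by polar coordinates. -/
theorem chartVolume_roundMetric (x : RoundSphere n) :
    chartVolume (stdBasis n) (roundMetric n) x
      = (volume : Measure (EuclideanSpace ℝ (Fin (n + 1)))).toSphere.restrict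
          (chartAt (EuclideanSpace ℝ (Fin n)) x).source := by
  have : Fact (Module.finrank ℝ (EuclideanSpace ℝ (Fin (n + 1))) = n + 1) :=
    ⟨finrank_euclideanSpace_fin⟩
  set e := chartAt (EuclideanSpace ℝ (Fin n)) x with he
  have htarget : coordTarget (𝓡 n) (stdBasis n) x = Set.univ := by
    have h : e.target = Set.univ := stereographic'_target (-x)
    rw [coordTarget, extChartAt_target]
    simp [← he, h]
  have hmeas : Measurable (param (𝓡 n) (stdBasis n) x) :=
    (contMDiff_param_sphere x).continuous.measurable
  have hmaps : ∀ y, param (𝓡 n) (stdBasis n) x y ∈ e.source := by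
    intro y
    have h : y ∈ coordTarget (𝓡 n) (stdBasis n) x := htarget ▸ Set.mem_univ y
    have h2 := (extChartAt (𝓡 n) x).map_target h
    rw [extChartAt_source] at h2
    exact h2
  have hinj : Function.Injective (stereoPoint (x : EuclideanSpace ℝ (Fin (n + 1))) (sphereFrame x)) := by
    intro y y' hyy
    rw [← param_sphere, ← param_sphere] at hyy
    have h : ∀ y, (stdBasis n).equivFun.symm y ∈ (extChartAt (𝓡 n) x).target := fun y =>
      show y ∈ coordTarget (𝓡 n) (stdBasis n) x from htarget ▸ Set.mem_univ y
    exact (stdBasis n).equivFun.symm.injective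
      ((extChartAt (𝓡 n) x).symm.injOn (h y) (h y') (Subtype.ext hyy))
  have hsurj : ∀ z ∈ e.source, ∃ y, param (𝓡 n) (stdBasis n) x y = z := by
    intro z hz
    refine ⟨coord (𝓡 n) (stdBasis n) x z, ?_⟩
    rw [param, coord, LinearEquiv.symm_apply_apply]
    exact (extChartAt (𝓡 n) x).left_inv (by simpa using hz)
  have hdens : gramDensity (stdBasis n) (roundMetric n) x
      = fun y => ENNReal.ofReal ((4 / (4 + y ⬝ᵥ y)) ^ n) := by
    funext y
    have h0 : 0 < 4 / (4 + y ⬝ᵥ y) := by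
      have := dotProduct_self_add_four_pos y
      rw [add_comm]
      positivity
    rw [gramDensity, gram_roundMetric, Matrix.det_diagonal]
    simp only [Finset.prod_const, Finset.card_univ, Fintype.card_fin]
    rw [← pow_mul, mul_comm, pow_mul, Real.sqrt_sq (by positivity)]
  ext s hs
  rw [Measure.restrict_apply hs, Measure.toSphere_apply' _ (hs.inter e.open_source.measurableSet),
    chartVolume, htarget, Measure.restrict_univ, Measure.map_apply hmeas hs,
    withDensity_apply _ (hmeas hs), hdens,
    ← volume_coneMap_image (by simp) (orthonormal_sphereFrame x) (inner_sphereFrame x) hinj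
      (hmeas hs), finrank_euclideanSpace_fin]
  congr 2
  ext w
  simp only [Set.mem_image, Set.mem_smul, Set.mem_ofPred_eq, Set.mem_preimage]
  constructor
  · rintro ⟨z, ⟨hz, hzs⟩, rfl⟩
    exact ⟨z 0, hz, _, ⟨_, ⟨hzs, hmaps _⟩, rfl⟩, by rw [param_sphere]; rfl⟩
  · rintro ⟨r, hr, _, ⟨z, ⟨hzs, hze⟩, rfl⟩, rfl⟩
    obtain ⟨y, rfl⟩ := hsurj z hze
    refine ⟨WithLp.toLp 2 (Fin.cons r y), ⟨hr, ?_⟩, ?_⟩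
    · exact hzs
    · rw [param_sphere]
      rfl

/-- The area of the unit sphere of dimension two. -/
theorem toSphere_real_univ_two :
    (volume : Measure (EuclideanSpace ℝ (Fin (2 + 1)))).toSphere.real Set.univ = 4 * Real.pi := by
  rw [measureReal_def, Measure.toSphere_apply_univ, EuclideanSpace.volume_ball_fin_three]
  simp only [finrank_euclideanSpace_fin, ENNReal.toReal_mul, ENNReal.toReal_pow]
  rw [ENNReal.toReal_ofReal zero_le_one, ENNReal.toReal_ofReal (by positivity)]
  simp
  ring

/-- The volume of the unit sphere of dimension four. -/
theorem toSphere_real_univ_four :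
    (volume : Measure (EuclideanSpace ℝ (Fin (4 + 1)))).toSphere.real Set.univ
      = 8 * Real.pi ^ 2 / 3 := by
  have hG : Real.Gamma ((5 : ℕ) / 2 + 1) = 15 / 8 * √Real.pi := by
    have h1 : ((5 : ℕ) / 2 + 1 : ℝ) = 3 / 2 + 1 + 1 := by norm_num
    have h2 : (3 / 2 : ℝ) = 1 / 2 + 1 := by norm_num
    rw [h1, Real.Gamma_add_one (by norm_num), Real.Gamma_add_one (by norm_num), h2,
      Real.Gamma_add_one (by norm_num), Real.Gamma_one_half_eq]
    ring
  have hs : √Real.pi ^ 5 = Real.pi ^ 2 * √Real.pi := by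
    have := Real.sq_sqrt Real.pi_pos.le
    calc √Real.pi ^ 5 = (√Real.pi ^ 2) ^ 2 * √Real.pi := by ring
      _ = _ := by rw [this]
  rw [measureReal_def, Measure.toSphere_apply_univ, EuclideanSpace.volume_ball, Fintype.card_fin, hG,
    hs]
  have h0 : √Real.pi ≠ 0 := (Real.sqrt_pos.2 Real.pi_pos).ne'
  simp [ENNReal.toReal_ofReal (show 0 ≤ Real.pi ^ 2 * √Real.pi / (15 / 8 * √Real.pi) by positivity)]
  field_simp
  norm_num

end SphereVolume

/-! ### The invariants of the product manifolds -/

section Invariants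

open CoordGeometry

theorem mdifferentiable_param_sphere {n : ℕ} (x : RoundSphere n) :
    MDifferentiable 𝓘(ℝ, Fin n → ℝ) (𝓡 n) (param (𝓡 n) (stdBasis n) x) :=
  (contMDiff_param_sphere x).mdifferentiable (by simp)

theorem mdifferentiable_param_torus {k : ℕ} (Λ : Submodule ℤ (EuclideanSpace ℝ (Fin k)))
    [DiscreteTopology Λ] (q : FlatTorus Λ) :
    MDifferentiable 𝓘(ℝ, Fin k → ℝ) (𝓡 k) (param (𝓡 k) (stdBasis k) q) :=
  (contMDiff_param_torus Λ q).mdifferentiable (by simp)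

theorem gram_sphere_prod_torus {m n : ℕ} (Λ : Submodule ℤ (EuclideanSpace ℝ (Fin n)))
    [DiscreteTopology Λ] (x : RoundSphere m × FlatTorus Λ) :
    gram (prodBasis m n) ((roundMetric m).prod (flatMetric Λ)) x
      = modelMetric fun i => i.isLeft := by
  funext y
  rw [gram_prod _ _ _ _ (mdifferentiable_param_sphere _) (mdifferentiable_param_torus Λ _),
    gram_roundMetric, gram_flatMetric, ← Matrix.diagonal_one, Matrix.fromBlocks_diagonal,
    modelMetric]
  congr 1
  funext i
  cases i <;> simp [frameScale, roundFactor, ind, dotProduct, sq]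

theorem gram_torus_prod_sphere {m n : ℕ} (Λ : Submodule ℤ (EuclideanSpace ℝ (Fin m)))
    [DiscreteTopology Λ] (x : FlatTorus Λ × RoundSphere n) :
    gram (prodBasis m n) ((flatMetric Λ).prod (roundMetric n)) x
      = modelMetric fun i => i.isRight := by
  funext y
  rw [gram_prod _ _ _ _ (mdifferentiable_param_torus Λ _) (mdifferentiable_param_sphere _),
    gram_roundMetric, gram_flatMetric, ← Matrix.diagonal_one, Matrix.fromBlocks_diagonal,
    modelMetric]
  congr 1
  funext i
  cases i <;> simp [frameScale, roundFactor, ind, dotProduct, sq]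

/-- A point of the product has spherical coordinates zero in the chart centred at it. -/
theorem coord_torus_prod_sphere_self {m n : ℕ} (Λ : Submodule ℤ (EuclideanSpace ℝ (Fin m)))
    [DiscreteTopology Λ] (x : FlatTorus Λ × RoundSphere n) (i : Fin n) :
    coord ((𝓡 m).prod (𝓡 n)) (prodBasis m n) x x (Sum.inr i) = 0 := by
  rw [coord_prod, coord_sphere_self]
  rfl

theorem measurableSet_coordTarget {n : ℕ} {M : Type*} [TopologicalSpace M]
    [ChartedSpace (EuclideanSpace ℝ (Fin n)) M] (x : M) :
    MeasurableSet (coordTarget (𝓡 n) (stdBasis n) x) :=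
  ((isOpen_extChartAt_target x).preimage
    (stdBasis n).equivFun.symm.toContinuousLinearEquiv.continuous).measurableSet

theorem measurable_gramDensity_roundMetric {n : ℕ} (x : RoundSphere n) :
    Measurable (gramDensity (stdBasis n) (roundMetric n) x) := by
  have h : Measurable fun y : Fin n → ℝ => y ⬝ᵥ y := contDiff_dotProduct_self.continuous.measurable
  unfold gramDensity
  simp only [gram_roundMetric, Matrix.det_diagonal, Finset.prod_const]
  fun_prop

theorem measurable_gramDensity_flatMetric {k : ℕ} (Λ : Submodule ℤ (EuclideanSpace ℝ (Fin k)))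
    [DiscreteTopology Λ] (q : FlatTorus Λ) :
    Measurable (gramDensity (stdBasis k) (flatMetric Λ) q) := by
  rw [gramDensity_flatMetric]
  exact measurable_one

/-- The integral of a scalar invariant which is constant in model coordinates. -/
theorem totalIntegral_sphere_prod_torus {m n : ℕ} (Λ : Submodule ℤ (EuclideanSpace ℝ (Fin n)))
    [DiscreteTopology Λ] [IsZLattice ℝ Λ]
    {F : ((Fin m ⊕ Fin n → ℝ) → Matrix (Fin m ⊕ Fin n) (Fin m ⊕ Fin n) ℝ) →
      (Fin m ⊕ Fin n → ℝ) → ℝ} {c : ℝ} (hF : ∀ y, F (modelMetric fun i => i.isLeft) y = c) :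
    totalIntegral (prodBasis m n) ((roundMetric m).prod (flatMetric Λ)) F
      = (volume : Measure (EuclideanSpace ℝ (Fin (m + 1)))).toSphere.real Set.univ *
          riemVol (stdBasis n) (flatMetric Λ) * c := by
  have h := totalIntegral_eq_integral (g := (roundMetric m).prod (flatMetric Λ))
    (b := prodBasis m n)
    (μ := (volume : Measure (EuclideanSpace ℝ (Fin (m + 1)))).toSphere.prod (torusMeasure Λ))
    (U := fun x => (chartAt (EuclideanSpace ℝ (Fin m)) x.1).source ×ˢ
      (chartAt (EuclideanSpace ℝ (Fin n)) x.2).source)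
    (fun x => (OpenPartialHomeomorph.open_source _).prod (OpenPartialHomeomorph.open_source _))
    (fun x => ⟨mem_chart_source _ _, mem_chart_source _ _⟩)
    (fun x => by
      rw [chartVolume_prod (fun y => ?_) (mdifferentiable_param_sphere _)
        (mdifferentiable_param_torus Λ _) (measurable_gramDensity_roundMetric _)
        (measurable_gramDensity_flatMetric Λ _) (measurableSet_coordTarget _)
        (measurableSet_coordTarget _), chartVolume_roundMetric, chartVolume_flatMetric,
        Measure.prod_restrict]
      rw [gram_roundMetric]
      exact Matrix.PosSemidef.diagonal fun _ => sq_nonneg _) F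
  rw [h]
  simp only [gram_sphere_prod_torus, hF]
  rw [integral_const, riemVol_flatMetric, smul_eq_mul, ← Set.univ_prod_univ, measureReal_prod_prod]

/-- The integral of a scalar invariant which takes the same value at all centres of model
coordinates. -/
theorem totalIntegral_torus_prod_sphere {m n : ℕ} (Λ : Submodule ℤ (EuclideanSpace ℝ (Fin m)))
    [DiscreteTopology Λ] [IsZLattice ℝ Λ]
    {F : ((Fin m ⊕ Fin n → ℝ) → Matrix (Fin m ⊕ Fin n) (Fin m ⊕ Fin n) ℝ) →
      (Fin m ⊕ Fin n → ℝ) → ℝ} {c : ℝ}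
    (hF : ∀ y, (∀ i, y (Sum.inr i) = 0) → F (modelMetric fun i => i.isRight) y = c) :
    totalIntegral (prodBasis m n) ((flatMetric Λ).prod (roundMetric n)) F
      = (volume : Measure (EuclideanSpace ℝ (Fin (n + 1)))).toSphere.real Set.univ *
          riemVol (stdBasis m) (flatMetric Λ) * c := by
  have h := totalIntegral_eq_integral (g := (flatMetric Λ).prod (roundMetric n))
    (b := prodBasis m n)
    (μ := (torusMeasure Λ).prod (volume : Measure (EuclideanSpace ℝ (Fin (n + 1)))).toSphere)
    (U := fun x => (chartAt (EuclideanSpace ℝ (Fin m)) x.1).source ×ˢ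
      (chartAt (EuclideanSpace ℝ (Fin n)) x.2).source)
    (fun x => (OpenPartialHomeomorph.open_source _).prod (OpenPartialHomeomorph.open_source _))
    (fun x => ⟨mem_chart_source _ _, mem_chart_source _ _⟩)
    (fun x => by
      rw [chartVolume_prod (fun y => ?_) (mdifferentiable_param_torus Λ _)
        (mdifferentiable_param_sphere _) (measurable_gramDensity_flatMetric Λ _)
        (measurable_gramDensity_roundMetric _) (measurableSet_coordTarget _)
        (measurableSet_coordTarget _), chartVolume_roundMetric, chartVolume_flatMetric,
        Measure.prod_restrict]
      rw [gram_flatMetric]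
      exact Matrix.PosSemidef.one) F
  rw [h]
  simp only [gram_torus_prod_sphere, hF _ (coord_torus_prod_sphere_self Λ _)]
  rw [integral_const, riemVol_flatMetric, smul_eq_mul, ← Set.univ_prod_univ, measureReal_prod_prod,
    mul_comm ((torusMeasure Λ).real _)]

theorem invariantQ_sphere_prod_torus (Λ : Submodule ℤ (EuclideanSpace ℝ (Fin 4)))
    [DiscreteTopology Λ] [IsZLattice ℝ Λ] :
    invariantQ (prodBasis 2 4) ((roundMetric 2).prod (flatMetric Λ))
      = -(48 * Real.pi / 25) * riemVol (stdBasis 4) (flatMetric Λ) := by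
  rw [invariantQ, totalIntegral_sphere_prod_torus Λ qDensity_modelMetric_two_four,
    toSphere_real_univ_two]
  ring

theorem invariantL₁_torus_prod_sphere (Λ : Submodule ℤ (EuclideanSpace ℝ (Fin 2)))
    [DiscreteTopology Λ] [IsZLattice ℝ Λ] :
    invariantL₁ (prodBasis 2 4) ((flatMetric Λ).prod (roundMetric 4))
      = -(96 * Real.pi ^ 2) * riemVol (stdBasis 2) (flatMetric Λ) := by
  rw [invariantL₁, totalIntegral_torus_prod_sphere Λ fun y hy => l₁Density_modelMetric_two_four hy,
    toSphere_real_univ_four]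
  ring

theorem invariantL₂_torus_prod_sphere (Λ : Submodule ℤ (EuclideanSpace ℝ (Fin 2)))
    [DiscreteTopology Λ] [IsZLattice ℝ Λ] :
    invariantL₂ (prodBasis 2 4) ((flatMetric Λ).prod (roundMetric 4))
      = -(528 * Real.pi ^ 2 / 25) * riemVol (stdBasis 2) (flatMetric Λ) := by
  rw [invariantL₂, totalIntegral_torus_prod_sphere Λ fun y _ => l₂Density_modelMetric_two_four y,
    toSphere_real_univ_four]
  ring

end Invariants

/-! ### Topology of the product manifolds -/

section Topology

variable {k : ℕ} (Λ : Submodule ℤ (EuclideanSpace ℝ (Fin k))) [DiscreteTopology Λ] [IsZLattice ℝ Λ]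

theorem exists_ne_zero_mem_lattice [NeZero k] : ∃ ξ ∈ Λ, ξ ≠ 0 := by
  by_contra! h
  have h1 : (Λ : Set (EuclideanSpace ℝ (Fin k))) ⊆ {0} := fun ξ hξ => h ξ hξ
  have h2 := IsZLattice.span_top (K := ℝ) (L := Λ)
  have h3 : Submodule.span ℝ (Λ : Set (EuclideanSpace ℝ (Fin k))) = ⊥ :=
    Submodule.span_eq_bot.2 fun ξ hξ => h1 hξ
  rw [h3] at h2
  exact bot_ne_top h2

theorem infinite_lattice [NeZero k] : Infinite Λ := by
  obtain ⟨ξ, hξ, h0⟩ := exists_ne_zero_mem_lattice Λ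
  refine Infinite.of_injective (fun n : ℤ => (⟨n • ξ, Λ.smul_mem n hξ⟩ : Λ)) fun a c hac => ?_
  have h1 : a • ξ = c • ξ := congrArg Subtype.val hac
  rw [← Int.cast_smul_eq_zsmul ℝ, ← Int.cast_smul_eq_zsmul ℝ] at h1
  exact_mod_cast smul_left_injective ℝ h0 h1

instance : CompactSpace (FlatTorus Λ) := by
  have := ZLattice.module_free ℝ Λ
  have := ZLattice.module_finite ℝ Λ
  set b := (Module.Free.chooseBasis ℤ Λ).ofZLatticeBasis ℝ Λ with hb
  have hspan : Submodule.span ℤ (Set.range b) = Λ :=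
    (Module.Free.chooseBasis ℤ Λ).ofZLatticeBasis_span ℝ
  have hc : IsCompact (closure (ZSpan.fundamentalDomain b)) :=
    (ZSpan.fundamentalDomain_isBounded b).isCompact_closure
  refine ⟨?_⟩
  have h := hc.image (torusProj_isLocalHomeomorph Λ).continuous
  have hu : torusProj Λ '' closure (ZSpan.fundamentalDomain b) = Set.univ := by
    refine Set.eq_univ_of_forall fun q => ?_
    obtain ⟨x, rfl⟩ := QuotientAddGroup.mk_surjective q
    obtain ⟨v, hv, -⟩ := ZSpan.exist_unique_vadd_mem_fundamentalDomain b x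
    refine ⟨v +ᵥ x, subset_closure hv, ?_⟩
    refine (torusProj_eq_iff Λ _ _).2 ?_
    rw [Submodule.vadd_def]
    have : -(v : EuclideanSpace ℝ (Fin k)) ∈ Λ := Λ.neg_mem (hspan.le v.2)
    simpa using this
  rwa [hu] at h

/-- The lattice is a quotient of the fundamental group, since it is the deck group of the connected
covering `ℝᵏ → ℝᵏ/Λ`. -/
theorem infinite_fundamentalGroup_flatTorus [NeZero k] (q : FlatTorus Λ) :
    Infinite (FundamentalGroup (FlatTorus Λ) q) := by
  have : DiscreteTopology Λ.toAddSubgroup := ‹DiscreteTopology Λ›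
  have hcov := AddSubgroup.isAddQuotientCoveringMap_of_comm Λ.toAddSubgroup
    DiscreteTopology.isDiscrete
  obtain ⟨x, rfl⟩ := QuotientAddGroup.mk_surjective q
  have hsurj := hcov.fundamentalGroupToMulOpposite_surjective ⟨x, rfl⟩
  have : Infinite Λ.toAddSubgroup := infinite_lattice Λ
  have : Infinite (Multiplicative Λ.toAddSubgroup)ᵐᵒᵖ :=
    Infinite.of_injective (fun a : Λ.toAddSubgroup => MulOpposite.op (Multiplicative.ofAdd a))
      fun a c h => Multiplicative.ofAdd.injective (MulOpposite.op_injective h)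
  exact Infinite.of_surjective _ hsurj

theorem infinite_fundamentalGroup_prod_left {X Y : Type*} [TopologicalSpace X] [TopologicalSpace Y]
    (p : X × Y) [Infinite (FundamentalGroup X p.1)] : Infinite (FundamentalGroup (X × Y) p) :=
  Infinite.of_surjective (β := FundamentalGroup X p.1)
    (fun γ : Path.Homotopic.Quotient p p => Path.Homotopic.projLeft γ) fun γ =>
      ⟨Path.Homotopic.prod γ (Path.Homotopic.Quotient.refl p.2), Path.Homotopic.projLeft_prod _ _⟩

theorem infinite_fundamentalGroup_prod_right {X Y : Type*} [TopologicalSpace X] [TopologicalSpace Y]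
    (p : X × Y) [Infinite (FundamentalGroup Y p.2)] : Infinite (FundamentalGroup (X × Y) p) :=
  Infinite.of_surjective (β := FundamentalGroup Y p.2)
    (fun γ : Path.Homotopic.Quotient p p => Path.Homotopic.projRight γ) fun γ =>
      ⟨Path.Homotopic.prod (Path.Homotopic.Quotient.refl p.1) γ, Path.Homotopic.projRight_prod _ _⟩

theorem connectedSpace_roundSphere {n : ℕ} [NeZero n] : ConnectedSpace (RoundSphere n) := by
  refine isConnected_iff_connectedSpace.1 (isConnected_sphere ?_ _ zero_le_one)
  rw [rank_eq_card_basis (stdBasis (n + 1)), Fintype.card_fin]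
  exact_mod_cast Nat.succ_lt_succ (Nat.pos_of_ne_zero (NeZero.ne n))

theorem connectedSpace_flatTorus : ConnectedSpace (FlatTorus Λ) := by
  have : Function.Surjective (torusProj Λ) := QuotientAddGroup.mk_surjective
  exact this.connectedSpace (torusProj_isLocalHomeomorph Λ).continuous

theorem isClosedManifoldWithInfinitePi1_sphere_prod_torus {m : ℕ} [NeZero m] [NeZero k] :
    IsClosedManifoldWithInfinitePi1 ((𝓡 m).prod (𝓡 k)) (m + k) (RoundSphere m × FlatTorus Λ) := by
  have : Fact (Module.finrank ℝ (EuclideanSpace ℝ (Fin (m + 1))) = m + 1) :=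
    ⟨finrank_euclideanSpace_fin⟩
  have := connectedSpace_flatTorus Λ
  have := connectedSpace_roundSphere (n := m)
  exact
  { isManifold := inferInstance
    finrank_eq := by simp
    boundaryless := inferInstance
    compact := inferInstance
    t2 := inferInstance
    connected := inferInstance
    infinite_pi1 := fun p =>
      have := infinite_fundamentalGroup_flatTorus Λ p.2
      infinite_fundamentalGroup_prod_right p }

theorem isClosedManifoldWithInfinitePi1_torus_prod_sphere {n : ℕ} [NeZero n] [NeZero k] :
    IsClosedManifoldWithInfinitePi1 ((𝓡 k).prod (𝓡 n)) (k + n) (FlatTorus Λ × RoundSphere n) := by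
  have : Fact (Module.finrank ℝ (EuclideanSpace ℝ (Fin (n + 1))) = n + 1) :=
    ⟨finrank_euclideanSpace_fin⟩
  have := connectedSpace_flatTorus Λ
  have := connectedSpace_roundSphere (n := n)
  exact
  { isManifold := inferInstance
    finrank_eq := by simp
    boundaryless := inferInstance
    compact := inferInstance
    t2 := inferInstance
    connected := inferInstance
    infinite_pi1 := fun p =>
      have := infinite_fundamentalGroup_flatTorus Λ p.1
      infinite_fundamentalGroup_prod_left p }

end Topology

/-! ### Great circles in stereographic coordinates -/

section GreatCircle

variable {n : ℕ}

/-- The stereographic frame at `x` spans the tangent space `x^⊥`. -/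
theorem exists_frameMap_eq (x : RoundSphere n) {w : EuclideanSpace ℝ (Fin (n + 1))}
    (hw : inner ℝ (x : EuclideanSpace ℝ (Fin (n + 1))) w = 0) :
    ∃ e : Fin n → ℝ, frameMap (sphereFrame x) e = w := by
  have : Fact (Module.finrank ℝ (EuclideanSpace ℝ (Fin (n + 1))) = n + 1) :=
    ⟨finrank_euclideanSpace_fin⟩
  set B := OrthonormalBasis.fromOrthogonalSpanSingleton (𝕜 := ℝ) n (ne_zero_of_mem_unit_sphere (-x))
    with hB
  have hw' : w ∈ (Submodule.span ℝ {((-x : RoundSphere n) : EuclideanSpace ℝ (Fin (n + 1)))})ᗮ := by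
    rw [Submodule.mem_orthogonal_singleton_iff_inner_right, coe_neg_sphere, inner_neg_left, hw,
      neg_zero]
  refine ⟨fun i => B.repr ⟨w, hw'⟩ i, ?_⟩
  have h := congrArg Subtype.val (B.sum_repr ⟨w, hw'⟩)
  rw [frameMap_apply]
  rw [Submodule.coe_sum] at h
  exact h

/-- The great circle through the orthogonal unit vectors `p` and `w`, parametrized by arc length. -/
def greatCircle (p w : EuclideanSpace ℝ (Fin (n + 1))) (hp : inner ℝ p p = (1 : ℝ))
    (hw : inner ℝ w w = (1 : ℝ)) (hpw : inner ℝ p w = (0 : ℝ)) (α : ℝ) : RoundSphere n :=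
  ⟨Real.cos α • p + Real.sin α • w, by
    have hwp : inner ℝ w p = (0 : ℝ) := by rw [real_inner_comm, hpw]
    have h : inner ℝ (Real.cos α • p + Real.sin α • w) (Real.cos α • p + Real.sin α • w) = (1 : ℝ) := by
      simp only [inner_add_left, inner_add_right, inner_smul_left, inner_smul_right, hp, hw, hpw, hwp]
      simp
      nlinarith [Real.sin_sq_add_cos_sq α]
    rw [real_inner_self_eq_norm_sq] at h
    rw [mem_sphere_zero_iff_norm]
    exact (pow_eq_one_iff_of_nonneg (norm_nonneg _) two_ne_zero).1 h⟩

variable {p w : EuclideanSpace ℝ (Fin (n + 1))} (hp : inner ℝ p p = (1 : ℝ))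
  (hw : inner ℝ w w = (1 : ℝ)) (hpw : inner ℝ p w = (0 : ℝ))

/-- In the stereographic coordinates centred at one of its points, a great circle is a straight line
through the origin, on which arc length `θ` and the coordinate `s` are related by
`s = 2 tan (θ / 2)`. -/
theorem exists_param_eq_greatCircle (α : ℝ) :
    ∃ e : Fin n → ℝ, e ⬝ᵥ e = 1 ∧ ∀ s : ℝ,
      param (𝓡 n) (stdBasis n) (greatCircle p w hp hw hpw α) (s • e)
        = greatCircle p w hp hw hpw (α + 2 * Real.arctan (s / 2)) := by
  have hwp : inner ℝ w p = (0 : ℝ) := by rw [real_inner_comm, hpw]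
  set x := greatCircle p w hp hw hpw α with hx
  have hxc : (x : EuclideanSpace ℝ (Fin (n + 1))) = Real.cos α • p + Real.sin α • w := rfl
  obtain ⟨e, he⟩ := exists_frameMap_eq x (w := Real.cos α • w - Real.sin α • p) (by
    rw [hxc]
    simp only [inner_add_left, inner_sub_right, inner_smul_left, inner_smul_right, hp, hw, hpw, hwp]
    simp
    ring)
  have hee : e ⬝ᵥ e = 1 := by
    rw [← inner_frameMap (orthonormal_sphereFrame x), he]
    simp only [inner_sub_left, inner_sub_right, inner_smul_left, inner_smul_right, hp, hw, hpw, hwp]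
    simp
    nlinarith [Real.sin_sq_add_cos_sq α]
  refine ⟨e, hee, fun s => Subtype.ext ?_⟩
  have hpos : 0 < s * s + 4 := add_pos_of_nonneg_of_pos (mul_self_nonneg s) four_pos
  have hsq : √(1 + (s / 2) ^ 2) ^ 2 = 1 + (s / 2) ^ 2 := Real.sq_sqrt (by positivity)
  have hs0 : √(1 + (s / 2) ^ 2) ≠ 0 := (Real.sqrt_pos.2 (by positivity)).ne'
  have hcos : Real.cos (2 * Real.arctan (s / 2)) = (s * s + 4)⁻¹ * (4 - s * s) := by
    rw [Real.cos_two_mul, Real.cos_arctan, div_pow, hsq]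
    field_simp
    ring
  have hsin : Real.sin (2 * Real.arctan (s / 2)) = (s * s + 4)⁻¹ * (4 * s) := by
    rw [Real.sin_two_mul, Real.cos_arctan, Real.sin_arctan]
    have : 2 * (s / 2 / √(1 + (s / 2) ^ 2)) * (1 / √(1 + (s / 2) ^ 2))
        = s / √(1 + (s / 2) ^ 2) ^ 2 := by
      field_simp
    rw [this, hsq]
    field_simp
    ring
  have hR : ((greatCircle p w hp hw hpw (α + 2 * Real.arctan (s / 2)) : RoundSphere n) :
      EuclideanSpace ℝ (Fin (n + 1))) = Real.cos (α + 2 * Real.arctan (s / 2)) • p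
        + Real.sin (α + 2 * Real.arctan (s / 2)) • w := rfl
  rw [param_sphere, hR, stereoPoint, map_smul, he, hxc, Real.cos_add, Real.sin_add, hcos, hsin]
  simp only [smul_dotProduct, dotProduct_smul, hee, smul_eq_mul, mul_one]
  module

end GreatCircle

/-! ### Second derivatives along lines -/

section Line

variable {ι : Type*} [Fintype ι] [DecidableEq ι] {W : (ι → ℝ) → ℝ}

/-- The second derivative of `W` at `y` in the directions `ζ` and `η`. -/
def hessian (W : (ι → ℝ) → ℝ) (y ζ η : ι → ℝ) : ℝ :=
  fderiv ℝ (fun z => fderiv ℝ W z η) y ζ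

theorem hasDerivAt_line (hW : ContDiff ℝ ∞ W) (y ζ : ι → ℝ) (t : ℝ) :
    HasDerivAt (fun t : ℝ => W (y + t • ζ)) (fderiv ℝ W (y + t • ζ) ζ) t := by
  have h1 : HasDerivAt (fun t : ℝ => y + t • ζ) ζ t := by
    simpa using ((hasDerivAt_id t).smul_const ζ).const_add y
  exact ((hW.differentiable (by simp)) _).hasFDerivAt.comp_hasDerivAt t h1

theorem contDiff_fderiv_apply (hW : ContDiff ℝ ∞ W) (η : ι → ℝ) :
    ContDiff ℝ ∞ (fun z => fderiv ℝ W z η) :=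
  (hW.fderiv_right (m := ∞) (by simp)).clm_apply contDiff_const

theorem hessian_eq_sum (hW : ContDiff ℝ ∞ W) (y ζ η : ι → ℝ) :
    hessian W y ζ η = ∑ i, ∑ j, ζ i * η j *
      CoordGeometry.partialDeriv i (CoordGeometry.partialDeriv j W) y := by
  have hsum : ∀ ζ : ι → ℝ, ζ = ∑ i, ζ i • (Pi.single i 1 : ι → ℝ) := fun ζ => by
    ext j
    simp [Finset.sum_apply, Pi.single_apply]
  have h1 : (fun z => fderiv ℝ W z η)
      = fun z => ∑ j, η j * CoordGeometry.partialDeriv j W z := by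
    funext z
    conv_lhs => rw [hsum η]
    simp [CoordGeometry.partialDeriv]
  have h2 : ∀ j, DifferentiableAt ℝ (CoordGeometry.partialDeriv j W) y := fun j =>
    (contDiff_fderiv_apply hW (Pi.single j 1)).differentiable (by simp) y
  rw [hessian, h1, fderiv_fun_sum fun j _ => (h2 j).const_mul _]
  conv_lhs => rw [hsum ζ]
  simp only [map_sum, map_smul, sum_apply, smul_eq_mul]
  refine Finset.sum_congr rfl fun i _ => ?_
  rw [Finset.mul_sum]
  refine Finset.sum_congr rfl fun j _ => ?_
  rw [fderiv_const_mul (h2 j)]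
  simp [CoordGeometry.partialDeriv]
  ring

/-- If the second derivative along the line were negative, the second derivative test would give a
local maximum as well, so `W` would be constant near `y` along the line. -/
theorem hessian_self_nonneg_of_forall_le (hW : ContDiff ℝ ∞ W) {y ζ : ι → ℝ}
    (h : ∀ t : ℝ, W y ≤ W (y + t • ζ)) : 0 ≤ hessian W y ζ ζ := by
  by_contra! hneg
  set φ : ℝ → ℝ := fun t => -W (y + t • ζ) with hφ
  have hd : deriv φ = fun t => -fderiv ℝ W (y + t • ζ) ζ :=
    funext fun t => (hasDerivAt_line hW y ζ t).neg.deriv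
  have hdd : deriv (deriv φ) 0 = -hessian W y ζ ζ := by
    rw [hd]
    have := (hasDerivAt_line (contDiff_fderiv_apply hW ζ) y ζ 0).neg.deriv
    rw [zero_smul, add_zero] at this
    exact this
  have hmin : IsLocalMin φ 0 := by
    refine isLocalMin_of_deriv_deriv_pos (by rw [hdd]; linarith) ?_ ?_
    · have hm : IsLocalMin (fun t : ℝ => W (y + t • ζ)) 0 :=
        Filter.Eventually.of_forall fun t => by simpa using h t
      have := hm.deriv_eq_zero
      rw [(hasDerivAt_line hW y ζ 0).deriv] at this
      rw [hd]
      simp only [this, neg_zero]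
    · exact (hasDerivAt_line hW y ζ 0).neg.continuousAt
  have hconst : φ =ᶠ[nhds 0] fun _ => φ 0 := by
    filter_upwards [hmin] with t ht
    have := h t
    simp only [hφ, zero_smul, add_zero] at ht ⊢
    linarith
  have h0 : deriv (deriv φ) 0 = 0 := by
    have h1 : deriv φ =ᶠ[nhds 0] fun _ => 0 := by
      filter_upwards [hconst.eventuallyEq_nhds] with t ht
      rw [ht.deriv_eq, deriv_const]
    rw [h1.deriv_eq, deriv_const]
  rw [hdd] at h0
  linarith

theorem hessian_self_nonpos_of_forall_le (hW : ContDiff ℝ ∞ W) {y ζ : ι → ℝ}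
    (h : ∀ t : ℝ, W (y + t • ζ) ≤ W y) : hessian W y ζ ζ ≤ 0 := by
  have h1 := hessian_self_nonneg_of_forall_le (W := fun z => -W z) hW.neg (y := y) (ζ := ζ)
    fun t => neg_le_neg (h t)
  have h2 : hessian (fun z => -W z) y ζ ζ = -hessian W y ζ ζ := by
    simp only [hessian, fderiv_fun_neg, neg_apply]
  linarith

end Line

/-! ### Conformal factors of Einstein metrics -/

namespace CoordGeometry

variable {ι : Type*} [Fintype ι] [DecidableEq ι] (s : ι → Prop) [DecidablePred s]
  {v : (ι → ℝ) → ℝ}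

theorem partialDeriv_partialDeriv_exp_neg (hv : ContDiff ℝ ∞ v) (i j : ι) (y : ι → ℝ) :
    partialDeriv i (partialDeriv j fun z => Real.exp (-v z)) y
      = Real.exp (-v y) * (partialDeriv i v y * partialDeriv j v y
          - partialDeriv i (partialDeriv j v) y) := by
  have hd : Differentiable ℝ v := hv.differentiable (by simp)
  have hv2 : ContDiff ℝ 2 v := contDiff_infty.1 hv 2
  have he : ∀ k z, partialDeriv k (fun z => Real.exp (-v z)) z
      = (-1) * (Real.exp (-v z) * partialDeriv k v z) := by
    intro k z
    rw [partialDeriv, fderiv_exp (hd z).fun_neg, fderiv_fun_neg, partialDeriv]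
    simp
  have hexp : DifferentiableAt ℝ (fun z => Real.exp (-v z)) y := (hd y).fun_neg.exp
  have hp := differentiable_partialDeriv hv2 j y
  rw [funext (he j), partialDeriv_const_mul _ (hexp.fun_mul hp), partialDeriv_mul hexp hp, he]
  ring

/-- If `e^{2v} g` satisfies the Einstein equation at a centre of the coordinates, where `g` is the
product of a round sphere and a flat space, then the Hessian of `W = e^{-v}` is there of the form
`a` times the flat part plus `b` times the spherical part of the metric, with `b < a`. Indeed
`∇²W = W (dv ⊗ dv - ∇²v)`, and up to multiples of the metric the Einstein equation says that
`(n - 2) (dv ⊗ dv - ∇²v)` is `-Ric(g)`. -/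
theorem exists_hessian_exp_neg (hv : ContDiff ℝ ∞ v) {y : ι → ℝ} (hy : ∀ i, s i → y i = 0)
    (hn : 2 < Fintype.card ι) (hs : 1 < sphereDim s) {c : ℝ}
    (hE : ∀ i j, ricci (fun z => Real.exp (2 * v z) • modelMetric s z) y ![i, j]
      = if i = j then c else 0) :
    ∃ a b : ℝ, b < a ∧ ∀ i j, partialDeriv i (partialDeriv j fun z => Real.exp (-v z)) y
      = if i = j then a + (b - a) * ind s i else 0 := by
  obtain ⟨K, hK⟩ := ricci_conformal s (contDiff_infty.1 hv 2) hy
  have hn' : (0 : ℝ) < (Fintype.card ι : ℝ) - 2 := by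
    have : (2 : ℝ) < Fintype.card ι := by exact_mod_cast hn
    linarith
  generalize (Fintype.card ι : ℝ) - 2 = N at hK hn'
  refine ⟨Real.exp (-v y) * ((c - K) / N), Real.exp (-v y) * ((c - K - (sphereDim s - 1)) / N),
    mul_lt_mul_of_pos_left (div_lt_div_of_pos_right (by linarith) hn') (Real.exp_pos _),
    fun i j => ?_⟩
  have h := (hK i j).symm.trans (hE i j)
  rw [partialDeriv_partialDeriv_exp_neg hv]
  generalize partialDeriv i (partialDeriv j v) y = D at h ⊢
  generalize partialDeriv i v y * partialDeriv j v y = P at h ⊢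
  by_cases hij : i = j
  · simp only [hij, if_true] at h ⊢
    have hr : P - D = (c - ((sphereDim s - 1) * ind s j + K)) / N := by
      rw [eq_div_iff hn'.ne']
      linear_combination h
    rw [hr]
    ring
  · simp only [hij, if_false, add_zero] at h ⊢
    have hr : N * (P - D) = 0 := by linear_combination h
    rw [(mul_eq_zero.1 hr).resolve_left hn'.ne', mul_zero]

end CoordGeometry

/-! ### The product of a torus and a sphere is not conformally Einstein -/

section NotConformallyEinstein

open CoordGeometry

variable {m n : ℕ} (Λ : Submodule ℤ (EuclideanSpace ℝ (Fin m))) [DiscreteTopology Λ]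

theorem contMDiff_param_torus_prod_sphere (x : FlatTorus Λ × RoundSphere n) :
    ContMDiff 𝓘(ℝ, Fin m ⊕ Fin n → ℝ) ((𝓡 m).prod (𝓡 n)) ∞
      (param ((𝓡 m).prod (𝓡 n)) (prodBasis m n) x) := by
  have h : param ((𝓡 m).prod (𝓡 n)) (prodBasis m n) x
      = fun y => (param (𝓡 m) (stdBasis m) x.1 (restrictCoord Sum.inl y),
          param (𝓡 n) (stdBasis n) x.2 (restrictCoord Sum.inr y)) :=
    funext fun y => param_prod x y
  rw [h]
  have h1 : ContMDiff 𝓘(ℝ, Fin m ⊕ Fin n → ℝ) 𝓘(ℝ, Fin m → ℝ) ∞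
      (restrictCoord (Sum.inl : Fin m → Fin m ⊕ Fin n)) :=
    (restrictCoord (Sum.inl : Fin m → Fin m ⊕ Fin n)).contMDiff
  have h2 : ContMDiff 𝓘(ℝ, Fin m ⊕ Fin n → ℝ) 𝓘(ℝ, Fin n → ℝ) ∞
      (restrictCoord (Sum.inr : Fin n → Fin m ⊕ Fin n)) :=
    (restrictCoord (Sum.inr : Fin n → Fin m ⊕ Fin n)).contMDiff
  have h3 := ContMDiff.comp (contMDiff_param_torus Λ x.1) h1
  have h4 := ContMDiff.comp (contMDiff_param_sphere x.2) h2
  exact h3.prodMk h4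

theorem gram_conformal {E : Type*} [NormedAddCommGroup E] [NormedSpace ℝ E]
    {H : Type*} [TopologicalSpace H] {I : ModelWithCorners ℝ E H}
    {M : Type*} [TopologicalSpace M] [ChartedSpace H M] [IsManifold I ∞ M]
    {ι : Type*} [Fintype ι] [DecidableEq ι] (b : Module.Basis ι ℝ E) {g g' : RiemMetric I M}
    {u : M → ℝ} (h : ∀ (x : M) (v w : TangentSpace I x),
      g'.inner x v w = Real.exp (2 * u x) * g.inner x v w) (x : M) :
    gram b g' x = fun y => Real.exp (2 * u (param I b x y)) • gram b g x y := by
  funext y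
  ext i j
  exact h _ _ _

/-- The torus coordinates of `q` in its own chart are a lift of `q` to `ℝᵐ`. -/
theorem torus_coord_spec (q : FlatTorus Λ) :
    torusProj Λ (WithLp.toLp 2 (coord (𝓡 m) (stdBasis m) q q)) = q := by
  rw [← param_torus Λ q, param, coord, LinearEquiv.symm_apply_apply]
  exact (extChartAt (𝓡 m) q).left_inv (mem_extChartAt_source q)

theorem sphereDim_isRight : sphereDim (fun i : Fin m ⊕ Fin n => (i.isRight : Prop)) = n := by
  rw [sphereDim, Fintype.sum_sum_type]
  simp [ind]

/-- At every point of `Tᵐ × Sⁿ`, the conformal factor `e^{-u}` of an Einstein metric `e^{2u} g` has,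
in the coordinates around the point, no mixed second derivatives, and its second derivatives in
spherical directions are smaller than those in flat directions. -/
theorem exists_hessian_of_isEinstein (hn : 2 ≤ n) (hm : 0 < m)
    {g' : RiemMetric ((𝓡 m).prod (𝓡 n)) (FlatTorus Λ × RoundSphere n)}
    {u : FlatTorus Λ × RoundSphere n → ℝ} (hu : ContMDiff ((𝓡 m).prod (𝓡 n)) 𝓘(ℝ, ℝ) ∞ u)
    (hg : ∀ (x : FlatTorus Λ × RoundSphere n) (v w : TangentSpace ((𝓡 m).prod (𝓡 n)) x),
      g'.inner x v w = Real.exp (2 * u x) * ((flatMetric Λ).prod (roundMetric n)).inner x v w)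
    (hE : IsEinstein (prodBasis m n) g') (x : FlatTorus Λ × RoundSphere n) :
    ∃ W : (Fin m ⊕ Fin n → ℝ) → ℝ, ContDiff ℝ ∞ W ∧
      (∀ y, W y = Real.exp (-u (param ((𝓡 m).prod (𝓡 n)) (prodBasis m n) x y))) ∧
      ∃ a b : ℝ, b < a ∧ ∀ ζ η : Fin m ⊕ Fin n → ℝ,
        hessian W (coord ((𝓡 m).prod (𝓡 n)) (prodBasis m n) x x) ζ η
          = a * ((ζ ∘ Sum.inl) ⬝ᵥ (η ∘ Sum.inl)) + b * ((ζ ∘ Sum.inr) ⬝ᵥ (η ∘ Sum.inr)) := by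
  obtain ⟨c, hc⟩ := hE
  set v := fun y => u (param ((𝓡 m).prod (𝓡 n)) (prodBasis m n) x y) with hv
  have hvs : ContDiff ℝ ∞ v :=
    contMDiff_iff_contDiff.1 (hu.comp (contMDiff_param_torus_prod_sphere Λ x))
  set y := coord ((𝓡 m).prod (𝓡 n)) (prodBasis m n) x x with hy
  have hcenter : ∀ i : Fin m ⊕ Fin n, i.isRight → y i = 0 := by
    rintro (i | i) hi
    · simp at hi
    · exact coord_torus_prod_sphere_self Λ x i
  have hgram : gram (prodBasis m n) g' x
      = fun z => Real.exp (2 * v z) • modelMetric (fun i : Fin m ⊕ Fin n => (i.isRight : Prop)) z := by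
    rw [gram_conformal _ hg x]
    funext z
    rw [gram_torus_prod_sphere]
  obtain ⟨a, b, hab, hW⟩ := exists_hessian_exp_neg (fun i : Fin m ⊕ Fin n => (i.isRight : Prop))
    hvs hcenter (by simp; omega) (by rw [sphereDim_isRight]; exact_mod_cast hn)
    (c := c * Real.exp (2 * v y)) (by
      intro i j
      have h := hc x i j
      have hmodel : modelMetric (fun i : Fin m ⊕ Fin n => (i.isRight : Prop)) y i j
          = if i = j then 1 else 0 := by
        simp [modelMetric, Matrix.diagonal_apply, frameScale_center _ hcenter]
      rw [hgram, ← hy] at h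
      refine h.trans ?_
      simp only [Matrix.smul_apply, hmodel]
      split_ifs <;> simp)
  have hWs : ContDiff ℝ ∞ fun z => Real.exp (-v z) := hvs.neg.exp
  refine ⟨fun z => Real.exp (-v z), hWs, fun _ => rfl, a, b, hab, fun ζ η => ?_⟩
  rw [hessian_eq_sum hWs]
  simp only [hW, mul_ite, mul_zero, Finset.sum_ite_eq, Finset.mem_univ, if_true,
    Fintype.sum_sum_type, dotProduct, Function.comp_apply, Finset.mul_sum]
  congr 1
  · refine Finset.sum_congr rfl fun i _ => ?_
    simp [ind]
    ring
  · refine Finset.sum_congr rfl fun i _ => ?_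
    simp [ind]
    ring

/-- The change of variable `s = 2 tan (θ / 2)` is tangent to the identity at `0`. -/
theorem hasDerivAt_of_comp_arctan {φ ψ : ℝ → ℝ} {α d : ℝ}
    (h : ∀ s, ψ s = φ (α + 2 * Real.arctan (s / 2))) (hd : HasDerivAt ψ d 0) :
    HasDerivAt φ d α := by
  have h1 : HasDerivAt (fun θ : ℝ => 2 * Real.tan ((θ - α) / 2)) 1 α := by
    have h2 : HasDerivAt (fun θ : ℝ => (θ - α) / 2) (1 / 2) α :=
      ((hasDerivAt_id α).sub_const α).div_const 2
    have h3 : HasDerivAt Real.tan (1 / Real.cos ((α - α) / 2) ^ 2) ((α - α) / 2) :=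
      Real.hasDerivAt_tan (by simp)
    have h4 := (h3.comp α h2).const_mul 2
    rw [sub_self, zero_div, Real.cos_zero, one_pow, div_one, one_mul, mul_one_div_cancel two_ne_zero]
      at h4
    exact h4
  have h5 : HasDerivAt (ψ ∘ fun θ : ℝ => 2 * Real.tan ((θ - α) / 2)) (d * 1) α := by
    refine HasDerivAt.comp α ?_ h1
    simpa using hd
  rw [mul_one] at h5
  refine h5.congr_of_eventuallyEq ?_
  have hα : Set.Ioo (α - Real.pi) (α + Real.pi) ∈ nhds α :=
    Ioo_mem_nhds (by linarith [Real.pi_pos]) (by linarith [Real.pi_pos])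
  filter_upwards [hα] with θ hθ
  rw [Function.comp_apply, h, mul_div_cancel_left₀ _ two_ne_zero,
    Real.arctan_tan (by linarith [hθ.1]) (by linarith [hθ.2])]
  congr 1
  ring

theorem exists_forall_le_of_periodic {f : ℝ → ℝ} {c : ℝ} (hf : Continuous f)
    (hp : Function.Periodic f c) (hc : 0 < c) : ∃ x, ∀ y, f x ≤ f y := by
  obtain ⟨x, -, hx⟩ := (isCompact_Icc (a := (0 : ℝ)) (b := c)).exists_isMinOn
    (Set.nonempty_Icc.2 hc.le) hf.continuousOn
  refine ⟨x, fun y => ?_⟩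
  obtain ⟨z, hz, hyz⟩ := hp.exists_mem_Ico₀ hc y
  rw [hyz]
  exact hx (Set.Ico_subset_Icc_self hz)

/-- A function of two variables whose mixed second derivative vanishes is a sum of functions of one
variable. -/
theorem sub_eq_sub_of_deriv_deriv_eq_zero {h : ℝ → ℝ → ℝ}
    (h1 : ∀ β, Differentiable ℝ (h β))
    (h2 : ∀ α β, HasDerivAt (fun β => deriv (h β) α) 0 β) (β β' α α' : ℝ) :
    h β α - h β' α = h β α' - h β' α' := by
  have h3 : deriv (h β) = deriv (h β') := funext fun α =>
    is_const_of_deriv_eq_zero (fun β => (h2 α β).differentiableAt) (fun β => (h2 α β).deriv) β β'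
  refine is_const_of_deriv_eq_zero (f := fun α => h β α - h β' α)
    ((h1 β).fun_sub (h1 β')) (fun α => ?_) α α'
  rw [deriv_fun_sub (h1 β α) (h1 β' α), h3, sub_self]

variable [IsZLattice ℝ Λ]

/-- The product of a flat torus and a round sphere is not conformally Einstein: the function
`e^{-u}` would be a sum of a function on the torus and a function on the sphere. On the product of
a closed geodesic of the torus and a great circle, at a point where the first summand is maximal and
the second one minimal, its second derivatives contradict the Einstein equation. -/
theorem not_isConformallyEinstein_torus_prod_sphere [NeZero m] (hn : 2 ≤ n) :
    ¬ IsConformallyEinstein (prodBasis m n) ((flatMetric Λ).prod (roundMetric n)) := by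
  rintro ⟨u, g', hu, hg, hE⟩
  obtain ⟨ξ, hξ, hξ0⟩ := exists_ne_zero_mem_lattice Λ
  have : NeZero n := ⟨by omega⟩
  have hlast : (0 : Fin (n + 1)) ≠ Fin.last n := (Fin.last_pos' (n := n)).ne
  have horth : inner ℝ (EuclideanSpace.single 0 1 : EuclideanSpace ℝ (Fin (n + 1)))
      (EuclideanSpace.single (Fin.last n) 1) = 0 := by
    rw [EuclideanSpace.inner_single_left, PiLp.single_apply, if_neg hlast]
    simp
  set γ := greatCircle (n := n) (EuclideanSpace.single 0 1) (EuclideanSpace.single (Fin.last n) 1)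
    (by simp) (by simp) horth with hγ
  set h : ℝ → ℝ → ℝ := fun β α => Real.exp (-u (torusProj Λ (β • ξ), γ α)) with hh
  -- `h` is `e^{-u}` on the product of a closed geodesic and a great circle. In the chart centred at any
  -- point of this surface, it is the restriction of `W` to an affine plane.
  have hlocal : ∀ β α, ∃ (W : (Fin m ⊕ Fin n → ℝ) → ℝ) (y ζ η : Fin m ⊕ Fin n → ℝ),
      ContDiff ℝ ∞ W ∧
      (∀ t s : ℝ, W (y + t • ζ + s • η) = h (β + t) (α + 2 * Real.arctan (s / 2))) ∧
      hessian W y ζ η = 0 ∧ hessian W y η η < hessian W y ζ ζ / ‖ξ‖ ^ 2 := by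
    intro β α
    set x : FlatTorus Λ × RoundSphere n := (torusProj Λ (β • ξ), γ α) with hx
    obtain ⟨W, hW, hWu, a, b, hab, hess⟩ :=
      exists_hessian_of_isEinstein Λ hn (Nat.pos_of_ne_zero (NeZero.ne m)) hu hg hE x
    obtain ⟨e, he, hparam⟩ := exists_param_eq_greatCircle (n := n)
      (p := EuclideanSpace.single 0 1) (w := EuclideanSpace.single (Fin.last n) 1)
      (by simp) (by simp) horth α
    refine ⟨W, coord ((𝓡 m).prod (𝓡 n)) (prodBasis m n) x x, Sum.elim ξ.ofLp 0, Sum.elim 0 e, hW,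
      fun t s => ?_, ?_, ?_⟩
    · rw [hWu, param_prod, coord_prod, coord_sphere_self]
      have hl : (Sum.elim (coord (𝓡 m) (stdBasis m) x.1 x.1) 0 + t • Sum.elim ξ.ofLp (0 : Fin n → ℝ)
          + s • Sum.elim (0 : Fin m → ℝ) e) ∘ Sum.inl
          = coord (𝓡 m) (stdBasis m) x.1 x.1 + t • ξ.ofLp := by
        funext i
        simp
      have hr : (Sum.elim (coord (𝓡 m) (stdBasis m) x.1 x.1) 0 + t • Sum.elim ξ.ofLp (0 : Fin n → ℝ)
          + s • Sum.elim (0 : Fin m → ℝ) e) ∘ Sum.inr = s • e := by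
        funext i
        simp
      have hadd : torusProj Λ (WithLp.toLp 2 (coord (𝓡 m) (stdBasis m) x.1 x.1 + t • ξ.ofLp))
          = torusProj Λ ((β + t) • ξ) := by
        have h1 : torusProj Λ (WithLp.toLp 2 (coord (𝓡 m) (stdBasis m) x.1 x.1 + t • ξ.ofLp))
            = torusProj Λ (WithLp.toLp 2 (coord (𝓡 m) (stdBasis m) x.1 x.1))
              + torusProj Λ (t • ξ) := rfl
        rw [h1, torus_coord_spec, add_smul]
        rfl
      rw [hl, hr, param_torus, hadd]
      exact congrArg (fun z => Real.exp (-u (torusProj Λ ((β + t) • ξ), z))) (hparam s)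
    · rw [hess]
      simp
    · rw [hess, hess]
      have h1 : (ξ.ofLp ⬝ᵥ ξ.ofLp : ℝ) = ‖ξ‖ ^ 2 := by
        rw [← real_inner_self_eq_norm_sq, PiLp.inner_apply]
        rfl
      have h2 : ‖ξ‖ ≠ 0 := norm_ne_zero_iff.2 hξ0
      simp only [Sum.elim_comp_inl, Sum.elim_comp_inr, h1, he]
      simp [h2, hab]
  have hderiv : ∀ β α, HasDerivAt (h β) (deriv (h β) α) α := by
    intro β α
    obtain ⟨W, y, ζ, η, hW, hWh, -⟩ := hlocal β α
    refine (hasDerivAt_of_comp_arctan (fun s => ?_)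
      (hasDerivAt_line hW y η 0)).differentiableAt.hasDerivAt
    have := hWh 0 s
    rwa [zero_smul, add_zero, add_zero] at this
  -- The mixed second derivative of `h` is the mixed Hessian of `W`, which vanishes.
  have hmixed : ∀ α β, HasDerivAt (fun β => deriv (h β) α) 0 β := by
    intro α β
    obtain ⟨W, y, ζ, η, hW, hWh, h0, -⟩ := hlocal β α
    have h1 : (fun β' => deriv (h β') α) = fun β' => fderiv ℝ W (y + (β' - β) • ζ) η := by
      funext β'
      have h2 := hasDerivAt_of_comp_arctan (fun s => hWh (β' - β) s)
        (hasDerivAt_line hW (y + (β' - β) • ζ) η 0)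
      rw [zero_smul, add_zero, add_sub_cancel] at h2
      exact h2.deriv
    have h4 := (hasDerivAt_line (contDiff_fderiv_apply hW η) y ζ (β - β)).comp_sub_const β β
    rw [sub_self, zero_smul, add_zero] at h4
    rw [h1]
    have h5 : fderiv ℝ (fun z => fderiv ℝ W z η) y ζ = 0 := h0
    rw [h5] at h4
    exact h4
  have hsplit := sub_eq_sub_of_deriv_deriv_eq_zero
    (fun β α => (hderiv β α).differentiableAt) hmixed
  -- By the splitting, a minimum of `h 0` and a maximum of `h · 0` are extremal on all parallel lines.
  obtain ⟨α, hα⟩ := exists_forall_le_of_periodic (f := h 0) (c := 2 * Real.pi)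
    (Differentiable.continuous fun α => (hderiv 0 α).differentiableAt)
    (fun α => by
      have : γ (α + 2 * Real.pi) = γ α := Subtype.ext (by simp [hγ, greatCircle])
      simp only [hh, this]) (by positivity)
  obtain ⟨β, hβ⟩ := exists_forall_le_of_periodic (f := fun β => -h β 0) (c := 1)
    (by
      obtain ⟨W, y, ζ, η, hW, hWh, -⟩ := hlocal 0 0
      have h1 : (fun β => h β 0) = fun β : ℝ => W (y + β • ζ) := by
        funext β
        have := hWh β 0
        simpa using this.symm
      have h2 : Continuous fun β => h β 0 := by
        rw [h1]
        have := hW.continuous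
        fun_prop
      exact h2.neg)
    (fun β => by
      have : torusProj Λ ((β + 1) • ξ) = torusProj Λ (β • ξ) := by
        rw [torusProj_eq_iff, ← sub_smul, sub_add_cancel_left, neg_one_smul]
        exact Λ.neg_mem hξ
      simp only [hh, this]) one_pos
  obtain ⟨W, y, ζ, η, hW, hWh, -, hlt⟩ := hlocal β α
  have hWy : W y = h β α := by
    have := hWh 0 0
    simpa using this
  have hη : 0 ≤ hessian W y η η := by
    refine hessian_self_nonneg_of_forall_le hW fun s => ?_
    have h1 := hWh 0 s
    rw [zero_smul, add_zero, add_zero] at h1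
    rw [hWy, h1]
    have h2 := hsplit β 0 (α + 2 * Real.arctan (s / 2)) α
    have h3 := hα (α + 2 * Real.arctan (s / 2))
    linarith
  have hζ : hessian W y ζ ζ ≤ 0 := by
    refine hessian_self_nonpos_of_forall_le hW fun t => ?_
    have h1 := hWh t 0
    rw [zero_smul, add_zero, zero_div, Real.arctan_zero, mul_zero, add_zero] at h1
    rw [hWy, h1]
    have h2 := hsplit (β + t) β α 0
    have h3 := hβ (β + t)
    simp only [neg_le_neg_iff] at h3
    linarith
  exact absurd (hlt.trans_le (div_nonpos_of_nonpos_of_nonneg hζ (by positivity))) (not_lt.2 hη)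

end NotConformallyEinstein

end

theorem proposition5p2 :
    -- `S² × T⁴`
    (∀ (Λ : Submodule ℤ (EuclideanSpace ℝ (Fin 4))) [DiscreteTopology Λ] [IsZLattice ℝ Λ],
      invariantQ (prodBasis 2 4) ((roundMetric 2).prod (flatMetric Λ))
          = -(48 * Real.pi / 25) * riemVol (stdBasis 4) (flatMetric Λ) ∧
      IsClosedManifoldWithInfinitePi1 ((𝓡 2).prod (𝓡 4)) 6 (RoundSphere 2 × FlatTorus Λ) ∧
      invariantQ (prodBasis 2 4) ((roundMetric 2).prod (flatMetric Λ)) < 0) ∧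
    -- `T² × S⁴`
    (∀ (Λ : Submodule ℤ (EuclideanSpace ℝ (Fin 2))) [DiscreteTopology Λ] [IsZLattice ℝ Λ],
      invariantL₁ (prodBasis 2 4) ((flatMetric Λ).prod (roundMetric 4))
          = -(96 * Real.pi ^ 2) * riemVol (stdBasis 2) (flatMetric Λ) ∧
      invariantL₂ (prodBasis 2 4) ((flatMetric Λ).prod (roundMetric 4))
          = -(528 * Real.pi ^ 2 / 25) * riemVol (stdBasis 2) (flatMetric Λ) ∧
      IsClosedManifoldWithInfinitePi1 ((𝓡 2).prod (𝓡 4)) 6 (FlatTorus Λ × RoundSphere 4) ∧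
      invariantL₁ (prodBasis 2 4) ((flatMetric Λ).prod (roundMetric 4)) < 0 ∧
      invariantL₂ (prodBasis 2 4) ((flatMetric Λ).prod (roundMetric 4)) < 0 ∧
      ¬ IsConformallyEinstein (prodBasis 2 4) ((flatMetric Λ).prod (roundMetric 4))) := by
  refine ⟨fun Λ _ _ => ?_, fun Λ _ _ => ?_⟩
  · have hvol := riemVol_flatMetric_pos Λ
    have hQ := invariantQ_sphere_prod_torus Λ
    refine ⟨hQ, isClosedManifoldWithInfinitePi1_sphere_prod_torus Λ, ?_⟩
    rw [hQ, neg_mul, neg_lt_zero]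
    positivity
  · have hvol := riemVol_flatMetric_pos Λ
    have hL₁ := invariantL₁_torus_prod_sphere Λ
    have hL₂ := invariantL₂_torus_prod_sphere Λ
    refine ⟨hL₁, hL₂, isClosedManifoldWithInfinitePi1_torus_prod_sphere Λ, ?_, ?_,
      not_isConformallyEinstein_torus_prod_sphere Λ (by norm_num)⟩
    · rw [hL₁, neg_mul, neg_lt_zero]
      positivity
    · rw [hL₂, neg_mul, neg_lt_zero]
      positivity
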